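/- **Setting.** A ribbon graph with flags $G$ is given by a finite set $X$ of crosses, permutations $\sigma_0,\theta,\sigma_1$ of $X$ with $\theta^2=\sigma_1^2=1$, $\theta\sigma_1=\sigma_1\theta$, $\theta x\neq x$, $\theta x\ne\sigma_1x$, $\sigma_0\theta=\theta\sigma_0^{-1}$, and $x,\theta x$ in different cycles of $\sigma_0$ for all $x$, together with a number of vertices carrying no half-ribbon. The half-ribbons are the orbits of $\theta$; those fixed pointwise by $\sigma_1$ are the flags; the edges are the orbits $\{x,\theta x,\sigma_1x,\theta\sigma_1x\}$ with $\sigma_1x\ne x$; the vertices carrying half-ribbons are the pairs of conjugate cycles of $\sigma_0$. $G$ is orientable if there is a set of crosses stable under $\sigma_0$ that contains exactly one of $x,\theta x$ for every $x$, and exactly one of $x,\sigma_1x$ whenever $\sigma_1x\neq x$; fixing such a set turns each vertex into a cyclically ordered set of half-ribbons. For an edge $e$: $G-e$ is obtained by removing the crosses of $e$ from the cycles of $\sigma_0$ (all vertices being kept, even if no half-ribbon is left on them); $G\vee e$ by making $\sigma_1$ the identity on $e$, so that the two halves of $e$ become flags; $G^e$ is the partial dual $(\sigma_0\theta_e\sigma_{1,e},\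 \sigma_{1,e}\theta_{e^c},\ \sigma_{1,e^c}\theta_e)$, where $\varphi_S$ is $\varphi$ on $S$ and the identity elsewhere (vertices without half-ribbons being kept). **Definition of $\mathrm{HU}_G$.** Let $G$ be orientable, and attach to each edge $e$ variables $\Omega_e$ and $t_e\neq0$. Represent each vertex by a plane tree of at least one triangle: a plane tree all of whose inner vertices (the triangles) have degree $3$ and whose edges are called corners, with the half-ribbons of the vertex attached to distinct leaf edges in their cyclic order; leaf edges may be left without half-ribbon. Corners attached to flags are external, all others internal. Let $\alpha$ be the antisymmetric matrix on the internal corners with $\alpha_{ij}=1$ if a triangle side is oriented (counterclockwise) from $i$ to $j$, $-1$ if from $j$ to $i$, and $0$ otherwise. Orient the edges of $G$, and let $\epsilon_{ei}=1$ if $e$ arrives at the internal corner $i$, $-1$ if it leaves $i$, $0$ otherwise. With rows and columns indexed by $(u_e),(v_e),(\lambda_e),(\mu_e),(y_i)$, put $$D=\mathrm{diag}\Big(\tfrac{\Omega_e}{t_e},\,\Omega_et_e,\,0,\,0,\,0\Big),\qquad R=\begin{pmatrix}0&0&I&0&0\\0&0&0&I&0\\-I&0&0&0&\tfrac1{\sqrt2}\epsilon\\0&-I&0&0&\tfrac1{\sqrt2}|\epsilon|\\0&0&-\tfrac1{\sqrt2}{}^t\epsilon&-\tfrac1{\sqrt2}{}^t|\epsilon|&\alpha\end{pmatrix},$$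 where $|\epsilon|$ is the entrywise absolute value, and $$\mathrm{HU}_G(\Omega,t)=2^{v(G)}\Big[\prod_et_e\Big]\det(D+R),$$ $v(G)$ being the number of vertices of $G$. **Theorem.** Every orientable ribbon graph with flags admits such choices, $\mathrm{HU}_G$ does not depend on them, and it is a polynomial in the variables $\Omega_e,t_e$. Moreover: 1. $\mathrm{HU}_{G\sqcup H}=\mathrm{HU}_G\,\mathrm{HU}_H$ for orientable ribbon graphs with flags $G,H$. 2. For every orientable ribbon graph with flags $G$ and every edge $e$ of $G$, $$\mathrm{HU}_G=t_e\,\mathrm{HU}_{G-e}+t_e\Omega_e^2\,\mathrm{HU}_{G\vee e}+\Omega_e\,\mathrm{HU}_{G^e-e}+\Omega_et_e^2\,\mathrm{HU}_{G^e\vee e}.$$ 3. If $V_n$ is an isolated vertex with $n\ge0$ flags, then $\mathrm{HU}_{V_n}=2$ if $n$ is odd and $\mathrm{HU}_{V_n}=0$ if $n$ is even. -/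

import Mathlib

open Equiv

namespace HyperbolicPolynomial

/-! ## Permutations restricted to, or induced on, a subset -/

section Perms

variable {X : Type*}

/-- `permOn φ S` is `φ` on the `φ`-invariant set `S` and the identity outside `S`. -/
noncomputable def permOn (φ : Perm X) (S : Set X) (h : ∀ x, φ x ∈ S ↔ x ∈ S) : Perm X :=
  letI : DecidablePred (· ∈ S) := Classical.decPred _
  Perm.ofSubtype (φ.subtypePerm h : Perm {x // x ∈ S})

theorem permOn_of_mem (φ : Perm X) (S : Set X) (h : ∀ x, φ x ∈ S ↔ x ∈ S) {x : X} (hx : x ∈ S) :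
    permOn φ S h x = φ x := by
  classical
  unfold permOn
  rw [Perm.ofSubtype_apply_of_mem _ hx]
  rfl

theorem permOn_of_notMem (φ : Perm X) (S : Set X) (h : ∀ x, φ x ∈ S ↔ x ∈ S) {x : X}
    (hx : x ∉ S) : permOn φ S h x = x := by
  classical
  unfold permOn
  exact Perm.ofSubtype_apply_of_not_mem _ hx

theorem exists_pow_mem [Finite X] (σ : Perm X) (S : Set X) (x : S) :
    ∃ n : ℕ, 0 < n ∧ (σ ^ n) x ∈ S :=
  ⟨orderOf σ, orderOf_pos σ, by simp [pow_orderOf_eq_one]⟩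

open Classical in
/-- The number of steps after which the `σ`-orbit of `x ∈ S` first comes back to `S`. -/
noncomputable def returnTime [Finite X] (σ : Perm X) (S : Set X) (x : S) : ℕ :=
  Nat.find (exists_pow_mem σ S x)

theorem returnTime_pos [Finite X] (σ : Perm X) (S : Set X) (x : S) : 0 < returnTime σ S x := by
  classical exact (Nat.find_spec (exists_pow_mem σ S x)).1

theorem returnTime_mem [Finite X] (σ : Perm X) (S : Set X) (x : S) :
    (σ ^ returnTime σ S x) (x : X) ∈ S := by
  classical exact (Nat.find_spec (exists_pow_mem σ S x)).2

theorem returnTime_le [Finite X] (σ : Perm X) (S : Set X) (x : S) {n : ℕ} (hn : 0 < n)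
    (h : (σ ^ n) (x : X) ∈ S) : returnTime σ S x ≤ n := by
  classical exact Nat.find_min' (exists_pow_mem σ S x) ⟨hn, h⟩

theorem firstReturn_injective [Finite X] (σ : Perm X) (S : Set X) :
    Function.Injective
      (fun x : S => (⟨(σ ^ returnTime σ S x) (x : X), returnTime_mem σ S x⟩ : S)) := by
  have key : ∀ x y : S, returnTime σ S x ≤ returnTime σ S y →
      (σ ^ returnTime σ S x) (x : X) = (σ ^ returnTime σ S y) (y : X) → x = y := by
    intro x y hle h
    obtain ⟨k, hk⟩ := Nat.exists_eq_add_of_le hle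
    rw [hk, pow_add, Perm.mul_apply] at h
    have hxy : (x : X) = (σ ^ k) (y : X) := (σ ^ returnTime σ S x).injective h
    rcases Nat.eq_zero_or_pos k with rfl | hpos
    · exact Subtype.ext (by simpa using hxy)
    · have := returnTime_le σ S y hpos (hxy ▸ x.2)
      have := returnTime_pos σ S x
      omega
  intro x y h
  have h' := congrArg Subtype.val h
  rcases le_total (returnTime σ S x) (returnTime σ S y) with hle | hle
  · exact key x y hle h'
  · exact (key y x hle h'.symm).symm

/-- The permutation induced by `σ` on `S`: the elements outside `S` are removed from the
cycles of `σ`, the cyclic order of the others being kept. -/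
noncomputable def firstReturn [Finite X] (σ : Perm X) (S : Set X) : Perm S :=
  Equiv.ofBijective _ (Finite.injective_iff_bijective.mp (firstReturn_injective σ S))

theorem firstReturn_apply [Finite X] (σ : Perm X) (S : Set X) (x : S) :
    (firstReturn σ S x : X) = (σ ^ returnTime σ S x) (x : X) := rfl

theorem firstReturn_zpow [Finite X] (σ : Perm X) (S : Set X) (x : S) (k : ℤ) :
    ∃ n : ℤ, ((firstReturn σ S ^ k) x : X) = (σ ^ n) (x : X) := by
  have hnat : ∀ (k : ℕ) (x : S), ∃ n : ℤ, ((firstReturn σ S ^ k) x : X) = (σ ^ n) (x : X) := by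
    intro k
    induction k with
    | zero => intro x; exact ⟨0, by simp⟩
    | succ k ih =>
      intro x
      obtain ⟨n, hn⟩ := ih (firstReturn σ S x)
      refine ⟨n + returnTime σ S x, ?_⟩
      rw [pow_succ, Perm.mul_apply, hn, firstReturn_apply, zpow_add, Perm.mul_apply, zpow_natCast]
  obtain ⟨k, rfl | rfl⟩ := k.eq_nat_or_neg
  · simpa using hnat k x
  · obtain ⟨n, hn⟩ := hnat k ((firstReturn σ S ^ (-(k : ℤ))) x)
    refine ⟨-n, ?_⟩
    have : (firstReturn σ S ^ k) ((firstReturn σ S ^ (-(k : ℤ))) x) = x := by simp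
    rw [this] at hn
    rw [hn]
    simp

end Perms

/-! ## Ribbon graphs with flags as combinatorial maps -/

/-- A ribbon graph with flags, as a combinatorial map on the set `X` of crosses.  The orbits of
`θ` are the half-ribbons; those fixed pointwise by `σ₁` are the flags, the other ones are the
half-edges; the edges are the orbits `{x, θ x, σ₁ x, θ σ₁ x}` with `σ₁ x ≠ x`.  The vertices
carrying at least one half-ribbon are the pairs of conjugate cycles of `σ₀`.  Vertices without any
half-ribbon carry no cross, so that their number `bare` is recorded separately. -/
structure RibbonGraph (X : Type*) where
  σ₀ : Perm X
  θ : Perm X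
  σ₁ : Perm X
  bare : ℕ
  θ_θ : ∀ x, θ (θ x) = x
  σ₁_σ₁ : ∀ x, σ₁ (σ₁ x) = x
  θ_σ₁ : ∀ x, θ (σ₁ x) = σ₁ (θ x)
  θ_ne : ∀ x, θ x ≠ x
  θ_ne_σ₁ : ∀ x, θ x ≠ σ₁ x
  σ₀_θ : ∀ x, σ₀ (θ x) = θ (σ₀⁻¹ x)
  orbit_ne : ∀ x, ¬ σ₀.SameCycle x (θ x)

namespace RibbonGraph

variable {X Y : Type*}

section Basics

variable (G : RibbonGraph X)

theorem σ₀_zpow_θ (k : ℤ) (x : X) : (G.σ₀ ^ k) (G.θ x) = G.θ ((G.σ₀ ^ (-k)) x) := by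
  have h1 : G.θ * G.σ₀⁻¹ = G.σ₀ * G.θ := by
    ext x; simp [Perm.mul_apply, G.σ₀_θ]
  have h2 : SemiconjBy G.θ G.σ₀⁻¹ G.σ₀ := h1
  have h3 := (h2.zpow_right k).eq
  have h4 := congrArg (fun p : Perm X => p x) h3
  simp only [Perm.mul_apply, inv_zpow'] at h4
  exact h4.symm

theorem sameCycle_θ {x y : X} (h : G.σ₀.SameCycle x y) : G.σ₀.SameCycle (G.θ x) (G.θ y) := by
  obtain ⟨k, hk⟩ := h
  exact ⟨-k, by rw [σ₀_zpow_θ, neg_neg, hk]⟩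

/-- Two crosses lie at the same vertex when they belong to the same pair of conjugate cycles. -/
def vertexSetoid : Setoid X where
  r x y := G.σ₀.SameCycle x y ∨ G.σ₀.SameCycle (G.θ x) y
  iseqv :=
    { refl := fun x => Or.inl (Perm.SameCycle.refl _ x)
      symm := by
        rintro x y (h | h)
        · exact Or.inl h.symm
        · exact Or.inr (by simpa [G.θ_θ] using (G.sameCycle_θ h).symm)
      trans := by
        rintro x y z (h | h) (h' | h')
        · exact Or.inl (h.trans h')
        · exact Or.inr ((G.sameCycle_θ h).trans h')
        · exact Or.inr (h.trans h')
        · have := G.sameCycle_θ h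
          rw [G.θ_θ] at this
          exact Or.inl (this.trans h') }

/-- The set of vertices. -/
def Vertex : Type _ := Quotient G.vertexSetoid ⊕ Fin G.bare

instance [Finite X] : Finite G.Vertex :=
  inferInstanceAs (Finite (Quotient G.vertexSetoid ⊕ Fin G.bare))

/-- The set of crosses of the edge through the cross `x` (of the flag, if `σ₁ x = x`). -/
def edge (x : X) : Set X := {x, G.θ x, G.σ₁ x, G.θ (G.σ₁ x)}

theorem mem_edge_self (x : X) : x ∈ G.edge x := by simp [edge]

theorem θ_mem_edge_of_mem {x y : X} (h : y ∈ G.edge x) : G.θ y ∈ G.edge x := by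
  simp only [edge, Set.mem_insert_iff, Set.mem_singleton_iff] at h ⊢
  rcases h with rfl | rfl | rfl | rfl <;> simp [G.θ_θ]

theorem θ_mem_edge (x y : X) : G.θ y ∈ G.edge x ↔ y ∈ G.edge x :=
  ⟨fun h => by simpa [G.θ_θ] using G.θ_mem_edge_of_mem h, G.θ_mem_edge_of_mem⟩

theorem σ₁_mem_edge_of_mem {x y : X} (h : y ∈ G.edge x) : G.σ₁ y ∈ G.edge x := by
  simp only [edge, Set.mem_insert_iff, Set.mem_singleton_iff] at h ⊢
  rcases h with rfl | rfl | rfl | rfl <;> simp [G.σ₁_σ₁, G.θ_σ₁]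

theorem σ₁_mem_edge (x y : X) : G.σ₁ y ∈ G.edge x ↔ y ∈ G.edge x :=
  ⟨fun h => by simpa [G.σ₁_σ₁] using G.σ₁_mem_edge_of_mem h, G.σ₁_mem_edge_of_mem⟩

theorem θ_mem_compl (x y : X) : G.θ y ∈ (G.edge x)ᶜ ↔ y ∈ (G.edge x)ᶜ :=
  not_congr (G.θ_mem_edge x y)

theorem σ₁_mem_compl (x y : X) : G.σ₁ y ∈ (G.edge x)ᶜ ↔ y ∈ (G.edge x)ᶜ :=
  not_congr (G.σ₁_mem_edge x y)

theorem σ₁_ne_of_mem_edge {x y : X} (hx : G.σ₁ x ≠ x) (h : y ∈ G.edge x) : G.σ₁ y ≠ y := by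
  simp only [edge, Set.mem_insert_iff, Set.mem_singleton_iff] at h
  rcases h with rfl | rfl | rfl | rfl
  · exact hx
  · rw [← G.θ_σ₁]; exact fun h => hx (G.θ.injective h)
  · exact fun h => hx (G.σ₁.injective h)
  · rw [← G.θ_σ₁]; exact fun h => hx (G.σ₁.injective (G.θ.injective h))

/-- A family of real numbers attached to the edges, written as a function of the crosses which is
constant on `{x, θ x, σ₁ x, θ σ₁ x}`; its values at flags play no role. -/
def IsEdgeFunction (w : X → ℝ) : Prop := (∀ x, w (G.θ x) = w x) ∧ (∀ x, w (G.σ₁ x) = w x)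

/-- `pos` selects one of the two conjugate cycles of each vertex, that is a direction of rotation
around each vertex, in such a way that no edge is twisted. -/
structure IsOrientation (pos : Set X) : Prop where
  σ₀_mem : ∀ x, G.σ₀ x ∈ pos ↔ x ∈ pos
  θ_mem : ∀ x, G.θ x ∈ pos ↔ x ∉ pos
  σ₁_mem : ∀ x, G.σ₁ x ≠ x → (G.σ₁ x ∈ pos ↔ x ∉ pos)

/-- The surface of the ribbon graph is orientable. -/
def Orientable : Prop := ∃ pos : Set X, G.IsOrientation pos

/-- An isolated vertex with `n` flags: a single vertex, no edges, `n` half-ribbons. -/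
def IsIsolatedVertex (n : ℕ) : Prop :=
  Nat.card G.Vertex = 1 ∧ (∀ x, G.σ₁ x = x) ∧ Nat.card X = 2 * n

end Basics

/-! ### Operations -/

/-- Disjoint union. -/
def disjointUnion (G : RibbonGraph X) (H : RibbonGraph Y) : RibbonGraph (X ⊕ Y) where
  σ₀ := sumCongr G.σ₀ H.σ₀
  θ := sumCongr G.θ H.θ
  σ₁ := sumCongr G.σ₁ H.σ₁
  bare := G.bare + H.bare
  θ_θ := by rintro (x | x) <;> simp [G.θ_θ, H.θ_θ]
  σ₁_σ₁ := by rintro (x | x) <;> simp [G.σ₁_σ₁, H.σ₁_σ₁]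
  θ_σ₁ := by rintro (x | x) <;> simp [G.θ_σ₁, H.θ_σ₁]
  θ_ne := by rintro (x | x) <;> simp [G.θ_ne, H.θ_ne]
  θ_ne_σ₁ := by rintro (x | x) <;> simp [G.θ_ne_σ₁, H.θ_ne_σ₁]
  σ₀_θ := by
    have hinv : (sumCongr G.σ₀ H.σ₀ : Perm (X ⊕ Y))⁻¹ = sumCongr G.σ₀⁻¹ H.σ₀⁻¹ := rfl
    rintro (x | x) <;> simp [hinv, G.σ₀_θ, H.σ₀_θ]
  orbit_ne := by
    have hpow : ∀ k : ℤ, (sumCongr G.σ₀ H.σ₀ : Perm (X ⊕ Y)) ^ k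
        = sumCongr (G.σ₀ ^ k) (H.σ₀ ^ k) := fun k =>
      (map_zpow (Perm.sumCongrHom X Y) (G.σ₀, H.σ₀) k).symm
    rintro (x | x) ⟨k, hk⟩
    · rw [hpow] at hk
      exact G.orbit_ne x ⟨k, by simpa using hk⟩
    · rw [hpow] at hk
      exact H.orbit_ne x ⟨k, by simpa using hk⟩

/-- Deletion of the edge through `x`: its crosses are removed from the cycles of `σ₀`.
Each vertex all of whose half-ribbons belong to the deleted edge survives as a vertex without
half-ribbons. -/
noncomputable def delete [Finite X] (G : RibbonGraph X) (x : X) :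
    RibbonGraph ((G.edge x)ᶜ : Set X) where
  σ₀ := firstReturn G.σ₀ (G.edge x)ᶜ
  θ := G.θ.subtypePerm (G.θ_mem_compl x)
  σ₁ := G.σ₁.subtypePerm (G.σ₁_mem_compl x)
  bare := G.bare +
    Nat.card {v : Quotient G.vertexSetoid // ∀ y, Quotient.mk G.vertexSetoid y = v → y ∈ G.edge x}
  θ_θ y := Subtype.ext (by simp [G.θ_θ])
  σ₁_σ₁ y := Subtype.ext (by simp [G.σ₁_σ₁])
  θ_σ₁ y := Subtype.ext (by simp [G.θ_σ₁])
  θ_ne y h := G.θ_ne y (by simpa using congrArg Subtype.val h)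
  θ_ne_σ₁ y h := G.θ_ne_σ₁ y (by simpa using congrArg Subtype.val h)
  σ₀_θ := by
    set S : Set X := (G.edge x)ᶜ with hS
    set s := firstReturn G.σ₀ S with hs
    set T : Perm S := G.θ.subtypePerm (G.θ_mem_compl x) with hT
    have hTv : ∀ y : S, (T y : X) = G.θ y := fun y => rfl
    -- the first return of `θ (s z)` is `θ z`
    have key : ∀ z : S, s (T (s z)) = T z := by
      intro z
      set n := returnTime G.σ₀ S z with hn
      have hnpos : 0 < n := returnTime_pos G.σ₀ S z
      have hval : ∀ k : ℕ, k ≤ n →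
          (G.σ₀ ^ k) (T (s z) : X) = G.θ ((G.σ₀ ^ (n - k)) (z : X)) := by
        intro k hk
        have h1 := G.σ₀_zpow_θ k ((G.σ₀ ^ n) (z : X))
        rw [hTv, hs, firstReturn_apply, ← hn, ← zpow_natCast G.σ₀ k, h1]
        congr 1
        rw [← zpow_natCast G.σ₀ n, ← zpow_natCast G.σ₀ (n - k), ← Perm.mul_apply, ← zpow_add]
        congr 2
        omega
      have hret : returnTime G.σ₀ S (T (s z)) = n := by
        apply le_antisymm
        · apply returnTime_le _ _ _ hnpos
          rw [hval n le_rfl]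
          simp only [Nat.sub_self, pow_zero, Perm.one_apply]
          exact (G.θ_mem_compl x z).mpr z.2
        · by_contra hlt
          push Not at hlt
          set m := returnTime G.σ₀ S (T (s z)) with hm
          have hmpos : 0 < m := returnTime_pos G.σ₀ S _
          have hmem : (G.σ₀ ^ m) (T (s z) : X) ∈ S := returnTime_mem G.σ₀ S _
          rw [hval m hlt.le] at hmem
          have hmem' : (G.σ₀ ^ (n - m)) (z : X) ∈ S := (G.θ_mem_compl x _).mp hmem
          have := returnTime_le G.σ₀ S z (by omega) hmem'
          omega
      apply Subtype.ext
      rw [hs, firstReturn_apply, ← hs, hret, hval n le_rfl, hTv]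
      simp
    intro y
    have := key (s⁻¹ y)
    simpa using this
  orbit_ne := by
    rintro y ⟨k, hk⟩
    obtain ⟨n, hn⟩ := firstReturn_zpow G.σ₀ (G.edge x)ᶜ y k
    refine G.orbit_ne y ⟨n, ?_⟩
    rw [← hn, hk]
    rfl

/-- Cut of the edge through `x`: its two half-edges become flags. -/
noncomputable def cut (G : RibbonGraph X) (x : X) : RibbonGraph X where
  σ₀ := G.σ₀
  θ := G.θ
  σ₁ := permOn G.σ₁ (G.edge x)ᶜ (G.σ₁_mem_compl x)
  bare := G.bare
  θ_θ := G.θ_θ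
  σ₁_σ₁ y := by
    by_cases hy : y ∈ (G.edge x)ᶜ
    · rw [permOn_of_mem _ _ _ hy, permOn_of_mem _ _ _ ((G.σ₁_mem_compl x y).mpr hy), G.σ₁_σ₁]
    · rw [permOn_of_notMem _ _ _ hy, permOn_of_notMem _ _ _ hy]
  θ_σ₁ y := by
    by_cases hy : y ∈ (G.edge x)ᶜ
    · rw [permOn_of_mem _ _ _ hy, permOn_of_mem _ _ _ ((G.θ_mem_compl x y).mpr hy), G.θ_σ₁]
    · rw [permOn_of_notMem _ _ _ hy,
        permOn_of_notMem _ _ _ (fun h => hy ((G.θ_mem_compl x y).mp h))]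
  θ_ne := G.θ_ne
  θ_ne_σ₁ y := by
    by_cases hy : y ∈ (G.edge x)ᶜ
    · rw [permOn_of_mem _ _ _ hy]; exact G.θ_ne_σ₁ y
    · rw [permOn_of_notMem _ _ _ hy]; exact G.θ_ne y
  σ₀_θ := G.σ₀_θ
  orbit_ne := G.orbit_ne

section PartialDual

variable (G : RibbonGraph X) (x : X)

theorem not_sameCycle_of_reflect {s T : Perm X} (hs : ∀ y, s (T y) = T (s⁻¹ y))
    (h1 : ∀ y, T y ≠ y) (h2 : ∀ y, s y ≠ T y) (y : X) :
    ¬ s.SameCycle y (T y) := by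
  have hz : ∀ (k : ℤ) (z : X), (s ^ k) (T z) = T ((s ^ (-k)) z) := by
    intro k z
    have h1 : T * s⁻¹ = s * T := by
      ext z; simp [Perm.mul_apply, hs]
    have h3 := ((show SemiconjBy T s⁻¹ s from h1).zpow_right k).eq
    have h4 := congrArg (fun p : Perm X => p z) h3
    simp only [Perm.mul_apply, inv_zpow'] at h4
    exact h4.symm
  rintro ⟨k, hk⟩
  obtain ⟨j, rfl | rfl⟩ := k.even_or_odd'
  · apply h1 ((s ^ j) y)
    have := hz (-j) y
    rw [neg_neg, ← hk, ← Perm.mul_apply, ← zpow_add] at this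
    rw [← this]
    congr 2
    ring
  · apply h2 ((s ^ j) y)
    have := hz (-j) y
    rw [neg_neg, ← hk, ← Perm.mul_apply, ← zpow_add] at this
    rw [← this, ← Perm.mul_apply, ← zpow_one_add]
    congr 2
    ring

/-- `σ₀ θ_e σ₁_e`, with `e` the edge through `x`. -/
noncomputable def dualσ₀ : Perm X :=
  G.σ₀ * permOn G.θ (G.edge x) (G.θ_mem_edge x) * permOn G.σ₁ (G.edge x) (G.σ₁_mem_edge x)

/-- `σ₁_e θ_{eᶜ}`, with `e` the edge through `x`. -/
noncomputable def dualθ : Perm X :=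
  permOn G.σ₁ (G.edge x) (G.σ₁_mem_edge x) * permOn G.θ (G.edge x)ᶜ (G.θ_mem_compl x)

/-- `σ₁_{eᶜ} θ_e`, with `e` the edge through `x`. -/
noncomputable def dualσ₁ : Perm X :=
  permOn G.σ₁ (G.edge x)ᶜ (G.σ₁_mem_compl x) * permOn G.θ (G.edge x) (G.θ_mem_edge x)

variable {x} {y : X}

theorem dualσ₀_of_mem (hy : y ∈ G.edge x) : G.dualσ₀ x y = G.σ₀ (G.θ (G.σ₁ y)) := by
  rw [dualσ₀, Perm.mul_apply, Perm.mul_apply, permOn_of_mem G.σ₁ _ _ hy,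
    permOn_of_mem _ _ _ ((G.σ₁_mem_edge x y).mpr hy)]

theorem dualσ₀_of_notMem (hy : y ∉ G.edge x) : G.dualσ₀ x y = G.σ₀ y := by
  rw [dualσ₀, Perm.mul_apply, Perm.mul_apply, permOn_of_notMem G.σ₁ _ _ hy,
    permOn_of_notMem _ _ _ hy]

theorem dualθ_of_mem (hy : y ∈ G.edge x) : G.dualθ x y = G.σ₁ y := by
  rw [dualθ, Perm.mul_apply, permOn_of_notMem G.θ _ _ (Set.notMem_compl_iff.mpr hy), permOn_of_mem _ _ _ hy]

theorem dualθ_of_notMem (hy : y ∉ G.edge x) : G.dualθ x y = G.θ y := by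
  rw [dualθ, Perm.mul_apply, permOn_of_mem G.θ _ _ hy,
    permOn_of_notMem _ _ _ ((G.θ_mem_compl x y).mpr hy)]

theorem dualσ₁_of_mem (hy : y ∈ G.edge x) : G.dualσ₁ x y = G.θ y := by
  rw [dualσ₁, Perm.mul_apply, permOn_of_mem G.θ _ _ hy,
    permOn_of_notMem _ _ _ (Set.notMem_compl_iff.mpr ((G.θ_mem_edge x y).mpr hy))]

theorem dualσ₁_of_notMem (hy : y ∉ G.edge x) : G.dualσ₁ x y = G.σ₁ y := by
  rw [dualσ₁, Perm.mul_apply, permOn_of_notMem G.θ _ _ hy, permOn_of_mem _ _ _ hy]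

theorem σ₀_ne_θ (y : X) : G.σ₀ y ≠ G.θ y := fun h =>
  G.orbit_ne y (h ▸ Perm.sameCycle_apply_right.mpr (Perm.SameCycle.refl _ y))

theorem dualθ_dualθ (y : X) : G.dualθ x (G.dualθ x y) = y := by
  by_cases hy : y ∈ G.edge x
  · rw [dualθ_of_mem G hy, dualθ_of_mem G ((G.σ₁_mem_edge x y).mpr hy), G.σ₁_σ₁]
  · rw [dualθ_of_notMem G hy, dualθ_of_notMem G ((G.θ_mem_compl x y).mpr hy), G.θ_θ]

theorem dualθ_ne (hx : G.σ₁ x ≠ x) (y : X) : G.dualθ x y ≠ y := by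
  by_cases hy : y ∈ G.edge x
  · rw [dualθ_of_mem G hy]; exact G.σ₁_ne_of_mem_edge hx hy
  · rw [dualθ_of_notMem G hy]; exact G.θ_ne y

theorem dualσ₀_dualθ (y : X) : G.dualσ₀ x (G.dualθ x y) = G.dualθ x ((G.dualσ₀ x)⁻¹ y) := by
  -- `σ₀' θ' σ₀' = θ'`
  have h0 : ∀ w, G.σ₀ (G.θ (G.σ₀ w)) = G.θ w := fun w => by simp [G.σ₀_θ]
  have h1 : ∀ w, G.dualσ₀ x (G.dualθ x w) = G.σ₀ (G.θ w) := by
    intro w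
    by_cases hw : w ∈ G.edge x
    · rw [dualθ_of_mem G hw, dualσ₀_of_mem G ((G.σ₁_mem_edge x w).mpr hw), G.σ₁_σ₁]
    · rw [dualθ_of_notMem G hw, dualσ₀_of_notMem G ((G.θ_mem_compl x w).mpr hw)]
  have h2 : ∀ w, G.dualσ₀ x (G.dualθ x (G.dualσ₀ x w)) = G.dualθ x w := by
    intro w
    rw [h1]
    by_cases hw : w ∈ G.edge x
    · rw [dualσ₀_of_mem G hw, h0, dualθ_of_mem G hw, G.θ_θ]
    · rw [dualσ₀_of_notMem G hw, h0, dualθ_of_notMem G hw]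
  simpa using h2 ((G.dualσ₀ x)⁻¹ y)

theorem dualσ₀_ne_dualθ (y : X) : G.dualσ₀ x y ≠ G.dualθ x y := by
  by_cases hy : y ∈ G.edge x
  · rw [dualσ₀_of_mem G hy, dualθ_of_mem G hy]
    have := G.σ₀_ne_θ (G.θ (G.σ₁ y))
    rwa [G.θ_θ] at this
  · rw [dualσ₀_of_notMem G hy, dualθ_of_notMem G hy]
    exact G.σ₀_ne_θ y

/-- Partial dual `G^e` with respect to the edge `e` through `x`:
`(σ₀ θ_e σ₁_e, σ₁_e θ_{eᶜ}, σ₁_{eᶜ} θ_e)`. -/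
noncomputable def partialDual (x : X) (hx : G.σ₁ x ≠ x) : RibbonGraph X where
  σ₀ := G.dualσ₀ x
  θ := G.dualθ x
  σ₁ := G.dualσ₁ x
  bare := G.bare
  θ_θ := G.dualθ_dualθ
  σ₁_σ₁ y := by
    by_cases hy : y ∈ G.edge x
    · rw [dualσ₁_of_mem G hy, dualσ₁_of_mem G ((G.θ_mem_edge x y).mpr hy), G.θ_θ]
    · rw [dualσ₁_of_notMem G hy, dualσ₁_of_notMem G ((G.σ₁_mem_compl x y).mpr hy), G.σ₁_σ₁]
  θ_σ₁ y := by
    by_cases hy : y ∈ G.edge x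
    · rw [dualσ₁_of_mem G hy, dualθ_of_mem G hy, dualθ_of_mem G ((G.θ_mem_edge x y).mpr hy),
        dualσ₁_of_mem G ((G.σ₁_mem_edge x y).mpr hy), G.θ_σ₁]
    · rw [dualσ₁_of_notMem G hy, dualθ_of_notMem G hy,
        dualθ_of_notMem G ((G.σ₁_mem_compl x y).mpr hy),
        dualσ₁_of_notMem G ((G.θ_mem_compl x y).mpr hy), G.θ_σ₁]
  θ_ne := G.dualθ_ne hx
  θ_ne_σ₁ y := by
    by_cases hy : y ∈ G.edge x
    · rw [dualσ₁_of_mem G hy, dualθ_of_mem G hy]; exact (G.θ_ne_σ₁ y).symm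
    · rw [dualσ₁_of_notMem G hy, dualθ_of_notMem G hy]; exact G.θ_ne_σ₁ y
  σ₀_θ := G.dualσ₀_dualθ
  orbit_ne := not_sameCycle_of_reflect G.dualσ₀_dualθ (G.dualθ_ne hx)
    G.dualσ₀_ne_dualθ

end PartialDual

end RibbonGraph

/-! ## Vertices as plane trees of triangles -/

/-- A rooted plane binary tree whose leaves may carry a label.  It stands for a plane tree with
inner vertices of degree `3` (the triangles) from which one leaf, lying below the root, has been
removed; `node l r` is a triangle whose corners, in cyclic order, are the one below, the stem of
`l` and the stem of `r`. -/
inductive PlaneTree (X : Type*) : Type _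
  | leaf (label : Option X) : PlaneTree X
  | node (left right : PlaneTree X) : PlaneTree X

/-- The oriented sides of a triangle with corners `none`, `sl`, `sr` glued to two families of
triangles along `sl` and `sr`. -/
def joinStep {A B : Type} (stepA : A → A → Prop) (stepB : B → B → Prop) (sl : A) (sr : B) :
    Option (A ⊕ B) → Option (A ⊕ B) → Prop
  | none, some (Sum.inl a) => a = sl
  | some (Sum.inl a), some (Sum.inr b) => a = sl ∧ b = sr
  | some (Sum.inr b), none => b = sr
  | some (Sum.inl a), some (Sum.inl a') => stepA a a'
  | some (Sum.inr b), some (Sum.inr b') => stepB b b'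
  | _, _ => False

namespace PlaneTree

variable {X : Type*}

/-- The corners: edges of the plane tree, including the one below the root. -/
def Corner : PlaneTree X → Type
  | leaf _ => Unit
  | node l r => Option (l.Corner ⊕ r.Corner)

theorem finite_corner : ∀ T : PlaneTree X, Finite T.Corner
  | leaf _ => inferInstanceAs (Finite Unit)
  | node l r =>
    haveI := finite_corner l
    haveI := finite_corner r
    inferInstanceAs (Finite (Option (l.Corner ⊕ r.Corner)))

instance (T : PlaneTree X) : Finite T.Corner := finite_corner T

/-- The corner below the root. -/
def stem : (T : PlaneTree X) → T.Corner
  | leaf _ => ()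
  | node _ _ => none

/-- `T.Step i j`: there is a triangle side oriented from the corner `i` to the corner `j`. -/
def Step : (T : PlaneTree X) → T.Corner → T.Corner → Prop
  | leaf _ => fun _ _ => False
  | node l r => joinStep l.Step r.Step l.stem r.stem

/-- The label of a corner: the one of the leaf, and none for a corner common to two triangles. -/
def cornerLabel : (T : PlaneTree X) → T.Corner → Option X
  | leaf a => fun _ => a
  | node l r => fun
    | none => none
    | some (Sum.inl c) => l.cornerLabel c
    | some (Sum.inr c) => r.cornerLabel c

/-- The labels of the leaves above the root, from left to right. -/
def labels : PlaneTree X → List X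
  | leaf a => a.toList
  | node l r => l.labels ++ r.labels

end PlaneTree

/-- A plane tree of triangles (at least one), rooted at one of its leaves.  Some of its leaves
carry a label. -/
structure TriangleTree (X : Type*) where
  root : Option X
  left : PlaneTree X
  right : PlaneTree X

namespace TriangleTree

variable {X : Type*} (T : TriangleTree X)

/-- The corners of the triangles. -/
def Corner : Type := Option (T.left.Corner ⊕ T.right.Corner)

instance : Finite T.Corner :=
  inferInstanceAs (Finite (Option (T.left.Corner ⊕ T.right.Corner)))

/-- `T.Step i j`: there is a triangle side oriented from the corner `i` to the corner `j`. -/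
def Step : T.Corner → T.Corner → Prop :=
  joinStep T.left.Step T.right.Step T.left.stem T.right.stem

/-- The half-ribbon attached to a corner, if any. -/
def cornerLabel : T.Corner → Option X
  | none => T.root
  | some (Sum.inl c) => T.left.cornerLabel c
  | some (Sum.inr c) => T.right.cornerLabel c

/-- The labels, in cyclic order around the tree. -/
def labels : List X := T.root.toList ++ (T.left.labels ++ T.right.labels)

end TriangleTree

/-! ## The Gaussian quadratic form and its determinant -/

/-- Indices of the quadratic form: `((u, v), (lam, mu)), y`, with `u, v, lam, mu` indexed by the
edges and `y` by the internal corners. -/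
abbrev GaussIndex (E C : Type*) : Type _ := ((E ⊕ E) ⊕ (E ⊕ E)) ⊕ C

open Classical in
/-- The diagonal matrix `D`: `Ω_e / t_e` on `u_e`, `Ω_e t_e` on `v_e`, and `0` elsewhere. -/
noncomputable def diagPart {E C : Type*} (Ω t : E → ℝ) :
    Matrix (GaussIndex E C) (GaussIndex E C) ℝ :=
  Matrix.diagonal
    (Sum.elim (Sum.elim (Sum.elim (fun e => Ω e / t e) (fun e => Ω e * t e)) (fun _ => 0))
      (fun _ => 0))

open Classical in
/-- The antisymmetric matrix `R`, with `ε` the edge-corner incidence matrix and `α` the adjacency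
matrix of the internal corners. -/
noncomputable def antisymmPart {E C : Type*} (ε : Matrix E C ℝ) (α : Matrix C C ℝ) :
    Matrix (GaussIndex E C) (GaussIndex E C) ℝ :=
  let B : Matrix ((E ⊕ E) ⊕ (E ⊕ E)) C ℝ :=
    Matrix.fromRows 0
      (Matrix.fromRows ((√2)⁻¹ • ε) ((√2)⁻¹ • ε.map (fun r => |r|)))
  Matrix.fromBlocks (Matrix.fromBlocks 0 1 (-1) 0) B (-B.transpose) α

namespace RibbonGraph

variable {X : Type*}

/-- The choices needed to write the Gaussian quadratic form of `G`: a direction of rotation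
around the vertices, an orientation of the edges, and a plane tree of triangles for each
vertex. -/
structure Presentation (G : RibbonGraph X) where
  /-- The crosses at which the vertices are turned around counterclockwise: one for each
  half-ribbon. -/
  pos : Set X
  isOrientation : G.IsOrientation pos
  /-- The half-edges from which the edges leave: exactly one for each edge. -/
  tail : Set X
  tail_mem : ∀ x ∈ tail, x ∈ pos ∧ G.σ₁ x ≠ x
  tail_iff : ∀ x ∈ pos, G.σ₁ x ≠ x → (x ∈ tail ↔ G.θ (G.σ₁ x) ∉ tail)
  /-- The plane tree of triangles representing a vertex. -/
  tree : G.Vertex → TriangleTree X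
  nodup_labels : ∀ v, (tree v).labels.Nodup
  /-- The labels are the half-ribbons of the vertex. -/
  mem_labels : ∀ v x, x ∈ (tree v).labels ↔ x ∈ pos ∧ Sum.inl (Quotient.mk G.vertexSetoid x) = v
  /-- The cyclic order of the labels around the tree is that of the half-ribbons around the
  vertex. -/
  next_label : ∀ v, ∀ (k : ℕ) (hk : k < (tree v).labels.length),
    G.σ₀ ((tree v).labels[k]) =
      (tree v).labels[(k + 1) % (tree v).labels.length]'(Nat.mod_lt _ (by omega))

namespace Presentation

variable {G : RibbonGraph X} (P : Presentation G)

/-- All the corners of all the triangles. -/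
def Corner : Type _ := Σ v : G.Vertex, (P.tree v).Corner

instance [Finite X] : Finite P.Corner :=
  inferInstanceAs (Finite (Σ v : G.Vertex, (P.tree v).Corner))

/-- The half-ribbon attached to a corner, if any. -/
def cornerLabel (c : P.Corner) : Option X := (P.tree c.1).cornerLabel c.2

/-- There is a triangle side oriented from the corner `i` to the corner `j`. -/
inductive Step : P.Corner → P.Corner → Prop
  | mk (v : G.Vertex) (i j : (P.tree v).Corner) (h : (P.tree v).Step i j) : Step ⟨v, i⟩ ⟨v, j⟩

/-- A corner is external if it is attached to a flag. -/
def IsExternal (c : P.Corner) : Prop := ∃ x, P.cornerLabel c = some x ∧ G.σ₁ x = x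

/-- Internal corners: attached to an edge, common to two triangles, or attached to nothing. -/
def InternalCorner : Type _ := {c : P.Corner // ¬ P.IsExternal c}

instance [Finite X] : Finite P.InternalCorner :=
  inferInstanceAs (Finite {c : P.Corner // ¬ P.IsExternal c})

/-- The edges of `G`, each of them represented by the half-edge from which it leaves. -/
abbrev EdgeIndex : Type _ := {x : X // x ∈ P.tail}

open Classical in
/-- The antisymmetric adjacency matrix `α` of the internal corners. -/
noncomputable def adjacency : Matrix P.InternalCorner P.InternalCorner ℝ :=
  Matrix.of fun i j =>
    if P.Step i.1 j.1 then 1 else if P.Step j.1 i.1 then -1 else 0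

open Classical in
/-- The incidence matrix `ε`: `1` if the edge arrives at the corner, `-1` if it leaves it. -/
noncomputable def incidence : Matrix P.EdgeIndex P.InternalCorner ℝ :=
  Matrix.of fun e i =>
    if P.cornerLabel i.1 = some (G.θ (G.σ₁ e.1)) then 1
    else if P.cornerLabel i.1 = some e.1 then -1 else 0

open Classical in
/-- `2 ^ v(G) * (∏ e, t e) * det (D + R)`, computed with the given choices. -/
noncomputable def value [Finite X] (Ω t : X → ℝ) : ℝ :=
  letI : Fintype P.EdgeIndex := Fintype.ofFinite _
  letI : Fintype P.InternalCorner := Fintype.ofFinite _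
  2 ^ Nat.card G.Vertex * (∏ e : P.EdgeIndex, t e.1) *
    (diagPart (fun e : P.EdgeIndex => Ω e.1) (fun e => t e.1)
      + antisymmPart P.incidence P.adjacency).det

end Presentation

open Classical in
/-- The first hyperbolic polynomial of an orientable ribbon graph with flags, evaluated at real
values of the edge variables `Ω` and `t` (with `t e ≠ 0` for all edges `e`).  The choices on which
the determinant is built are arbitrary. -/
noncomputable def HU [Finite X] (G : RibbonGraph X) (Ω t : X → ℝ) : ℝ :=
  if h : Nonempty (Presentation G) then h.some.value Ω t else 0

end RibbonGraph

end HyperbolicPolynomial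

/-! The variables `u`, `v`, `lam`, `mu` are integrated out first. Their block has determinant 1, so
a Schur complement leaves `det (α + W)` on the internal corners, where `W` couples only the two ends
of each edge (`det_diagPart_add_antisymmPart`, `sum_incidence`). External corners are then put back
as unit rows (`det_internal`).

The triangles can now be eliminated. On the half-corners (a triangle and one of its corners) let `P`
be the rotation of the triangles; `α` is `P - P⁻¹` pushed down to the corners. From `P ^ 3 = 1`
follows `(P⁻¹ - P) (1 + P) = 1 - P`, so that writing the corner variables as `y = (1 + P) q` gives a
system of first order: away from the labels its equations are `q h = q (P (g h))`, where `g`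
exchanges glued half-corners (`det_glue`). Thus `q` is constant along the walk around a tree until a
label is met, and the unlabelled unknowns disappear by triangular substitution (`det_contract`,
`det_triangulation`). There remains `det (C (1 + S) + E (1 - S))`, where `S` is `σ₀` on the
half-ribbons, `C` the coupling and `E` the indicator of the half-edges (`formMatrix_eq`). As for the
powers of 2, `det (1 + P)` contributes one per triangle and each gluing takes one back; a tree has
one more triangle than gluings, which explains the factor `2 ^ v(G)` (`det_full`). A tree without
labels has the constants in its kernel, so a vertex without half-ribbons gives the value 0.

This closed form no longer sees the trees. Two directions of rotation differ by inverting `S` on a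
stable set; transposition turns this into a change of order of the factors, and `det (C A + E B) =
det (A C + B E)` if `A` commutes with `B` and `C` with `E` (`det_mul_add_mul_comm`,
`det_rotation_reverse`). Polynomiality holds because the factor `t e` clears the denominator in the
row of `u e`.

For the reduction relation, let `p`, `p'` be the unknowns at the two ends of `e`, and `q`, `q'`
those at the half-ribbons which follow. The determinant is an alternating form `F` of the two rows
`r`, `r'` of `e`, and `F r r' = -F (r + r') (r - r') / 2`. The coefficient of the coupling is `Ω t`
in `r + r'` and `Ω / t` in `r - r'`, whence exactly four terms, with rows `p ∓ q`, `p' ∓ q'` or `p ∓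
q'`, `p' ∓ q` (`alternating_expansion`). Rows with a plus sign are those of flags, so the edge is
cut; rows with a minus sign identify each half-ribbon with the next one, so the edge is deleted
(`det_uncoupledMatrix`); exchanging `q` and `q'` is partial duality.

Multiplicativity is a block decomposition. An isolated vertex with `n > 0` flags gives `det (1 + S)`
for an `n`-cycle `S`, that is `1 - (-1) ^ n`. -/

namespace HyperbolicPolynomial

/-! ### Determinant identities: exchange of factors, contraction, gluing -/

section LinearAlgebra

variable {V : Type*} [Fintype V] [DecidableEq V]

/-- As a function of `w` the determinant is the characteristic polynomial of `-M`, which is monic.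
Almost all shifts of a matrix are therefore invertible, as needed for the density argument below. -/
theorem finite_det_add_smul_eq_zero (M : Matrix V V ℝ) :
    {w : ℝ | (M + w • (1 : Matrix V V ℝ)).det = 0}.Finite := by
  have h : {w : ℝ | (M + w • (1 : Matrix V V ℝ)).det = 0}
      ⊆ {w : ℝ | ((-M).charpoly).IsRoot w} := by
    intro w hw
    simp only [Set.mem_ofPred_eq] at hw
    simp only [Set.mem_ofPred_eq, Polynomial.IsRoot, Matrix.eval_charpoly]
    rw [← hw]
    congr 1
    rw [sub_neg_eq_add, add_comm, Matrix.smul_one_eq_diagonal]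
    rfl
  exact (Polynomial.finite_setOfPred_isRoot (Matrix.charpoly_monic _).ne_zero).subset h

/-- For invertible `A` and `E`, factoring out `E` and `A` on the two sides leaves `E⁻¹ C + B A⁻¹`
and `C E⁻¹ + A⁻¹ B`, which agree by commutation. In general `A` and `E` are shifted by the same
scalar `w`, which keeps the commutations; only finitely many `w` are excluded, and continuity gives
`w = 0`. -/
theorem det_mul_add_mul_comm (A B C E : Matrix V V ℝ) (hAB : Commute A B) (hCE : Commute C E) :
    (C * A + E * B).det = (A * C + B * E).det := by
  have regular : ∀ A E : Matrix V V ℝ, A.det ≠ 0 → E.det ≠ 0 → Commute A B → Commute C E →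
      (C * A + E * B).det = (A * C + B * E).det := by
    intro A E hA hE hAB hCE
    have hA' : IsUnit A.det := hA.isUnit
    have hE' : IsUnit E.det := hE.isUnit
    have h1 : C * A + E * B = E * (E⁻¹ * C + B * A⁻¹) * A := by
      rw [mul_add, add_mul, Matrix.mul_nonsing_inv_cancel_left _ _ hE', mul_assoc,
        Matrix.nonsing_inv_mul_cancel_right _ _ hA']
    have h2 : A * C + B * E = A * (C * E⁻¹ + A⁻¹ * B) * E := by
      rw [mul_add, add_mul, Matrix.mul_nonsing_inv_cancel_left _ _ hA', mul_assoc,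
        Matrix.nonsing_inv_mul_cancel_right _ _ hE']
    have h3 : E⁻¹ * C = C * E⁻¹ := by
      calc E⁻¹ * C = E⁻¹ * (C * E * E⁻¹) := by rw [Matrix.mul_nonsing_inv_cancel_right _ _ hE']
        _ = E⁻¹ * (E * (C * E⁻¹)) := by rw [hCE.eq, mul_assoc]
        _ = C * E⁻¹ := by rw [Matrix.nonsing_inv_mul_cancel_left _ _ hE']
    have h4 : A⁻¹ * B = B * A⁻¹ := by
      calc A⁻¹ * B = A⁻¹ * (B * A * A⁻¹) := by rw [Matrix.mul_nonsing_inv_cancel_right _ _ hA']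
        _ = A⁻¹ * (A * (B * A⁻¹)) := by rw [← hAB.eq, mul_assoc]
        _ = B * A⁻¹ := by rw [Matrix.nonsing_inv_mul_cancel_left _ _ hA']
    rw [h1, h2, h3, h4]
    simp only [Matrix.det_mul]
    ring
  let s : Set ℝ := ({w : ℝ | (A + w • (1 : Matrix V V ℝ)).det = 0}
    ∪ {w : ℝ | (E + w • (1 : Matrix V V ℝ)).det = 0})ᶜ
  have hs : Dense s :=
    Set.Countable.dense_compl ℝ
      ((finite_det_add_smul_eq_zero A).union (finite_det_add_smul_eq_zero E)).countable
  have hfun : (fun w : ℝ => (C * (A + w • (1 : Matrix V V ℝ)) +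
        (E + w • (1 : Matrix V V ℝ)) * B).det)
      = fun w : ℝ => ((A + w • (1 : Matrix V V ℝ)) * C +
        B * (E + w • (1 : Matrix V V ℝ))).det := by
    refine Continuous.ext_on hs ?_ ?_ ?_
    · fun_prop
    · fun_prop
    · intro w hw
      simp only [s, Set.mem_compl_iff, Set.mem_union, Set.mem_ofPred_eq, not_or] at hw
      refine regular _ _ hw.1 hw.2 ?_ ?_
      · exact hAB.add_left ((Commute.one_left B).smul_left w)
      · exact hCE.add_right ((Commute.one_right C).smul_right w)
  simpa using congrFun hfun 0

/-- Reversing the permutation does not change the determinant. -/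
theorem det_rotation_inv (C P P' : Matrix V V ℝ) (e : V → ℝ) (hC : C.transpose = C)
    (hCe : Commute C (Matrix.diagonal e)) (hP : P.transpose = P') (hPP : P * P' = 1) :
    (C * (1 + P') + Matrix.diagonal e * (1 - P')).det
      = (C * (1 + P) + Matrix.diagonal e * (1 - P)).det := by
  have hPP' : P' * P = 1 := mul_eq_one_comm.mp hPP
  have h1 : (C * (1 + P) + Matrix.diagonal e * (1 - P)).det
      = ((1 + P') * C + (1 - P') * Matrix.diagonal e).det := by
    rw [← Matrix.det_transpose]
    congr 1
    simp [Matrix.transpose_mul, hC, hP]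
  rw [h1]
  -- After the transposition the two sides differ only by the order of the factors.
  refine det_mul_add_mul_comm _ _ _ _ ?_ hCe
  show (1 + P') * (1 - P') = (1 - P') * (1 + P')
  noncomm_ring

/-- Sorted by `d`, the matrix is block triangular, and the block of indices of equal rank is the
identity. -/
theorem det_eq_one_of_rank (M : Matrix V V ℝ) (d : V → ℕ) (hdiag : ∀ i, M i i = 1)
    (h : ∀ i j, i ≠ j → M i j ≠ 0 → d j < d i) : M.det = 1 := by
  have hM : M.BlockTriangular (fun i => OrderDual.toDual (d i)) := by
    intro i j hij
    by_contra hne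
    have hij' : d i < d j := hij
    by_cases e : i = j
    · subst e; omega
    · have := h i j e hne
      omega
  rw [hM.det]
  refine Finset.prod_eq_one fun a _ => ?_
  have : M.toSquareBlock (fun i => OrderDual.toDual (d i)) a = 1 := by
    ext i j
    rw [Matrix.toSquareBlock_def, Matrix.of_apply]
    by_cases e : i = j
    · subst e; simp [hdiag]
    · rw [Matrix.one_apply_ne e]
      by_contra hne
      have h1 := h i j (fun h => e (Subtype.ext h)) hne
      have h2 : d i = d j := OrderDual.toDual.injective (i.2.trans j.2.symm)
      omega
  rw [this, Matrix.det_one]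

/-- Elimination of the unknowns `p h`, for `h` not in the range of `inc`, by means of the
equations `p h = s h * p (ρ h)`. -/
theorem det_contract {L : Type*} [Fintype L] [DecidableEq L] (M : Matrix V V ℝ) (inc : L → V)
    (r : V → L) (ω s : V → ℝ) (ρ : V → V) (d : V → ℕ)
    (hr : ∀ x, r (inc x) = x) (hω : ∀ x, ω (inc x) = 1)
    (hrow : ∀ h, h ∉ Set.range inc →
      M h = (Pi.single h 1 - s h • Pi.single (ρ h) 1 : V → ℝ))
    (hrρ : ∀ h, h ∉ Set.range inc → r (ρ h) = r h)
    (hωρ : ∀ h, h ∉ Set.range inc → ω h = s h * ω (ρ h))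
    (hd : ∀ h, h ∉ Set.range inc → d (ρ h) < d h) :
    M.det = (Matrix.of fun x x' : L => ∑ h, M (inc x) h * (if r h = x' then ω h else 0)).det := by
  classical
  obtain ⟨p, hp⟩ : ∃ p : V → Prop, ∀ h, p h ↔ h ∈ Set.range inc := ⟨_, fun _ => Iff.rfl⟩
  simp only [← hp] at hrow hrρ hωρ hd
  -- Column operations of determinant one which carry out the substitution `p h = ω h * p (inc (r
  -- h))`: the column of `inc x` becomes the combination, with weights `ω h`, of all the columns `h`
  -- with `r h = x`; the other columns are kept.
  let U : Matrix V V ℝ := Matrix.of fun h k =>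
    if p k then (if r h = r k then ω h else 0) else (if h = k then 1 else 0)
  have hUa : ∀ h k, U h k =
    if p k then (if r h = r k then ω h else 0) else (if h = k then 1 else 0) := fun _ _ => rfl
  have hinj : ∀ {h k}, p h → p k → r h = r k → h = k := by
    intro h k hh hk hxy
    obtain ⟨x, rfl⟩ := (hp h).mp hh
    obtain ⟨y, rfl⟩ := (hp k).mp hk
    rw [hr, hr] at hxy
    rw [hxy]
  have hdiag : ∀ h, p h → ω h = 1 := by
    intro h hh
    obtain ⟨x, rfl⟩ := (hp h).mp hh
    exact hω x
  have hU : U.det = 1 := by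
    have h0 : ∀ i, p i → ∀ j, ¬ p j → U i j = 0 := by
      intro i hi j hj
      have : i ≠ j := fun h => hj (h ▸ hi)
      simp [hUa, hj, this]
    rw [Matrix.twoBlockTriangular_det' U p h0]
    have h1 : U.toSquareBlockProp p = 1 := by
      ext i j
      rw [Matrix.toSquareBlockProp_def, Matrix.of_apply]
      by_cases e : i = j
      · subst e; simp [hUa, i.2, hdiag]
      · rw [Matrix.one_apply_ne e]
        have : r i ≠ r j := fun h => e (Subtype.ext (hinj i.2 j.2 h))
        simp [hUa, j.2, this]
    have h2 : U.toSquareBlockProp (fun i => ¬ p i) = 1 := by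
      ext i j
      rw [Matrix.toSquareBlockProp_def, Matrix.of_apply]
      simp [hUa, j.2, Matrix.one_apply, Subtype.ext_iff]
    rw [h1, h2, Matrix.det_one, Matrix.det_one, one_mul]
  have hMU : M.det = (M * U).det := by rw [Matrix.det_mul, hU, mul_one]
  -- The substitution solves the equations of the eliminated rows, so these rows vanish on the
  -- columns of the range of `inc`. On the other columns they are unitriangular for the rank `d`.
  have hlow : ∀ i, ¬ p i → ∀ j, p j → (M * U) i j = 0 := by
    intro i hi j hj
    rw [Matrix.mul_apply, hrow i hi]
    simp only [Pi.sub_apply, Pi.smul_apply, sub_mul, Finset.sum_sub_distrib, smul_eq_mul, hUa, hj,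
      if_true, mul_assoc, ← Finset.mul_sum]
    simp only [Pi.single_apply, ite_mul, one_mul, zero_mul, Finset.sum_ite_eq', Finset.mem_univ,
      if_true]
    rw [hrρ i hi, hωρ i hi]
    split_ifs <;> ring
  rw [hMU, Matrix.twoBlockTriangular_det _ p hlow]
  have h2 : ((M * U).toSquareBlockProp (fun i => ¬ p i)).det = 1 := by
    have hent : ∀ i j, ¬ p j → (M * U) i j = M i j := by
      intro i j hj
      simp [Matrix.mul_apply, hUa, hj]
    refine det_eq_one_of_rank _ (fun i => d i.1) ?_ ?_
    · intro i
      rw [Matrix.toSquareBlockProp_def, Matrix.of_apply, hent _ _ i.2, hrow _ i.2]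
      have : ρ i.1 ≠ i.1 := fun h => by have := hd _ i.2; rw [h] at this; omega
      simp [this.symm]
    · intro i j hij hne
      rw [Matrix.toSquareBlockProp_def, Matrix.of_apply, hent _ _ j.2, hrow _ i.2] at hne
      have hij' : (j : V) ≠ i := fun h => hij (Subtype.ext h.symm)
      have : (j : V) = ρ i := by
        by_contra hj
        simp [hij', hj] at hne
      show d j < d i
      rw [this]
      exact hd _ i.2
  rw [h2, mul_one]
  let e : L ≃ {a // p a} := Equiv.ofBijective (fun x => ⟨inc x, (hp _).mpr ⟨x, rfl⟩⟩)
    ⟨fun x y h => by simpa [hr] using congrArg r (congrArg Subtype.val h),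
      fun ⟨h, hh⟩ => ((hp h).mp hh).imp fun x hx => Subtype.ext hx⟩
  rw [← Matrix.det_submatrix_equiv_self e]
  congr 1
  ext x x'
  simp only [Matrix.submatrix_apply, Matrix.toSquareBlockProp_def, Matrix.of_apply,
    Matrix.mul_apply]
  refine Finset.sum_congr rfl fun h _ => ?_
  have : p (e x' : V) := (e x').2
  have hx : ∀ x, (e x : V) = inc x := fun _ => rfl
  rw [hUa, if_pos this, hx, hx, hr]

end LinearAlgebra

/-- Gluing triangles.  `P` rotates the triangles, and `K` records which half-corners (indexed by
`I`) are glued to which corners. -/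
theorem det_glue {C I : Type*} [Fintype C] [DecidableEq C] [Fintype I] [DecidableEq I]
    (N : Matrix C C ℝ) (E : Matrix C C ℝ) (K : Matrix I C ℝ)
    (π : Matrix C (C ⊕ I) ℝ) (hπ : π = Matrix.fromCols 1 K.transpose)
    (P P' : Matrix (C ⊕ I) (C ⊕ I) ℝ) (hP : P * P' = 1) (hP3 : P * P = P')
    (hK : K * K.transpose = 1) (hE : E * K.transpose = K.transpose) (hE' : K * E = K)
    (hN : K * N = 0) :
    2 ^ Fintype.card I *
      (Matrix.fromBlocks N 0 0 0 * (1 + P) + Matrix.fromBlocks E 0 0 1 *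
        (1 - Matrix.fromBlocks (1 - K.transpose * K) K.transpose K 0 * P)).det
    = (N - E * (π * (P - P') * π.transpose)).det * (1 + P).det := by
  -- For each glued pair of half-corners, `T` replaces the two gluing equations by their sum and
  -- their difference; its determinant is that of `1 + K Kᵀ = 2`, one factor 2 per pair.
  set T : Matrix (C ⊕ I) (C ⊕ I) ℝ := Matrix.fromBlocks 1 K.transpose (-K) 1 with hT
  set G : Matrix (C ⊕ I) (C ⊕ I) ℝ :=
    Matrix.fromBlocks (1 - K.transpose * K) K.transpose K 0 with hG
  have hTdet : T.det = 2 ^ Fintype.card I := by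
    rw [hT, Matrix.det_fromBlocks_one₁₁, Matrix.neg_mul, hK, sub_neg_eq_add]
    have : (1 + 1 : Matrix I I ℝ) = (2 : ℝ) • 1 := by rw [two_smul]
    rw [this, Matrix.det_smul, Matrix.det_one, mul_one]
  -- The same system in terms of `y = (1 + P) q`: the difference of the two gluing equations says
  -- that `y` takes the same value on both sides of the corner, and their sum is the equation of
  -- that corner.
  set S : Matrix (C ⊕ I) (C ⊕ I) ℝ :=
    Matrix.fromBlocks N 0 (-K) 1 + Matrix.fromBlocks E K.transpose 0 0 * (P' - P) with hS
  have h1 : T * (Matrix.fromBlocks N 0 0 0 * (1 + P) + Matrix.fromBlocks E 0 0 1 * (1 - G * P))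
      = S * (1 + P) := by
    have a1 : T * Matrix.fromBlocks N 0 0 0 = Matrix.fromBlocks N 0 0 0 := by
      rw [hT, Matrix.fromBlocks_multiply]; simp [hN]
    have a2 : T * Matrix.fromBlocks E 0 0 1
        = Matrix.fromBlocks E K.transpose 0 0 + Matrix.fromBlocks 0 0 (-K) 1 := by
      rw [hT, Matrix.fromBlocks_multiply, Matrix.fromBlocks_add]; simp [hE']
    have a3 : (Matrix.fromBlocks E K.transpose 0 0 : Matrix (C ⊕ I) (C ⊕ I) ℝ) * G
        = Matrix.fromBlocks E K.transpose 0 0 := by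
      rw [hG, Matrix.fromBlocks_multiply]; simp [mul_sub, ← Matrix.mul_assoc, hE]
    have a4 : (Matrix.fromBlocks 0 0 (-K) 1 : Matrix (C ⊕ I) (C ⊕ I) ℝ) * G
        = - Matrix.fromBlocks 0 0 (-K) 1 := by
      rw [hG, Matrix.fromBlocks_multiply, Matrix.fromBlocks_neg]
      simp [Matrix.mul_sub, ← Matrix.mul_assoc, hK]
    have a5 : (Matrix.fromBlocks N 0 (-K) 1 : Matrix (C ⊕ I) (C ⊕ I) ℝ)
        = Matrix.fromBlocks N 0 0 0 + Matrix.fromBlocks (0 : Matrix C C ℝ) 0 (-K) 1 := by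
      rw [Matrix.fromBlocks_add]; simp
    -- This is where triangles matter: the identity uses that `P` has order three.
    have a6 : (P' - P) * (1 + P) = 1 - P := by
      have : P' * P = 1 := mul_eq_one_comm.mp hP
      rw [sub_mul, mul_add, mul_add, this, hP3]
      simp only [mul_one]
      abel
    rw [mul_add, ← mul_assoc, a1, ← mul_assoc, a2, hS, a5, add_mul _ _ (1 + P),
      mul_assoc _ (P' - P), a6, add_mul, mul_sub, mul_sub, ← mul_assoc, ← mul_assoc, a3, a4]
    noncomm_ring
  have h2 : S.det = (N - E * (π * (P - P') * π.transpose)).det := by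
    -- Substitution of the common value of `y` at the two sides of each glued corner, which pushes
    -- `P - P'` down to the corners.
    set U : Matrix (C ⊕ I) (C ⊕ I) ℝ := Matrix.fromBlocks 1 0 K 1 with hU
    have hUdet : U.det = 1 := by rw [hU, Matrix.det_fromBlocks_zero₁₂]; simp
    rw [← mul_one S.det, ← hUdet, ← Matrix.det_mul]
    have b1 : Matrix.fromBlocks N 0 (-K) 1 * U = Matrix.fromBlocks N 0 0 1 := by
      rw [hU, Matrix.fromBlocks_multiply]; simp
    obtain ⟨x, y, z, w, hX⟩ : ∃ x y z w, P - P' = Matrix.fromBlocks x y z w :=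
      ⟨_, _, _, _, (Matrix.fromBlocks_toBlocks _).symm⟩
    have b2 : P' - P = - Matrix.fromBlocks x y z w := by rw [← hX]; abel
    have b3 : S * U = Matrix.fromBlocks (N - E * (π * (P - P') * π.transpose))
          (- (E * y + K.transpose * w)) 0 1 := by
      rw [hS, add_mul, b1, b2, hX, hU, hπ, Matrix.transpose_fromCols, mul_neg, neg_mul, Matrix.fromBlocks_multiply,
        Matrix.fromBlocks_multiply, Matrix.fromBlocks_neg, Matrix.fromBlocks_add,
        Matrix.fromCols_mul_fromBlocks, Matrix.fromCols_mul_fromRows]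
      congr 1
      · simp only [Matrix.one_mul, Matrix.mul_one, Matrix.mul_add, Matrix.transpose_one,
          Matrix.transpose_transpose, ← Matrix.mul_assoc, hE, Matrix.add_mul, sub_eq_add_neg]
      · simp
      · simp
      · simp
    rw [b3, Matrix.det_fromBlocks_zero₂₁, Matrix.det_one, mul_one]
  rw [← hTdet, ← h2, ← Matrix.det_mul, ← Matrix.det_mul, h1]

/-! ### Half-corners of a plane tree and the walk around it -/

namespace PlaneTree

variable {X : Type*}

/-- The triangles. -/
def Node : PlaneTree X → Type
  | leaf _ => Empty
  | node l r => Option (l.Node ⊕ r.Node)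

theorem finite_node : ∀ T : PlaneTree X, Finite T.Node
  | leaf _ => inferInstanceAs (Finite Empty)
  | node l r =>
    haveI := finite_node l
    haveI := finite_node r
    inferInstanceAs (Finite (Option (l.Node ⊕ r.Node)))

instance (T : PlaneTree X) : Finite T.Node := finite_node T

/-- The three corners of a triangle in cyclic order, starting from the one below. -/
def slot : (T : PlaneTree X) → T.Node → Fin 3 → T.Corner
  | leaf _ => fun n => n.elim
  | node l r => fun
    | none => fun
      | 0 => none
      | 1 => some (Sum.inl l.stem)
      | 2 => some (Sum.inr r.stem)
    | some (Sum.inl n) => fun i => some (Sum.inl (l.slot n i))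
    | some (Sum.inr n) => fun i => some (Sum.inr (r.slot n i))

section Slots

theorem slot_ne_stem : ∀ (T : PlaneTree X) (n : T.Node) (i : Fin 3), i ≠ 0 → T.slot n i ≠ T.stem
  | leaf _, n, _, _ => n.elim
  | node l r, none, i, hi => by
    fin_cases i
    · exact absurd rfl hi
    · exact fun h => Option.some_ne_none _ h
    · exact fun h => Option.some_ne_none _ h
  | node l r, some (Sum.inl n), i, hi => fun h => Option.some_ne_none _ h
  | node l r, some (Sum.inr n), i, hi => fun h => Option.some_ne_none _ h

theorem slot_injective : ∀ (T : PlaneTree X) (n m : T.Node) (i j : Fin 3), i ≠ 0 → j ≠ 0 →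
    T.slot n i = T.slot m j → n = m ∧ i = j
  | leaf _, n, _, _, _, _, _, _ => n.elim
  | node l r, none, none, i, j, hi, hj, h => by
    refine ⟨rfl, ?_⟩
    fin_cases i <;> fin_cases j <;> first | rfl | exact absurd rfl hi | exact absurd rfl hj | skip
    · exact absurd (Option.some_injective _ h) Sum.inl_ne_inr
    · exact absurd (Option.some_injective _ h) Sum.inr_ne_inl
  | node l r, none, some (Sum.inl m), i, j, hi, hj, h => by
    fin_cases i
    · exact absurd rfl hi
    · exact absurd (Sum.inl_injective (Option.some_injective _ h)).symm (slot_ne_stem l m j hj)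
    · exact absurd (Option.some_injective _ h) Sum.inr_ne_inl
  | node l r, none, some (Sum.inr m), i, j, hi, hj, h => by
    fin_cases i
    · exact absurd rfl hi
    · exact absurd (Option.some_injective _ h) Sum.inl_ne_inr
    · exact absurd (Sum.inr_injective (Option.some_injective _ h)).symm (slot_ne_stem r m j hj)
  | node l r, some (Sum.inl m), none, i, j, hi, hj, h => by
    fin_cases j
    · exact absurd rfl hj
    · exact absurd (Sum.inl_injective (Option.some_injective _ h)) (slot_ne_stem l m i hi)
    · exact absurd (Option.some_injective _ h) Sum.inl_ne_inr
  | node l r, some (Sum.inr m), none, i, j, hi, hj, h => by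
    fin_cases j
    · exact absurd rfl hj
    · exact absurd (Option.some_injective _ h) Sum.inr_ne_inl
    · exact absurd (Sum.inr_injective (Option.some_injective _ h)) (slot_ne_stem r m i hi)
  | node l r, some (Sum.inl n), some (Sum.inl m), i, j, hi, hj, h => by
    obtain ⟨h1, h2⟩ := slot_injective l n m i j hi hj (Sum.inl_injective (Option.some_injective _ h))
    exact ⟨by rw [h1], h2⟩
  | node l r, some (Sum.inr n), some (Sum.inr m), i, j, hi, hj, h => by
    obtain ⟨h1, h2⟩ := slot_injective r n m i j hi hj (Sum.inr_injective (Option.some_injective _ h))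
    exact ⟨by rw [h1], h2⟩
  | node l r, some (Sum.inl n), some (Sum.inr m), i, j, hi, hj, h =>
    absurd (Option.some_injective _ h) Sum.inl_ne_inr
  | node l r, some (Sum.inr n), some (Sum.inl m), i, j, hi, hj, h =>
    absurd (Option.some_injective _ h) Sum.inr_ne_inl

/-- Every corner but the stem lies above exactly one triangle; `slot_injective` is the uniqueness.
-/
theorem exists_slot : ∀ (T : PlaneTree X) (c : T.Corner), c ≠ T.stem →
    ∃ n i, i ≠ 0 ∧ T.slot n i = c
  | leaf _, _, h => absurd rfl h
  | node l r, none, h => absurd rfl h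
  | node l r, some (Sum.inl c), _ => by
    by_cases hc : c = l.stem
    · exact ⟨none, 1, by decide, by rw [hc]; rfl⟩
    · obtain ⟨n, i, hi, rfl⟩ := exists_slot l c hc
      exact ⟨some (Sum.inl n), i, hi, rfl⟩
  | node l r, some (Sum.inr c), _ => by
    by_cases hc : c = r.stem
    · exact ⟨none, 2, by decide, by rw [hc]; rfl⟩
    · obtain ⟨n, i, hi, rfl⟩ := exists_slot r c hc
      exact ⟨some (Sum.inr n), i, hi, rfl⟩

theorem slot_zero_injective : ∀ (T : PlaneTree X) (n m : T.Node),
    T.slot n 0 = T.slot m 0 → n = m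
  | leaf _, n, _, _ => n.elim
  | node l r, none, none, _ => rfl
  | node l r, none, some (Sum.inl m), h => absurd h.symm (Option.some_ne_none _)
  | node l r, none, some (Sum.inr m), h => absurd h.symm (Option.some_ne_none _)
  | node l r, some (Sum.inl m), none, h => absurd h (Option.some_ne_none _)
  | node l r, some (Sum.inr m), none, h => absurd h (Option.some_ne_none _)
  | node l r, some (Sum.inl n), some (Sum.inl m), h => by
    rw [slot_zero_injective l n m (Sum.inl_injective (Option.some_injective _ h))]
  | node l r, some (Sum.inr n), some (Sum.inr m), h => by
    rw [slot_zero_injective r n m (Sum.inr_injective (Option.some_injective _ h))]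
  | node l r, some (Sum.inl n), some (Sum.inr m), h =>
    absurd (Option.some_injective _ h) Sum.inl_ne_inr
  | node l r, some (Sum.inr n), some (Sum.inl m), h =>
    absurd (Option.some_injective _ h) Sum.inr_ne_inl

theorem step_slot : ∀ (T : PlaneTree X) (n : T.Node) (i : Fin 3),
    T.Step (T.slot n i) (T.slot n (i + 1))
  | leaf _, n, _ => n.elim
  | node l r, none, i => by
    fin_cases i
    · exact (rfl : l.stem = l.stem)
    · exact (⟨rfl, rfl⟩ : l.stem = l.stem ∧ r.stem = r.stem)
    · exact (rfl : r.stem = r.stem)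
  | node l r, some (Sum.inl n), i => step_slot l n i
  | node l r, some (Sum.inr n), i => step_slot r n i

theorem exists_of_step : ∀ (T : PlaneTree X) (c d : T.Corner), T.Step c d →
    ∃ n i, T.slot n i = c ∧ T.slot n (i + 1) = d
  | leaf _, _, _, h => h.elim
  | node l r, none, none, h => h.elim
  | node l r, none, some (Sum.inl a), h => ⟨none, 0, rfl, by
      rw [show a = l.stem from h]; rfl⟩
  | node l r, none, some (Sum.inr a), h => h.elim
  | node l r, some (Sum.inl a), none, h => h.elim
  | node l r, some (Sum.inr a), none, h => ⟨none, 2, by rw [show a = r.stem from h]; rfl, rfl⟩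
  | node l r, some (Sum.inl a), some (Sum.inl b), h => by
    obtain ⟨n, i, h1, h2⟩ := exists_of_step l a b h
    exact ⟨some (Sum.inl n), i, by rw [← h1]; rfl, by rw [← h2]; rfl⟩
  | node l r, some (Sum.inr a), some (Sum.inr b), h => by
    obtain ⟨n, i, h1, h2⟩ := exists_of_step r a b h
    exact ⟨some (Sum.inr n), i, by rw [← h1]; rfl, by rw [← h2]; rfl⟩
  | node l r, some (Sum.inl a), some (Sum.inr b), h => ⟨none, 1,
      by rw [show a = l.stem from h.1]; rfl, by rw [show b = r.stem from h.2]; rfl⟩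
  | node l r, some (Sum.inr a), some (Sum.inl b), h => h.elim

theorem step_asymm : ∀ (T : PlaneTree X) (c d : T.Corner), T.Step c d → ¬ T.Step d c
  | leaf _, _, _, h, _ => h
  | node l r, none, none, h, _ => h
  | node l r, none, some (Sum.inl a), _, h => h
  | node l r, none, some (Sum.inr a), h, _ => h
  | node l r, some (Sum.inl a), none, h, _ => h
  | node l r, some (Sum.inr a), none, _, h => h
  | node l r, some (Sum.inl a), some (Sum.inl b), h, h' => step_asymm l a b h h'
  | node l r, some (Sum.inr a), some (Sum.inr b), h, h' => step_asymm r a b h h'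
  | node l r, some (Sum.inl a), some (Sum.inr b), _, h => h
  | node l r, some (Sum.inr a), some (Sum.inl b), h, _ => h

/-- Two triangles share at most one corner, so an oriented side determines its triangle. Together
with `step_asymm` this keeps the entries of the adjacency matrix equal to `0`, `1` or `-1` when
sides are summed over half-corners. -/
theorem slot_pair_injective : ∀ (T : PlaneTree X) (n m : T.Node) (i j : Fin 3),
    T.slot n i = T.slot m j → T.slot n (i + 1) = T.slot m (j + 1) → n = m ∧ i = j
  | leaf _, n, _, _, _, _, _ => n.elim
  | node l r, none, none, i, j, h, _ => by
    refine ⟨rfl, ?_⟩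
    fin_cases i <;> fin_cases j <;> first
      | rfl
      | exact absurd h (Option.some_ne_none _)
      | exact absurd h.symm (Option.some_ne_none _)
      | exact absurd (Option.some_injective _ h) Sum.inl_ne_inr
      | exact absurd (Option.some_injective _ h) Sum.inr_ne_inl
  | node l r, none, some (Sum.inl m), i, j, h, h' => by
    fin_cases i
    · exact absurd h.symm (Option.some_ne_none _)
    · exact absurd (Option.some_injective _ h') Sum.inr_ne_inl
    · exact absurd h'.symm (Option.some_ne_none _)
  | node l r, none, some (Sum.inr m), i, j, h, h' => by
    fin_cases i
    · exact absurd h.symm (Option.some_ne_none _)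
    · exact absurd (Option.some_injective _ h) Sum.inl_ne_inr
    · exact absurd h'.symm (Option.some_ne_none _)
  | node l r, some (Sum.inl m), none, i, j, h, h' => by
    fin_cases j
    · exact absurd h (Option.some_ne_none _)
    · exact absurd (Option.some_injective _ h') Sum.inl_ne_inr
    · exact absurd h' (Option.some_ne_none _)
  | node l r, some (Sum.inr m), none, i, j, h, h' => by
    fin_cases j
    · exact absurd h (Option.some_ne_none _)
    · exact absurd (Option.some_injective _ h) Sum.inr_ne_inl
    · exact absurd h' (Option.some_ne_none _)
  | node l r, some (Sum.inl n), some (Sum.inl m), i, j, h, h' => by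
    obtain ⟨h1, h2⟩ := slot_pair_injective l n m i j
      (Sum.inl_injective (Option.some_injective _ h)) (Sum.inl_injective (Option.some_injective _ h'))
    exact ⟨by rw [h1], h2⟩
  | node l r, some (Sum.inr n), some (Sum.inr m), i, j, h, h' => by
    obtain ⟨h1, h2⟩ := slot_pair_injective r n m i j
      (Sum.inr_injective (Option.some_injective _ h)) (Sum.inr_injective (Option.some_injective _ h'))
    exact ⟨by rw [h1], h2⟩
  | node l r, some (Sum.inl n), some (Sum.inr m), i, j, h, _ =>
    absurd (Option.some_injective _ h) Sum.inl_ne_inr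
  | node l r, some (Sum.inr n), some (Sum.inl m), i, j, h, _ =>
    absurd (Option.some_injective _ h) Sum.inr_ne_inl

end Slots

/-- The next label and the number of steps needed to reach it, one step further away. -/
def farther (b : X × ℕ) : X × ℕ := (b.1, b.2 + 1)

/-- Next label, and number of steps to reach it, seen from the region on the left of the stem,
given what is seen from the region on its right. -/
def enter : PlaneTree X → X × ℕ → X × ℕ
  | leaf (some x) => fun _ => (x, 0)
  | leaf none => farther
  | node l r => fun b => farther (l.enter (r.enter (farther b)))

/-- Next label, and number of steps to reach it, seen from all the half-corners, given what is
seen from the root half-corner. -/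
def walk : (T : PlaneTree X) → X × ℕ → T.Node → Fin 3 → X × ℕ
  | leaf _ => fun _ n => n.elim
  | node l r => fun w => fun
    | none => fun
      | 0 => w
      | 1 => l.enter (r.enter w)
      | 2 => r.enter w
    | some (Sum.inl n) => l.walk (farther (r.enter w)) n
    | some (Sum.inr n) => r.walk (farther w) n

theorem farther_fst (b : X × ℕ) : (farther b).1 = b.1 := rfl

theorem enter_fst : ∀ (T : PlaneTree X) (b : X × ℕ), (T.enter b).1 = T.labels.headD b.1
  | leaf (some x), b => rfl
  | leaf none, b => rfl
  | node l r, b => by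
    show (l.enter (r.enter (farther b))).1 = (l.labels ++ r.labels).headD b.1
    rw [enter_fst l, enter_fst r, farther_fst]
    cases l.labels <;> simp

/-- The walk stops at the first label, so nothing beyond it is seen. This allows the walk to be
closed up at a root without label. -/
theorem enter_const : ∀ (T : PlaneTree X) (b b' : X × ℕ), T.labels ≠ [] → T.enter b = T.enter b'
  | leaf (some x), _, _, _ => rfl
  | leaf none, _, _, h => absurd rfl h
  | node l r, b, b', h => by
    show farther (l.enter (r.enter (farther b))) = farther (l.enter (r.enter (farther b')))
    by_cases hl : l.labels = []
    · rw [enter_const r _ (farther b')]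
      intro hr
      exact h (show l.labels ++ r.labels = [] by rw [hl, hr]; rfl)
    · rw [enter_const l _ (r.enter (farther b')) hl]

theorem cornerLabel_slot_zero : ∀ (T : PlaneTree X) (n : T.Node), T.cornerLabel (T.slot n 0) = none
  | leaf _, n => n.elim
  | node l r, none => rfl
  | node l r, some (Sum.inl n) => cornerLabel_slot_zero l n
  | node l r, some (Sum.inr n) => cornerLabel_slot_zero r n

theorem mem_labels : ∀ (T : PlaneTree X) (x : X),
    x ∈ T.labels ↔ ∃ c, T.cornerLabel c = some x
  | leaf a, x => by
    show x ∈ a.toList ↔ ∃ c : Unit, a = some x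
    simp
  | node l r, x => by
    show x ∈ l.labels ++ r.labels ↔ _
    rw [List.mem_append, mem_labels l, mem_labels r]
    constructor
    · rintro (⟨c, hc⟩ | ⟨c, hc⟩)
      · exact ⟨some (Sum.inl c), hc⟩
      · exact ⟨some (Sum.inr c), hc⟩
    · rintro ⟨_ | c | c, hc⟩
      · exact absurd hc (by simp [cornerLabel])
      · exact Or.inl ⟨c, hc⟩
      · exact Or.inr ⟨c, hc⟩

theorem cornerLabel_injective : ∀ (T : PlaneTree X), T.labels.Nodup → ∀ c d x,
    T.cornerLabel c = some x → T.cornerLabel d = some x → c = d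
  | leaf a, _, c, d, x, _, _ => (rfl : (() : Unit) = ())
  | node l r, h, c, d, x, hc, hd => by
    obtain ⟨h1, h2, h3⟩ := List.nodup_append.mp (show (l.labels ++ r.labels).Nodup from h)
    match c, d, hc, hd with
    | none, _, hc, _ => exact absurd hc (by simp [cornerLabel])
    | some _, none, _, hd => exact absurd hd (by simp [cornerLabel])
    | some (Sum.inl c), some (Sum.inl d), hc, hd =>
      rw [cornerLabel_injective l h1 c d x hc hd]
    | some (Sum.inr c), some (Sum.inr d), hc, hd =>
      rw [cornerLabel_injective r h2 c d x hc hd]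
    | some (Sum.inl c), some (Sum.inr d), hc, hd =>
      exact absurd rfl (h3 x ((mem_labels l x).mpr ⟨c, hc⟩) x ((mem_labels r x).mpr ⟨d, hd⟩))
    | some (Sum.inr c), some (Sum.inl d), hc, hd =>
      exact absurd rfl (h3 x ((mem_labels l x).mpr ⟨d, hd⟩) x ((mem_labels r x).mpr ⟨c, hc⟩))

/-- The walk around a tree on the left, or on the right, of a triangle. -/
theorem walk_enter (T : PlaneTree X) (v : X × ℕ) :
    (∀ x, T.cornerLabel T.stem = some x → T.enter v = (x, 0) ∧ T.labels = [x]) ∧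
    (T.cornerLabel T.stem = none → (∀ n, T.slot n 0 ≠ T.stem) → T.enter v = farther v) ∧
    (∀ n, T.slot n 0 = T.stem →
      T.enter v = farther (T.walk (farther v) n 1) ∧ T.walk (farther v) n 0 = farther v) := by
  match T with
  | leaf (some x) => exact ⟨fun y hy => by cases hy; exact ⟨rfl, rfl⟩, fun h => (by cases h),
      fun n => n.elim⟩
  | leaf none => exact ⟨fun y hy => (by cases hy), fun _ _ => rfl, fun n => n.elim⟩
  | node l r =>
    refine ⟨fun y hy => (by cases hy), fun _ h => absurd rfl (h none), ?_⟩
    rintro (_ | n | n) h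
    · exact ⟨rfl, rfl⟩
    · exact absurd h (Option.some_ne_none _)
    · exact absurd h (Option.some_ne_none _)

theorem walk_label : ∀ (T : PlaneTree X) (w : X × ℕ) (n : T.Node) (i : Fin 3) (x : X), i ≠ 0 →
    T.cornerLabel (T.slot n i) = some x → T.walk w n i = (x, 0)
  | leaf _, _, n, _, _, _, _ => n.elim
  | node l r, w, none, i, x, hi, h => by
    fin_cases i
    · exact absurd rfl hi
    · exact ((walk_enter l _).1 x h).1
    · exact ((walk_enter r _).1 x h).1
  | node l r, w, some (Sum.inl n), i, x, hi, h => walk_label l _ n i x hi h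
  | node l r, w, some (Sum.inr n), i, x, hi, h => walk_label r _ n i x hi h

/-- The default value `w.1` occurs when `x` is the last label above the root: the walk then leaves
through the root half-corner. -/
theorem walk_next_label : ∀ (T : PlaneTree X) (w : X × ℕ) (n : T.Node) (i : Fin 3) (x : X), i ≠ 0 →
    T.cornerLabel (T.slot n i) = some x →
    ∃ l₁ l₂, T.labels = l₁ ++ x :: l₂ ∧ (T.walk w n (i + 1)).1 = l₂.headD w.1
  | leaf _, _, n, _, _, _, _ => n.elim
  | node l r, w, none, i, x, hi, h => by
    fin_cases i
    · exact absurd rfl hi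
    · refine ⟨[], r.labels, ?_, enter_fst r w⟩
      show l.labels ++ r.labels = _
      rw [((walk_enter l w).1 x h).2]; rfl
    · refine ⟨l.labels, [], ?_, rfl⟩
      show l.labels ++ r.labels = _
      rw [((walk_enter r w).1 x h).2]
  | node l r, w, some (Sum.inl n), i, x, hi, h => by
    obtain ⟨l₁, l₂, h1, h2⟩ := walk_next_label l (farther (r.enter w)) n i x hi h
    refine ⟨l₁, l₂ ++ r.labels, ?_, ?_⟩
    · show l.labels ++ r.labels = _
      rw [h1]; simp
    · refine Eq.trans h2 ?_
      rw [farther_fst, enter_fst]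
      cases l₂ <;> simp
  | node l r, w, some (Sum.inr n), i, x, hi, h => by
    obtain ⟨l₁, l₂, h1, h2⟩ := walk_next_label r (farther w) n i x hi h
    refine ⟨l.labels ++ l₁, l₂, ?_, h2⟩
    show l.labels ++ r.labels = _
    rw [h1]; simp

theorem walk_blank : ∀ (T : PlaneTree X) (w : X × ℕ) (n : T.Node) (i : Fin 3), i ≠ 0 →
    T.cornerLabel (T.slot n i) = none → (∀ m, T.slot m 0 ≠ T.slot n i) →
    T.walk w n i = farther (T.walk w n (i + 1))
  | leaf _, _, n, _, _, _, _ => n.elim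
  | node l r, w, none, i, hi, h, hs => by
    fin_cases i
    · exact absurd rfl hi
    · exact (walk_enter l _).2.1 h fun m hm => hs (some (Sum.inl m)) (by
        show some (Sum.inl (l.slot m 0)) = some (Sum.inl l.stem); rw [hm])
    · exact (walk_enter r _).2.1 h fun m hm => hs (some (Sum.inr m)) (by
        show some (Sum.inr (r.slot m 0)) = some (Sum.inr r.stem); rw [hm])
  | node l r, w, some (Sum.inl n), i, hi, h, hs => walk_blank l _ n i hi h fun m hm =>
      hs (some (Sum.inl m)) (by
        show some (Sum.inl (l.slot m 0)) = some (Sum.inl (l.slot n i)); rw [hm])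
  | node l r, w, some (Sum.inr n), i, hi, h, hs => walk_blank r _ n i hi h fun m hm =>
      hs (some (Sum.inr m)) (by
        show some (Sum.inr (r.slot m 0)) = some (Sum.inr (r.slot n i)); rw [hm])

/-- The walk crosses the common corner and goes on with the next corner of the other triangle. The
two relations are the two directions of crossing, and each crossing costs one step, which later
makes the elimination triangular. -/
theorem walk_glued : ∀ (T : PlaneTree X) (w : X × ℕ) (n m : T.Node) (i : Fin 3), i ≠ 0 →
    T.slot m 0 = T.slot n i →
    T.walk w n i = farther (T.walk w m 1) ∧ T.walk w m 0 = farther (T.walk w n (i + 1))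
  | leaf _, _, n, _, _, _, _ => n.elim
  | node l r, w, none, none, i, hi, h => absurd h.symm (slot_ne_stem (node l r) none i hi)
  | node l r, w, none, some (Sum.inl m), i, hi, h => by
    fin_cases i
    · exact absurd rfl hi
    · exact (walk_enter l _).2.2 m (Sum.inl_injective (Option.some_injective _ h))
    · exact absurd (Option.some_injective _ h) Sum.inl_ne_inr
  | node l r, w, none, some (Sum.inr m), i, hi, h => by
    fin_cases i
    · exact absurd rfl hi
    · exact absurd (Option.some_injective _ h) Sum.inr_ne_inl
    · exact (walk_enter r _).2.2 m (Sum.inr_injective (Option.some_injective _ h))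
  | node l r, w, some (Sum.inl n), none, i, hi, h => absurd h.symm (Option.some_ne_none _)
  | node l r, w, some (Sum.inr n), none, i, hi, h => absurd h.symm (Option.some_ne_none _)
  | node l r, w, some (Sum.inl n), some (Sum.inl m), i, hi, h =>
    walk_glued l _ n m i hi (Sum.inl_injective (Option.some_injective _ h))
  | node l r, w, some (Sum.inr n), some (Sum.inr m), i, hi, h =>
    walk_glued r _ n m i hi (Sum.inr_injective (Option.some_injective _ h))
  | node l r, w, some (Sum.inl n), some (Sum.inr m), i, hi, h =>
    absurd (Option.some_injective _ h) Sum.inr_ne_inl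
  | node l r, w, some (Sum.inr n), some (Sum.inl m), i, hi, h =>
    absurd (Option.some_injective _ h) Sum.inl_ne_inr

end PlaneTree

/-! ### Permutation matrices and the elimination of glued triangles -/

section PermutationMatrices

variable {V : Type*} [Fintype V] [DecidableEq V]

theorem permMatrix_apply' (σ : Perm V) (i j : V) :
    σ.permMatrix ℝ i j = if σ i = j then 1 else 0 := by
  simp [Equiv.toPEquiv, PEquiv.toMatrix_apply]

theorem permMatrix_mulVec' (σ : Perm V) (q : V → ℝ) (i : V) :
    (σ.permMatrix ℝ).mulVec q i = q (σ i) := by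
  simp [Matrix.mulVec, dotProduct, permMatrix_apply']

theorem permMatrix_mul_inv (σ : Perm V) :
    σ.permMatrix ℝ * (σ⁻¹).permMatrix ℝ = 1 := by
  rw [← Matrix.permMatrix_mul, inv_mul_cancel, Matrix.permMatrix_one]

/-- The sum of the identity and of a permutation all of whose cycles have length three. -/
theorem det_one_add_rotation {D : Type*} [Fintype D] [DecidableEq D] (σ : Perm V)
    (e : V ≃ Fin 3 × D) (he : ∀ h, e (σ h) = ((e h).1 + 1, (e h).2)) :
    (1 + σ.permMatrix ℝ).det = 2 ^ Fintype.card D := by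
  rw [← Matrix.det_submatrix_equiv_self e.symm]
  -- Sorted by cycles, the matrix is block diagonal with circulant blocks of size three and
  -- determinant 2.
  have h : (1 + σ.permMatrix ℝ).submatrix e.symm e.symm
      = Matrix.blockDiagonal (fun _ : D => (!![1, 1, 0; 0, 1, 1; 1, 0, 1] : Matrix (Fin 3) (Fin 3) ℝ)) := by
    ext ⟨i, d⟩ ⟨j, d'⟩
    have h1 : σ (e.symm (i, d)) = e.symm (j, d') ↔ (i + 1 = j ∧ d = d') := by
      rw [← e.injective.eq_iff, he, e.apply_symm_apply, e.apply_symm_apply, Prod.mk.injEq]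
    rw [Matrix.submatrix_apply, Matrix.add_apply, permMatrix_apply', Matrix.one_apply,
      Matrix.blockDiagonal_apply]
    simp only [h1, e.symm.injective.eq_iff, Prod.mk.injEq]
    by_cases hd : d = d'
    · simp only [hd, and_true, if_true]
      fin_cases i <;> fin_cases j <;> simp
    · simp [hd]
  rw [h, Matrix.det_blockDiagonal]
  simp only [Finset.prod_const, Finset.card_univ]
  congr 1
  simp [Matrix.det_fin_three]
  norm_num

end PermutationMatrices

section Glue

variable {C I L : Type*} [Fintype C] [DecidableEq C] [Fintype I] [DecidableEq I]
  [Fintype L] [DecidableEq L]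

/-- Triangles, whose half-corners are rotated by `rot`, glued along the corners `stem i`: the
half-corner `inr i` is glued to `inl (stem i)`.  All corners are eliminated, except those which
carry a label. -/
theorem det_triangulation (rot : Perm (C ⊕ I)) (hrot : rot * rot = rot⁻¹) (stem : I → C)
    (hstem : Function.Injective stem) (α : Matrix C C ℝ)
    (hα : ∀ c d, α c d
      = (∑ h, if Sum.elim id stem h = c ∧ Sum.elim id stem (rot h) = d then (1 : ℝ) else 0)
        - ∑ h, if Sum.elim id stem h = d ∧ Sum.elim id stem (rot h) = c then (1 : ℝ) else 0)
    (corner : L → C) (hcorner : ∀ x i, corner x ≠ stem i) (R : C ⊕ I → L) (dist : C ⊕ I → ℕ)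
    (next : L → L) (hR : ∀ x, R (Sum.inl (corner x)) = x)
    (hnext : ∀ x, R (rot (Sum.inl (corner x))) = next x)
    (hblank : ∀ c, (∀ x, corner x ≠ c) → (∀ i, stem i ≠ c) →
      R (rot (Sum.inl c)) = R (Sum.inl c) ∧ dist (rot (Sum.inl c)) < dist (Sum.inl c))
    (hinr : ∀ i, R (rot (Sum.inl (stem i))) = R (Sum.inr i) ∧
      dist (rot (Sum.inl (stem i))) < dist (Sum.inr i))
    (hinl : ∀ i, R (rot (Sum.inr i)) = R (Sum.inl (stem i)) ∧
      dist (rot (Sum.inr i)) < dist (Sum.inl (stem i)))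
    (W : L → L → ℝ) (N : Matrix C C ℝ) (hN : ∀ x y, N (corner x) (corner y) = W x y)
    (hN₁ : ∀ c d, (∀ x, corner x ≠ c) → N c d = 0) (hN₂ : ∀ c d, (∀ x, corner x ≠ d) → N c d = 0)
    (e : C → ℝ) (he : ∀ c, (∀ x, corner x ≠ c) → e c = 1) :
    2 ^ Fintype.card I * (Matrix.of fun x z : L =>
        (∑ y, W x y * ((if y = z then 1 else 0) + (if next y = z then 1 else 0)))
        + e (corner x) * ((if x = z then 1 else 0) - (if next x = z then 1 else 0))).det
      = (N - Matrix.diagonal e * α).det * (1 + rot.permMatrix ℝ).det := by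
  classical
  set κ : C ⊕ I → C := Sum.elim id stem with hκ
  let K : Matrix I C ℝ := Matrix.of fun i c => if stem i = c then 1 else 0
  have hKa : ∀ i c, K i c = if stem i = c then 1 else 0 := fun _ _ => rfl
  let π : Matrix C (C ⊕ I) ℝ := Matrix.fromCols 1 K.transpose
  have hπ : ∀ c h, π c h = if κ h = c then 1 else 0 := by
    rintro c (d | i)
    · simp [π, hκ, Matrix.one_apply, eq_comm]
    · simp [π, hκ, hKa]
  have hE : Matrix.diagonal e * K.transpose = K.transpose := by
    ext c i
    rw [Matrix.diagonal_mul, Matrix.transpose_apply, hKa]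
    split_ifs with h
    · rw [← h, he _ fun x => hcorner x i, one_mul]
    · rw [mul_zero]
  have hE' : K * Matrix.diagonal e = K := by
    have := congrArg Matrix.transpose hE
    rwa [Matrix.transpose_mul, Matrix.transpose_transpose, Matrix.diagonal_transpose] at this
  have hK : K * K.transpose = 1 := by
    ext i j
    simp [Matrix.mul_apply, hKa, Matrix.one_apply, hstem.eq_iff, eq_comm]
  have hKN : K * N = 0 := by
    ext i c
    simp only [Matrix.mul_apply, hKa, ite_mul, one_mul, zero_mul, Finset.sum_ite_eq,
      Finset.mem_univ, if_true, Matrix.zero_apply]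
    exact hN₁ _ _ fun x => hcorner x i
  have hP3 : rot.permMatrix ℝ * rot.permMatrix ℝ = (rot⁻¹).permMatrix ℝ := by
    rw [← Matrix.permMatrix_mul, hrot]
  have key := det_glue N (Matrix.diagonal e) K π rfl (rot.permMatrix ℝ) ((rot⁻¹).permMatrix ℝ)
    (permMatrix_mul_inv rot) hP3 hK hE hE' hKN
  have hα' : π * (rot.permMatrix ℝ - (rot⁻¹).permMatrix ℝ) * π.transpose = α := by
    have h1 : (rot⁻¹).permMatrix ℝ = (rot.permMatrix ℝ).transpose :=
      (Matrix.transpose_permMatrix _).symm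
    have h2 : ∀ c d, (π * rot.permMatrix ℝ * π.transpose) c d
        = ∑ h, if κ h = c ∧ κ (rot h) = d then (1 : ℝ) else 0 := by
      intro c d
      rw [Matrix.mul_assoc, Matrix.mul_apply]
      refine Finset.sum_congr rfl fun h _ => ?_
      have : (rot.permMatrix ℝ * π.transpose) h d = if κ (rot h) = d then 1 else 0 := by
        rw [← hπ]
        exact permMatrix_mulVec' rot (fun k => π d k) h
      rw [this, hπ]
      by_cases h1 : κ h = c <;> simp [h1]
    ext c d
    rw [hα, Matrix.mul_sub, Matrix.sub_mul, Matrix.sub_apply, h2, h1, ← h2 d c]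
    congr 1
    rw [← Matrix.transpose_apply (π * rot.permMatrix ℝ * π.transpose), Matrix.transpose_mul,
      Matrix.transpose_mul, Matrix.transpose_transpose, Matrix.mul_assoc]
  rw [hα'] at key
  rw [← key]
  congr 1
  -- The gluing involution: it exchanges the two half-corners of a corner common to two triangles
  -- and fixes the others.
  set g : C ⊕ I → C ⊕ I := fun h => match h with
    | Sum.inl c => if hc : ∃ i, stem i = c then Sum.inr hc.choose else Sum.inl c
    | Sum.inr i => Sum.inl (stem i) with hg
  have g_stem : ∀ i, g (Sum.inl (stem i)) = Sum.inr i := by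
    intro i
    have hc : ∃ j, stem j = stem i := ⟨i, rfl⟩
    simp only [hg, dif_pos hc]
    rw [hstem hc.choose_spec]
  have g_inl : ∀ c, (∀ i, stem i ≠ c) → g (Sum.inl c) = Sum.inl c := by
    intro c hc
    have hc' : ¬ ∃ i, stem i = c := fun ⟨i, hi⟩ => hc i hi
    simp only [hg, dif_neg hc']
  have hG : ∀ (q : C ⊕ I → ℝ) h, (Matrix.fromBlocks (1 - K.transpose * K) K.transpose K 0).mulVec q h
      = q (g h) := by
    intro q h
    rw [Matrix.fromBlocks_mulVec]
    have hKq : ∀ (q : C → ℝ) i, K.mulVec q i = q (stem i) := by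
      intro q i; simp [Matrix.mulVec, dotProduct, hKa]
    rcases h with c | i
    · rw [Sum.elim_inl, Pi.add_apply, Matrix.sub_mulVec, Pi.sub_apply, Matrix.one_mulVec,
        ← Matrix.mulVec_mulVec]
      by_cases hc : ∃ i, stem i = c
      · obtain ⟨i, rfl⟩ := hc
        have hKt : ∀ q : I → ℝ, K.transpose.mulVec q (stem i) = q i := by
          intro q
          simp [Matrix.mulVec, dotProduct, hKa, hstem.eq_iff]
        rw [hKt, hKt, hKq, g_stem]
        simp
      · have hKt : ∀ q : I → ℝ, K.transpose.mulVec q c = 0 := by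
          intro q
          have : ∀ i, stem i ≠ c := fun i hi => hc ⟨i, hi⟩
          simp [Matrix.mulVec, dotProduct, hKa, this]
        rw [hKt, hKt, g_inl c fun i hi => hc ⟨i, hi⟩]
        simp
    · rw [Sum.elim_inr, Matrix.zero_mulVec, add_zero, hKq]
      rfl
  set M := Matrix.fromBlocks N 0 0 0 * (1 + rot.permMatrix ℝ) + Matrix.fromBlocks (Matrix.diagonal e)
    0 0 1 * (1 - Matrix.fromBlocks (1 - K.transpose * K) K.transpose K 0 * rot.permMatrix ℝ) with hM
  have hMq : ∀ (q : C ⊕ I → ℝ) h, M.mulVec q h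
      = Sum.elim (fun c => ∑ d, N c d * (q (Sum.inl d) + q (rot (Sum.inl d)))) (fun _ => 0) h
        + Sum.elim e (fun _ => 1) h * (q h - q (rot (g h))) := by
    intro q h
    have h1 : (1 + rot.permMatrix ℝ).mulVec q = fun h => q h + q (rot h) := by
      ext h
      rw [Matrix.add_mulVec, Pi.add_apply, Matrix.one_mulVec, permMatrix_mulVec']
    have h2 : (1 - Matrix.fromBlocks (1 - K.transpose * K) K.transpose K 0 *
        rot.permMatrix ℝ).mulVec q = fun h => q h - q (rot (g h)) := by
      ext h
      rw [Matrix.sub_mulVec, Pi.sub_apply, Matrix.one_mulVec, ← Matrix.mulVec_mulVec, hG,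
        permMatrix_mulVec']
    rw [hM, Matrix.add_mulVec, ← Matrix.mulVec_mulVec, ← Matrix.mulVec_mulVec, h1, h2,
      Matrix.fromBlocks_mulVec, Matrix.fromBlocks_mulVec]
    rcases h with c | i
    · simp [Matrix.mulVec_diagonal]
      rfl
    · simp
  symm
  have hsum : ∀ x (q : C → ℝ), ∑ d, N (corner x) d * q d = ∑ y, W x y * q (corner y) := by
    intro x q
    have hinj : Function.Injective corner := fun x y h => by rw [← hR x, h, hR]
    refine (Fintype.sum_of_injective corner hinj _ _ (fun d hd => ?_) fun y => ?_).symm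
    · rw [hN₂ _ _ fun y hy => hd ⟨y, hy⟩, zero_mul]
    · rw [hN]
  -- Off the labelled corners `N` vanishes and the weight is 1, so the equation is `q h = q (rot (g
  -- h))`. The three cases are the two sides of a glued corner and a leaf without label; in each of
  -- them `R` is kept and `dist` drops.
  have hinc : ∀ h, h ∉ Set.range (fun x => (Sum.inl (corner x) : C ⊕ I)) →
      (∀ q : C ⊕ I → ℝ, M.mulVec q h = q h - q (rot (g h))) ∧ R (rot (g h)) = R h ∧
        dist (rot (g h)) < dist h := by
    rintro (c | i) hh
    · have hc : ∀ x, corner x ≠ c := fun x hx => hh ⟨x, by simp [hx]⟩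
      refine ⟨fun q => ?_, ?_⟩
      · rw [hMq]
        simp [hN₁ c _ hc, he c hc]
      · by_cases hs : ∃ i, stem i = c
        · obtain ⟨i, rfl⟩ := hs
          rw [g_stem]; exact hinl i
        · rw [g_inl c fun i hi => hs ⟨i, hi⟩]
          exact hblank c hc fun i hi => hs ⟨i, hi⟩
    · refine ⟨fun q => ?_, ?_⟩
      · rw [hMq]; simp
      · exact hinr i
  rw [det_contract M (fun x => Sum.inl (corner x)) R 1 1 (fun h => rot (g h)) dist hR
    (fun _ => rfl) ?_ (fun h hh => (hinc h hh).2.1) (fun _ _ => by simp)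
    (fun h hh => (hinc h hh).2.2)]
  · congr 1
    ext x z
    show M.mulVec (fun h => if R h = z then (1 : ℝ) else 0) (Sum.inl (corner x)) = _
    rw [hMq, g_inl _ fun i hi => hcorner x i hi.symm, Sum.elim_inl, Sum.elim_inl,
      hsum x fun d => (if R (Sum.inl d) = z then (1 : ℝ) else 0)
        + (if R (rot (Sum.inl d)) = z then (1 : ℝ) else 0)]
    simp only [hR, hnext, Matrix.of_apply]
  · intro h hh
    ext k
    have := (hinc h hh).1 (Pi.single k 1)
    rw [Matrix.mulVec_single_one] at this
    simpa [Pi.single_apply, eq_comm] using this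

end Glue
-- Rotation of the triangles of one tree
namespace TriangleTree

variable {X : Type*} (T : TriangleTree X)

/-- The tree of triangles seen as a rooted plane tree, the root being the stem. -/
def body : PlaneTree X := PlaneTree.node T.left T.right

/-- The triangles that are not adjacent to the root. -/
def Inner : Type := T.left.Node ⊕ T.right.Node

instance : Finite T.Inner := inferInstanceAs (Finite (T.left.Node ⊕ T.right.Node))

/-- The corners of a triangle, in cyclic order. -/
def slot (n : Option T.Inner) (i : Fin 3) : T.Corner := T.body.slot n i

/-- The corner between an inner triangle and its parent. -/
def stemOf (m : T.Inner) : T.Corner := T.slot (some m) 0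

open Classical in
/-- A half-corner, that is a triangle together with one of its corners, is identified with its
corner, except if it lies above its corner, in which case it is identified with its triangle. -/
noncomputable def halfFun : Fin 3 × Option T.Inner → T.Corner ⊕ T.Inner
  | (i, n) => if i = 0 then (match n with
      | none => Sum.inl (T.slot none 0)
      | some m => Sum.inr m)
    else Sum.inl (T.slot n i)

theorem halfFun_some_zero (m : T.Inner) : T.halfFun (0, some m) = Sum.inr m := by
  simp [halfFun]

theorem halfFun_none (i : Fin 3) : T.halfFun (i, none) = Sum.inl (T.slot none i) := by
  by_cases hi : i = 0
  · subst hi; simp [halfFun]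
  · simp [halfFun, hi]

theorem halfFun_of_ne (n : Option T.Inner) {i : Fin 3} (hi : i ≠ 0) :
    T.halfFun (i, n) = Sum.inl (T.slot n i) := by
  simp [halfFun, hi]

theorem slot_ne_root (n : Option T.Inner) {i : Fin 3} (hi : i ≠ 0) :
    T.slot n i ≠ T.slot none 0 := PlaneTree.slot_ne_stem T.body n i hi

theorem exists_slot (c : T.Corner) (hc : c ≠ T.slot none 0) :
    ∃ (n : Option T.Inner) (i : Fin 3), i ≠ 0 ∧ T.slot n i = c :=
  PlaneTree.exists_slot T.body c hc

theorem step_slot (n : Option T.Inner) (i : Fin 3) : T.Step (T.slot n i) (T.slot n (i + 1)) :=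
  PlaneTree.step_slot T.body n i

theorem exists_of_step (c d : T.Corner) (h : T.Step c d) :
    ∃ (n : Option T.Inner) (i : Fin 3), T.slot n i = c ∧ T.slot n (i + 1) = d :=
  PlaneTree.exists_of_step T.body c d h

theorem slot_pair_injective (n m : Option T.Inner) (i j : Fin 3) (h : T.slot n i = T.slot m j)
    (h' : T.slot n (i + 1) = T.slot m (j + 1)) : n = m ∧ i = j :=
  PlaneTree.slot_pair_injective T.body n m i j h h'

/-- The root corner has the single half-corner `(0, none)`; any other corner lies above a unique
triangle, which gives a half-corner `(i, n)` with `i ≠ 0`. The half-corners left over are the `(0,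
some m)`, one for each inner triangle. -/
theorem halfFun_bijective : Function.Bijective T.halfFun := by
  constructor
  · rintro ⟨i, n⟩ ⟨j, m⟩ h
    by_cases hi : i = 0 <;> by_cases hj : j = 0
    · subst hi hj
      rcases n with _ | n <;> rcases m with _ | m
      · rfl
      · rw [halfFun_none, halfFun_some_zero] at h
        exact absurd h Sum.inl_ne_inr
      · rw [halfFun_none, halfFun_some_zero] at h
        exact absurd h Sum.inr_ne_inl
      · rw [halfFun_some_zero, halfFun_some_zero] at h
        rw [Sum.inr_injective h]
    · subst hi
      rw [halfFun_of_ne _ _ hj] at h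
      rcases n with _ | n
      · rw [halfFun_none] at h
        exact absurd (Sum.inl_injective h).symm (T.slot_ne_root m hj)
      · rw [halfFun_some_zero] at h
        exact absurd h Sum.inr_ne_inl
    · subst hj
      rw [halfFun_of_ne _ _ hi] at h
      rcases m with _ | m
      · rw [halfFun_none] at h
        exact absurd (Sum.inl_injective h) (T.slot_ne_root n hi)
      · rw [halfFun_some_zero] at h
        exact absurd h Sum.inl_ne_inr
    · rw [halfFun_of_ne _ _ hi, halfFun_of_ne _ _ hj] at h
      obtain ⟨h1, h2⟩ := PlaneTree.slot_injective T.body n m i j hi hj (Sum.inl_injective h)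
      exact Prod.ext h2 h1
  · rintro (c | m)
    · by_cases hc : c = T.slot none 0
      · exact ⟨(0, none), by rw [halfFun_none, hc]⟩
      · obtain ⟨n, i, hi, h⟩ := T.exists_slot c hc
        exact ⟨(i, n), by rw [halfFun_of_ne _ _ hi]; exact congrArg _ h⟩
    · exact ⟨(0, some m), T.halfFun_some_zero m⟩

/-- The half-corners. -/
noncomputable def half : T.Corner ⊕ T.Inner ≃ Fin 3 × Option T.Inner :=
  (Equiv.ofBijective _ T.halfFun_bijective).symm

theorem half_halfFun (p : Fin 3 × Option T.Inner) : T.half (T.halfFun p) = p :=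
  (Equiv.ofBijective _ T.halfFun_bijective).symm_apply_apply p

theorem halfFun_half (h : T.Corner ⊕ T.Inner) : T.halfFun (T.half h) = h :=
  (Equiv.ofBijective _ T.halfFun_bijective).apply_symm_apply h

/-- The rotation of the triangles. -/
noncomputable def rot : Perm (T.Corner ⊕ T.Inner) :=
  T.half.trans (((Equiv.addRight (1 : Fin 3)).prodCongr (Equiv.refl _)).trans T.half.symm)

theorem half_rot (h : T.Corner ⊕ T.Inner) : T.half (T.rot h) = ((T.half h).1 + 1, (T.half h).2) := by
  simp [rot, Prod.map]

theorem rot_halfFun (n : Option T.Inner) (i : Fin 3) :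
    T.rot (T.halfFun (i, n)) = T.halfFun (i + 1, n) := by
  apply T.half.injective
  rw [half_rot, half_halfFun, half_halfFun]

theorem corner_halfFun (n : Option T.Inner) (i : Fin 3) :
    Sum.elim id T.stemOf (T.halfFun (i, n)) = T.slot n i := by
  by_cases hi : i = 0
  · subst hi
    rcases n with _ | m
    · rw [halfFun_none]; rfl
    · rw [halfFun_some_zero]; rfl
  · rw [halfFun_of_ne _ _ hi]; rfl

theorem step_iff (c d : T.Corner) : T.Step c d ↔
    ∃ h, Sum.elim id T.stemOf h = c ∧ Sum.elim id T.stemOf (T.rot h) = d := by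
  constructor
  · intro h
    obtain ⟨n, i, h1, h2⟩ := T.exists_of_step c d h
    exact ⟨T.halfFun (i, n), (T.corner_halfFun n i).trans h1, by
      rw [rot_halfFun]; exact (T.corner_halfFun n (i + 1)).trans h2⟩
  · rintro ⟨h, h1, h2⟩
    rw [← T.halfFun_half h] at h1 h2
    generalize T.half h = p at h1 h2
    obtain ⟨i, n⟩ := p
    rw [corner_halfFun] at h1
    rw [rot_halfFun, corner_halfFun] at h2
    rw [← h1, ← h2]
    exact T.step_slot n i

theorem half_corner_injective (h k : T.Corner ⊕ T.Inner)
    (h₁ : Sum.elim id T.stemOf h = Sum.elim id T.stemOf k)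
    (h₂ : Sum.elim id T.stemOf (T.rot h) = Sum.elim id T.stemOf (T.rot k)) : h = k := by
  rw [← T.halfFun_half h, ← T.halfFun_half k] at h₁ h₂ ⊢
  generalize T.half h = p at h₁ h₂ ⊢
  generalize T.half k = q at h₁ h₂ ⊢
  obtain ⟨i, n⟩ := p
  obtain ⟨j, m⟩ := q
  rw [corner_halfFun, corner_halfFun] at h₁
  rw [rot_halfFun, rot_halfFun, corner_halfFun, corner_halfFun] at h₂
  obtain ⟨h3, h4⟩ := T.slot_pair_injective n m i j h₁ h₂
  rw [h3, h4]

theorem step_asymm (c d : T.Corner) (h : T.Step c d) : ¬ T.Step d c :=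
  PlaneTree.step_asymm T.body c d h

theorem stemOf_injective : Function.Injective T.stemOf := fun m m' h =>
  Option.some_injective _ (PlaneTree.slot_zero_injective T.body (some m) (some m') h)

theorem cornerLabel_of_ne {c : T.Corner} (hc : c ≠ T.slot none 0) :
    T.cornerLabel c = T.body.cornerLabel c := by
  match c with
  | none => exact absurd rfl hc
  | some (Sum.inl c) => rfl
  | some (Sum.inr c) => rfl

theorem stemOf_ne_root (m : T.Inner) : T.stemOf m ≠ T.slot none 0 := fun h =>
  Option.some_ne_none m (PlaneTree.slot_zero_injective T.body (some m) none h)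

theorem cornerLabel_stemOf (m : T.Inner) : T.cornerLabel (T.stemOf m) = none := by
  rw [T.cornerLabel_of_ne (T.stemOf_ne_root m)]
  exact PlaneTree.cornerLabel_slot_zero T.body (some m)

theorem labels_eq : T.labels = T.root.toList ++ T.body.labels := rfl

theorem mem_labels (x : X) : x ∈ T.labels ↔ ∃ c, T.cornerLabel c = some x := by
  rw [labels_eq, List.mem_append, PlaneTree.mem_labels]
  constructor
  · rintro (h | ⟨c, hc⟩)
    · exact ⟨T.slot none 0, (Option.mem_toList.mp h : T.root = some x)⟩
    · have : c ≠ T.slot none 0 := by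
        rintro rfl
        exact absurd (hc.symm.trans (PlaneTree.cornerLabel_slot_zero T.body none)) (by simp)
      exact ⟨c, by rw [T.cornerLabel_of_ne this, hc]⟩
  · rintro ⟨c, hc⟩
    by_cases h : c = T.slot none 0
    · subst h; exact Or.inl (Option.mem_toList.mpr (hc : T.root = some x))
    · rw [T.cornerLabel_of_ne h] at hc; exact Or.inr ⟨c, hc⟩

theorem cornerLabel_injective (h : T.labels.Nodup) (c d : T.Corner) (x : X)
    (hc : T.cornerLabel c = some x) (hd : T.cornerLabel d = some x) : c = d := by
  rw [labels_eq] at h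
  obtain ⟨-, h2, h3⟩ := List.nodup_append.mp h
  have aux : ∀ c, c ≠ T.slot none 0 → T.cornerLabel c = some x → T.root ≠ some x := by
    intro c hc h hr
    rw [T.cornerLabel_of_ne hc] at h
    exact h3 x (by simp [hr]) x ((PlaneTree.mem_labels _ x).mpr ⟨c, h⟩) rfl
  by_cases h1 : c = T.slot none 0 <;> by_cases h1' : d = T.slot none 0
  · rw [h1, h1']
  · subst h1; exact absurd hc (aux d h1' hd)
  · subst h1'; exact absurd hd (aux c h1 hc)
  · rw [T.cornerLabel_of_ne h1] at hc
    rw [T.cornerLabel_of_ne h1'] at hd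
    exact PlaneTree.cornerLabel_injective T.body h2 c d x hc hd

theorem walk_mem (S : Set X) : ∀ (T : PlaneTree X) (w : X × ℕ) (n : T.Node) (i : Fin 3), w.1 ∈ S →
    (∀ x ∈ T.labels, x ∈ S) → (T.walk w n i).1 ∈ S
  | .leaf _, _, n, _, _, _ => n.elim
  | .node l r, w, n, i, hw, h => by
    have hl : ∀ x ∈ l.labels, x ∈ S := fun x hx => h x (List.mem_append_left _ hx)
    have hr : ∀ x ∈ r.labels, x ∈ S := fun x hx => h x (List.mem_append_right _ hx)
    have henter : ∀ (T : PlaneTree X) (b : X × ℕ), b.1 ∈ S → (∀ x ∈ T.labels, x ∈ S) →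
        (T.enter b).1 ∈ S := by
      intro T b hb hT
      rw [PlaneTree.enter_fst]
      cases h : T.labels with
      | nil => exact hb
      | cons a l => exact hT a (by simp [h])
    match n, i with
    | none, 0 => exact hw
    | none, 1 => exact henter l _ (henter r _ hw hr) hl
    | none, 2 => exact henter r _ hw hr
    | some (Sum.inl n), i => exact walk_mem S l _ n i (henter r _ hw hr) hl
    | some (Sum.inr n), i => exact walk_mem S r _ n i hw hr

/-- The walk around a tree carrying at least one label. -/
theorem exists_walk (hT : T.labels ≠ []) : ∃ R : T.Corner ⊕ T.Inner → X × ℕ,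
    (∀ h, (R h).1 ∈ T.labels) ∧
    (∀ c x, T.cornerLabel c = some x → R (Sum.inl c) = (x, 0) ∧
      ∃ l₁ l₂, T.labels = l₁ ++ x :: l₂ ∧ (R (T.rot (Sum.inl c))).1 = l₂.headD (T.labels.headD x)) ∧
    (∀ c, T.cornerLabel c = none → (∀ m, T.stemOf m ≠ c) →
      R (Sum.inl c) = PlaneTree.farther (R (T.rot (Sum.inl c)))) ∧
    (∀ m, R (Sum.inr m) = PlaneTree.farther (R (T.rot (Sum.inl (T.stemOf m)))) ∧
      R (Sum.inl (T.stemOf m)) = PlaneTree.farther (R (T.rot (Sum.inr m)))) := by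
  -- `w` is what is seen from the root half-corner. At a root without label the walk comes back into
  -- the tree, so `w` has to be a fixed point of one turn.
  obtain ⟨w, hw, hwroot⟩ : ∃ w : X × ℕ, (∀ x, T.labels.headD x = w.1) ∧
      (∀ x, T.root = some x → w = (x, 0)) ∧
      (T.root = none → w = PlaneTree.farther (T.left.enter (T.right.enter w))) := by
    obtain ⟨x₀, -⟩ := List.exists_mem_of_ne_nil _ hT
    cases hr : T.root with
    | some x =>
      refine ⟨(x, 0), ?_, fun y hy => by cases hy; rfl, fun h => absurd h (by simp)⟩
      intro y; rw [labels_eq, hr]; rfl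
    | none =>
      have hne : T.body.labels ≠ [] := by
        intro h; apply hT; rw [labels_eq, hr, h]; rfl
      have hc := PlaneTree.enter_const T.body
      -- The starting value `(x₀, 0)` is arbitrary: some label lies above the root, so one turn
      -- forgets it and already gives the fixed point.
      refine ⟨T.body.enter (x₀, 0), ?_, fun x h => absurd h (by simp), fun _ => ?_⟩
      · intro y
        rw [PlaneTree.enter_fst]
        have : T.labels = T.body.labels := by rw [labels_eq, hr]; rfl
        rw [this]
        cases h : T.body.labels with
        | nil => exact absurd h hne
        | cons a l => rfl
      · by_cases hl : T.left.labels = []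
        · have hr : T.right.labels ≠ [] := fun h => hne (by
            show T.left.labels ++ T.right.labels = []; rw [hl, h]; rfl)
          show PlaneTree.farther (T.left.enter (T.right.enter _)) = _
          rw [PlaneTree.enter_const T.right _ (T.body.enter (x₀, 0)) hr]
        · show PlaneTree.farther (T.left.enter (T.right.enter _)) = _
          rw [PlaneTree.enter_const T.left _ (T.right.enter (T.body.enter (x₀, 0))) hl]
  set R : T.Corner ⊕ T.Inner → X × ℕ := fun h => T.body.walk w (T.half h).2 (T.half h).1 with hR
  have hRh : ∀ (n : Option T.Inner) i, R (T.halfFun (i, n)) = T.body.walk w n i := by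
    intro n i; simp only [hR, half_halfFun]
  have hcases : ∀ c : T.Corner, c ≠ T.slot none 0 → ∃ (n : Option T.Inner) (i : Fin 3), i ≠ 0 ∧ T.slot n i = c
      ∧ T.halfFun (i, n) = Sum.inl c := by
    intro c hc
    obtain ⟨n, i, hi, h⟩ := T.exists_slot c hc
    exact ⟨n, i, hi, h, by rw [halfFun_of_ne _ _ hi]; exact congrArg _ h⟩
  have hroot : T.halfFun (0, none) = Sum.inl (T.slot none 0) := T.halfFun_none 0
  refine ⟨R, fun h => walk_mem {x | x ∈ T.labels} T.body w _ _ ?_ ?_, ?_, ?_, ?_⟩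
  · show w.1 ∈ T.labels
    rw [← hw w.1]
    cases h : T.labels with
    | nil => exact absurd h hT
    | cons a l => simp
  · intro x hx
    show x ∈ T.labels
    rw [labels_eq]
    exact List.mem_append_right _ hx
  · intro c x hc
    by_cases h : c = T.slot none 0
    · subst h
      have hx : T.root = some x := hc
      have hw' := hwroot.1 x hx
      rw [← hroot, rot_halfFun, hRh, hRh]
      refine ⟨hw', [], T.body.labels, by rw [labels_eq, hx]; rfl, ?_⟩
      show (T.left.enter (T.right.enter w)).1 = _
      rw [PlaneTree.enter_fst, PlaneTree.enter_fst, hw]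
      show _ = (T.left.labels ++ T.right.labels).headD _
      cases T.left.labels <;> simp
    · obtain ⟨n, i, hi, h1, h2⟩ := hcases c h
      rw [T.cornerLabel_of_ne h, ← h1] at hc
      rw [← h2, rot_halfFun, hRh, hRh]
      refine ⟨PlaneTree.walk_label _ _ _ _ _ hi hc, ?_⟩
      obtain ⟨l₁, l₂, h3, h4⟩ := PlaneTree.walk_next_label T.body w n i x hi hc
      refine ⟨T.root.toList ++ l₁, l₂, by rw [labels_eq, h3]; simp, ?_⟩
      rw [h4, hw]
  · intro c hc hs
    by_cases h : c = T.slot none 0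
    · subst h
      rw [← hroot, rot_halfFun, hRh, hRh]
      exact hwroot.2 hc
    · obtain ⟨n, i, hi, h1, h2⟩ := hcases c h
      rw [T.cornerLabel_of_ne h, ← h1] at hc
      rw [← h2, rot_halfFun, hRh, hRh]
      refine PlaneTree.walk_blank T.body w n i hi hc ?_
      intro m hm
      rcases m with _ | m
      · exact T.slot_ne_root n hi hm.symm
      · exact hs m (hm.trans h1)
  · intro m
    obtain ⟨n, i, hi, h1, h2⟩ := hcases _ (T.stemOf_ne_root m)
    rw [← h2, ← T.halfFun_some_zero m, rot_halfFun, rot_halfFun, hRh, hRh, hRh, hRh]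
    obtain ⟨h3, h4⟩ := PlaneTree.walk_glued T.body w n (some m) i hi h1.symm
    exact ⟨h4, h3⟩

end TriangleTree

/-! ### Integration over the edge variables -/

section Gauss

open Classical in
/-- Integration over all the variables except those of the corners. -/
theorem det_diagPart_add_antisymmPart {E C : Type*} [Fintype E] [Fintype C] (Ω t : E → ℝ)
    (ε : Matrix E C ℝ) (α : Matrix C C ℝ) :
    (diagPart Ω t + antisymmPart ε α).det
      = (α + Matrix.of fun i j => ∑ e, (Ω e / t e * (ε e i * ε e j)
          + Ω e * t e * (|ε e i| * |ε e j|)) / 2).det := by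
  set Δ : Matrix (E ⊕ E) (E ⊕ E) ℝ :=
    Matrix.diagonal (Sum.elim (fun e => Ω e / t e) fun e => Ω e * t e) with hΔ
  set B₂ : Matrix (E ⊕ E) C ℝ :=
    Matrix.fromRows ((√2)⁻¹ • ε) ((√2)⁻¹ • ε.map (fun r => |r|)) with hB₂
  have hD : (diagPart Ω t : Matrix (GaussIndex E C) (GaussIndex E C) ℝ)
      = Matrix.fromBlocks (Matrix.fromBlocks Δ 0 0 0) 0 0 0 := by
    rw [diagPart, ← Matrix.fromBlocks_diagonal, ← Matrix.fromBlocks_diagonal, Matrix.diagonal_zero,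
      Matrix.diagonal_zero]
  rw [hD, antisymmPart, Matrix.fromBlocks_add, Matrix.fromBlocks_add]
  simp only [zero_add, add_zero]
  -- The block of the edge variables is invertible for every `Δ`, so the Schur complement requires
  -- no condition on `Ω`.
  have hinv : (Matrix.fromBlocks Δ 1 (-1) 0 : Matrix ((E ⊕ E) ⊕ (E ⊕ E)) ((E ⊕ E) ⊕ (E ⊕ E)) ℝ)
      * Matrix.fromBlocks 0 (-1) 1 Δ = 1 := by
    rw [Matrix.fromBlocks_multiply, ← Matrix.fromBlocks_one]
    simp
  letI : Invertible (Matrix.fromBlocks Δ 1 (-1) 0 : Matrix ((E ⊕ E) ⊕ (E ⊕ E)) ((E ⊕ E) ⊕ (E ⊕ E)) ℝ) :=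
    ⟨_, mul_eq_one_comm.mp hinv, hinv⟩
  have hdet : (Matrix.fromBlocks Δ 1 (-1) 0 : Matrix ((E ⊕ E) ⊕ (E ⊕ E)) ((E ⊕ E) ⊕ (E ⊕ E)) ℝ).det = 1 := by
    have : (Matrix.fromBlocks Δ 1 (-1) 0 : Matrix ((E ⊕ E) ⊕ (E ⊕ E)) ((E ⊕ E) ⊕ (E ⊕ E)) ℝ)
        * Matrix.fromBlocks 1 0 (-Δ) 1
        = Matrix.fromBlocks 0 1 (-1) 0 := by
      rw [Matrix.fromBlocks_multiply]; simp
    have h1 := congrArg Matrix.det this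
    rw [Matrix.det_mul, Matrix.det_fromBlocks_zero₁₂, Matrix.det_one, mul_one, mul_one] at h1
    have h2 : (Matrix.fromBlocks 1 1 0 1 * Matrix.fromBlocks 1 0 (-1) 1 *
        Matrix.fromBlocks 1 1 0 1 : Matrix ((E ⊕ E) ⊕ (E ⊕ E)) ((E ⊕ E) ⊕ (E ⊕ E)) ℝ)
        = Matrix.fromBlocks 0 1 (-1) 0 := by
      rw [Matrix.fromBlocks_multiply, Matrix.fromBlocks_multiply]; simp
    rw [h1, ← h2]
    simp [Matrix.det_fromBlocks_zero₁₂, Matrix.det_fromBlocks_zero₂₁]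
  rw [Matrix.det_fromBlocks₁₁, hdet, one_mul]
  -- The corners are joined only to `lam` and `mu`, where the inverse has the block `Δ`. Two factors
  -- `(√2)⁻¹` give the `1 / 2`.
  have hinv' : ⅟(Matrix.fromBlocks Δ 1 (-1) 0 : Matrix ((E ⊕ E) ⊕ (E ⊕ E)) ((E ⊕ E) ⊕ (E ⊕ E)) ℝ) = Matrix.fromBlocks 0 (-1) 1 Δ := rfl
  rw [hinv', Matrix.neg_mul, Matrix.neg_mul, sub_neg_eq_add]
  congr 2
  rw [Matrix.transpose_fromRows, Matrix.fromCols_mul_fromBlocks, Matrix.fromCols_mul_fromRows]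
  simp only [Matrix.transpose_zero, Matrix.zero_mul, Matrix.mul_zero, Matrix.mul_one, zero_add]
  ext i j
  rw [Matrix.mul_assoc, Matrix.mul_apply, Fintype.sum_sum_type, Matrix.of_apply, ← Finset.sum_add_distrib]
  refine Finset.sum_congr rfl fun e _ => ?_
  have h2 : (√2 : ℝ)⁻¹ * (√2)⁻¹ = 1 / 2 := by
    rw [← mul_inv, Real.mul_self_sqrt (by norm_num)]; norm_num
  simp only [Matrix.transpose_apply, Matrix.fromRows_apply_inl, Matrix.fromRows_apply_inr,
    Matrix.smul_apply, Matrix.map_apply, smul_eq_mul, Matrix.diagonal_mul, Δ, Sum.elim_inl, Sum.elim_inr]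
  linear_combination (Ω e / t e * (ε e i * ε e j) + Ω e * t e * (|ε e i| * |ε e j|)) * h2

end Gauss

/-! ### Coupling of the half-edges -/

namespace RibbonGraph

variable {X : Type*} (G : RibbonGraph X)

/-- The other half-edge of the same edge, with the same direction of rotation. -/
def twin (x : X) : X := G.θ (G.σ₁ x)

theorem twin_twin (x : X) : G.twin (G.twin x) = x := by
  simp [twin, ← G.θ_σ₁, G.θ_θ, G.σ₁_σ₁]

theorem σ₁_twin_ne {x : X} (hx : G.σ₁ x ≠ x) : G.σ₁ (G.twin x) ≠ G.twin x := by
  unfold twin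
  rw [← G.θ_σ₁]
  exact fun h => hx (G.σ₁.injective (G.θ.injective h))

theorem twin_ne (x : X) : G.twin x ≠ x := fun h => G.θ_ne_σ₁ x (by
  have := congrArg G.θ h; rw [twin, G.θ_θ] at this; exact this.symm)

theorem IsOrientation.twin_mem {G : RibbonGraph X} {pos : Set X} (h : G.IsOrientation pos) {x : X}
    (hx : G.σ₁ x ≠ x) : G.twin x ∈ pos ↔ x ∈ pos := by
  rw [twin, h.θ_mem, h.σ₁_mem x hx, not_not]

theorem IsEdgeFunction.twin {G : RibbonGraph X} {w : X → ℝ} (h : G.IsEdgeFunction w) (x : X) :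
    w (G.twin x) = w x := by rw [RibbonGraph.twin, h.1, h.2]

open Classical in
/-- The quadratic form of the half-edges, obtained by integration over the variables of the edges.
Flags are given the identity. -/
noncomputable def coupling (Ω t : X → ℝ) (x y : X) : ℝ :=
  if G.σ₁ x = x then (if y = x then 1 else 0)
  else (Ω x / t x + Ω x * t x) / 2 * (if y = x then 1 else 0)
    + (Ω x * t x - Ω x / t x) / 2 * (if y = G.twin x then 1 else 0)

theorem coupling_symm {Ω t : X → ℝ} (hΩ : G.IsEdgeFunction Ω) (ht : G.IsEdgeFunction t) (x y : X) :
    G.coupling Ω t x y = G.coupling Ω t y x := by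
  by_cases hxy : y = x
  · rw [hxy]
  by_cases hxy' : y = G.twin x
  · subst hxy'
    have h1 : G.σ₁ (G.twin x) = G.twin x ↔ G.σ₁ x = x :=
      ⟨fun h => by_contra fun h' => G.σ₁_twin_ne h' h, fun h => by_contra fun h' =>
        G.σ₁_twin_ne h' (by rwa [twin_twin])⟩
    by_cases h2 : G.σ₁ x = x <;>
      simp [coupling, h1, h2, twin_twin, hΩ.twin, ht.twin, (G.twin_ne x).symm, G.twin_ne]
  · have h2 : x ≠ G.twin y := fun h => hxy' (by rw [h, twin_twin])
    simp [coupling, hxy, hxy', Ne.symm hxy, h2]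

namespace Presentation

variable {G} (P : G.Presentation)

open Classical in
-- Only the edge through `x` contributes. Between its two ends the product of the entries of `ε` is
-- `-1` and that of the absolute values is `1`, hence the sign of `Ω / t` in the coupling of `x`
-- with its twin, whichever end is the tail.
theorem sum_incidence [Fintype P.EdgeIndex] {Ω t : X → ℝ} (hΩ : G.IsEdgeFunction Ω)
    (ht : G.IsEdgeFunction t) (i j : P.InternalCorner) (x : X) (hx : P.cornerLabel i.1 = some x)
    (hpos : x ∈ P.pos) (hx₁ : G.σ₁ x ≠ x) :
    ∑ e : P.EdgeIndex, (Ω e.1 / t e.1 * (P.incidence e i * P.incidence e j)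
          + Ω e.1 * t e.1 * (|P.incidence e i| * |P.incidence e j|)) / 2
      = (P.cornerLabel j.1).elim 0 (G.coupling Ω t x) := by
  obtain ⟨e₀, he₀⟩ : ∃ e₀ : P.EdgeIndex, x = e₀.1 ∨ x = G.twin e₀.1 := by
    by_cases h : x ∈ P.tail
    · exact ⟨⟨x, h⟩, Or.inl rfl⟩
    · have : G.θ (G.σ₁ x) ∈ P.tail := by
        by_contra h'; exact h ((P.tail_iff x hpos hx₁).mpr h')
      exact ⟨⟨_, this⟩, Or.inr (G.twin_twin x).symm⟩
  have huniq : ∀ e : P.EdgeIndex, e ≠ e₀ → P.incidence e i = 0 := by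
    intro e he
    have h0 := P.tail_iff _ (P.tail_mem _ e₀.2).1 (P.tail_mem _ e₀.2).2
    have he' : e.1 ≠ e₀.1 := fun h => he (Subtype.ext h)
    have he'' : e.1 ≠ G.twin e₀.1 := fun h => h0.mp e₀.2 (by rw [← twin, ← h]; exact e.2)
    have h1 : x ≠ G.twin e.1 := by
      rcases he₀ with h | h
      · rw [h]; intro h'; apply he''; rw [h', twin_twin]
      · rw [h]; intro h'; apply he'; rw [← G.twin_twin e.1, ← h', twin_twin]
    have h2 : x ≠ e.1 := by
      rcases he₀ with h | h
      · rw [h]; exact he'.symm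
      · rw [h]; exact he''.symm
    simp only [incidence, Matrix.of_apply, hx, Option.some.injEq]
    rw [if_neg (show ¬ x = G.θ (G.σ₁ e.1) from h1), if_neg h2]
  rw [Finset.sum_eq_single e₀ (fun e _ he => by rw [huniq e he]; simp) (by simp)]
  have hne := G.twin_ne e₀.1
  have hΩ₀ : Ω e₀.1 = Ω x := by rcases he₀ with h | h <;> rw [h]; rw [hΩ.twin]
  have ht₀ : t e₀.1 = t x := by rcases he₀ with h | h <;> rw [h]; rw [ht.twin]
  rw [hΩ₀, ht₀]
  simp only [incidence, Matrix.of_apply, hx, Option.some.injEq]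
  have hb : ∀ y, G.θ (G.σ₁ y) = G.twin y := fun _ => rfl
  simp only [hb]
  cases hy : P.cornerLabel j.1 with
  | none => simp
  | some y =>
    simp only [Option.elim_some, coupling, if_neg hx₁, Option.some.injEq]
    rcases he₀ with h | h
    · rw [h] at hx₁ ⊢
      by_cases h1 : y = e₀.1
      · simp [h1, hne.symm]
      · by_cases h2 : y = G.twin e₀.1
        · simp [h2, hne, hne.symm]; ring
        · simp [h1, h2]
    · rw [h]
      rw [twin_twin]
      by_cases h1 : y = e₀.1
      · simp [h1, hne.symm]; ring
      · by_cases h2 : y = G.twin e₀.1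
        · simp [h2, hne]
        · simp [h1, h2]

end Presentation
end RibbonGraph
-- Elimination of the trees: the closed form of the determinant
namespace RibbonGraph

variable {X : Type*} (G : RibbonGraph X)

section ClosedForm

open Classical in
/-- The value at `a` of an unknown function on the half-ribbons. -/
noncomputable def coord (pos : Set X) (a : X) : pos → ℝ := fun y => if a = y then 1 else 0

/-- Sum of the values at `a` and at the next half-ribbon. -/
noncomputable def sumForm (pos : Set X) (a : X) : pos → ℝ := coord pos a + coord pos (G.σ₀ a)

/-- Difference of the values at `a` and at the next half-ribbon. -/
noncomputable def diffForm (pos : Set X) (a : X) : pos → ℝ := coord pos a - coord pos (G.σ₀ a)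

open Classical in
/-- The linear form attached to a half-ribbon. -/
noncomputable def form (pos : Set X) (Ω t : X → ℝ) (x : X) : pos → ℝ :=
  if G.σ₁ x = x then G.sumForm pos x
  else ((Ω x / t x + Ω x * t x) / 2) • G.sumForm pos x
    + ((Ω x * t x - Ω x / t x) / 2) • G.sumForm pos (G.twin x) + G.diffForm pos x

/-- The linear forms attached to the half-ribbons. -/
noncomputable def formMatrix (pos : Set X) (Ω t : X → ℝ) : Matrix pos pos ℝ :=
  Matrix.of fun x => G.form pos Ω t x

open Classical in
/-- An expression of the first hyperbolic polynomial which does not use trees. -/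
noncomputable def closedValue [Finite X] (pos tail : Set X) (Ω t : X → ℝ) : ℝ :=
  letI := Fintype.ofFinite X
  if G.bare = 0 then (∏ e : tail, t e) * (G.formMatrix pos Ω t).det else 0

end ClosedForm

namespace Presentation

variable {G} (P : G.Presentation)

/-- Translates the indexed cyclic order of a presentation into the form produced by the walk: if
nothing follows `x`, its successor is the head of the whole list. -/
theorem headD_eq_of_cyclic (f : X → X) (x : X) (l₁ l₂ l : List X) (h : l = l₁ ++ x :: l₂)
    (hf : ∀ (k : ℕ) (hk : k < l.length),
      f l[k] = l[(k + 1) % l.length]'(Nat.mod_lt _ (by omega))) :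
    l₂.headD (l.headD x) = f x := by
  subst h
  have h1 := hf l₁.length (by simp)
  rw [List.getElem_append_right (le_refl _)] at h1
  simp only [Nat.sub_self, List.getElem_cons_zero] at h1
  rw [h1]
  cases l₂ with
  | nil =>
    have : (l₁.length + 1) % (l₁ ++ [x]).length = 0 := by simp
    simp only [this]
    cases l₁ <;> simp
  | cons a l =>
    have : (l₁.length + 1) % (l₁ ++ x :: a :: l).length = l₁.length + 1 :=
      Nat.mod_eq_of_lt (by simp)
    simp only [this]
    rw [List.getElem_append_right (by omega)]
    simp

/-- The triangles that are not adjacent to a root. -/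
def Inner : Type _ := Σ v : G.Vertex, (P.tree v).Inner

instance [Finite X] : Finite P.Inner := inferInstanceAs (Finite (Σ v : G.Vertex, (P.tree v).Inner))

/-- The half-corners of all the trees. -/
def lift (v : G.Vertex) : (P.tree v).Corner ⊕ (P.tree v).Inner → P.Corner ⊕ P.Inner
  | Sum.inl c => Sum.inl ⟨v, c⟩
  | Sum.inr m => Sum.inr ⟨v, m⟩

theorem exists_lift (h : P.Corner ⊕ P.Inner) : ∃ v k, P.lift v k = h := by
  rcases h with ⟨v, c⟩ | ⟨v, m⟩
  · exact ⟨v, Sum.inl c, rfl⟩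
  · exact ⟨v, Sum.inr m, rfl⟩

/-- The half-corners, sorted by trees. -/
def sortHalf : P.Corner ⊕ P.Inner ≃ Σ v : G.Vertex, (P.tree v).Corner ⊕ (P.tree v).Inner :=
  (Equiv.sigmaSumDistrib (fun v : G.Vertex => (P.tree v).Corner)
    fun v => (P.tree v).Inner).symm

theorem sortHalf_lift (v : G.Vertex) (k : (P.tree v).Corner ⊕ (P.tree v).Inner) :
    P.sortHalf (P.lift v k) = ⟨v, k⟩ := by
  rcases k with c | m <;> rfl

/-- The rotation of all the triangles. -/
noncomputable def rot : Perm (P.Corner ⊕ P.Inner) :=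
  P.sortHalf.trans ((Equiv.sigmaCongrRight fun v => (P.tree v).rot).trans P.sortHalf.symm)

theorem rot_lift (v : G.Vertex) (k : (P.tree v).Corner ⊕ (P.tree v).Inner) :
    P.rot (P.lift v k) = P.lift v ((P.tree v).rot k) := by
  apply P.sortHalf.injective
  rw [sortHalf_lift, rot]
  simp [sortHalf_lift]

/-- The corner between an inner triangle and its parent. -/
def stemOf (m : P.Inner) : P.Corner := ⟨m.1, (P.tree m.1).stemOf m.2⟩

/-- The corner of a half-corner. -/
def cornerOf : P.Corner ⊕ P.Inner → P.Corner := Sum.elim id P.stemOf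

theorem cornerOf_lift (v : G.Vertex) (k : (P.tree v).Corner ⊕ (P.tree v).Inner) :
    P.cornerOf (P.lift v k) = ⟨v, Sum.elim id (P.tree v).stemOf k⟩ := by
  rcases k with c | m <;> rfl

theorem stemOf_injective : Function.Injective P.stemOf := by
  rintro ⟨v, m⟩ ⟨v', m'⟩ h
  obtain ⟨h1, h2⟩ := Sigma.mk.inj h
  dsimp only at h1
  subst h1
  exact congrArg (fun m => (⟨v, m⟩ : P.Inner)) ((P.tree v).stemOf_injective (eq_of_heq h2))

/-- The half-corners, sorted by triangles. -/
noncomputable def half : P.Corner ⊕ P.Inner ≃ Fin 3 × Σ v : G.Vertex, Option (P.tree v).Inner :=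
  P.sortHalf.trans ((Equiv.sigmaCongrRight fun v => (P.tree v).half).trans
    { toFun := fun p => (p.2.1, ⟨p.1, p.2.2⟩)
      invFun := fun p => ⟨p.2.1, p.1, p.2.2⟩
      left_inv := fun _ => rfl
      right_inv := fun _ => rfl })

theorem half_lift (v : G.Vertex) (k : (P.tree v).Corner ⊕ (P.tree v).Inner) :
    P.half (P.lift v k) = (((P.tree v).half k).1, ⟨v, ((P.tree v).half k).2⟩) := by
  simp [half, sortHalf_lift]

theorem half_rot (h : P.Corner ⊕ P.Inner) : P.half (P.rot h) = ((P.half h).1 + 1, (P.half h).2) := by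
  obtain ⟨v, k, rfl⟩ := P.exists_lift h
  rw [rot_lift, half_lift, half_lift, TriangleTree.half_rot]

theorem rot_mul_rot : P.rot * P.rot = P.rot⁻¹ := by
  rw [eq_inv_iff_mul_eq_one]
  ext1 h
  apply P.half.injective
  simp only [Perm.mul_apply, half_rot, Perm.one_apply]
  ext1
  · show (P.half h).1 + 1 + 1 + 1 = (P.half h).1
    generalize (P.half h).1 = i
    fin_cases i <;> rfl
  · rfl

theorem step_iff (c d : P.Corner) : P.Step c d ↔
    ∃ h, P.cornerOf h = c ∧ P.cornerOf (P.rot h) = d := by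
  constructor
  · rintro ⟨v, i, j, h⟩
    obtain ⟨k, h1, h2⟩ := ((P.tree v).step_iff i j).mp h
    exact ⟨P.lift v k, by rw [cornerOf_lift, h1], by rw [rot_lift, cornerOf_lift, h2]⟩
  · rintro ⟨h, rfl, rfl⟩
    obtain ⟨v, k, rfl⟩ := P.exists_lift h
    rw [rot_lift, cornerOf_lift, cornerOf_lift]
    exact ⟨v, _, _, ((P.tree v).step_iff _ _).mpr ⟨k, rfl, rfl⟩⟩

theorem half_corner_injective (h k : P.Corner ⊕ P.Inner) (h₁ : P.cornerOf h = P.cornerOf k)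
    (h₂ : P.cornerOf (P.rot h) = P.cornerOf (P.rot k)) : h = k := by
  obtain ⟨v, h, rfl⟩ := P.exists_lift h
  obtain ⟨v', k, rfl⟩ := P.exists_lift k
  rw [rot_lift, rot_lift, cornerOf_lift, cornerOf_lift] at h₂
  rw [cornerOf_lift, cornerOf_lift] at h₁
  obtain ⟨h3, h4⟩ := Sigma.mk.inj h₁
  subst h3
  rw [(P.tree v).half_corner_injective h k (eq_of_heq h4) (eq_of_heq (Sigma.mk.inj h₂).2)]

theorem step_asymm (c d : P.Corner) (h : P.Step c d) : ¬ P.Step d c := by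
  obtain ⟨v, i, j, h⟩ := h
  intro h'
  generalize hc : (⟨v, i⟩ : P.Corner) = c at h'
  generalize hd : (⟨v, j⟩ : P.Corner) = d at h'
  obtain ⟨v', i', j', h'⟩ := h'
  obtain ⟨h3, h4⟩ := Sigma.mk.inj hc
  subst h3
  obtain rfl := eq_of_heq h4
  obtain rfl := eq_of_heq (Sigma.mk.inj hd).2
  exact (P.tree v).step_asymm _ _ h h'

theorem cornerLabel_stemOf (m : P.Inner) : P.cornerLabel (P.stemOf m) = none :=
  (P.tree m.1).cornerLabel_stemOf m.2

theorem exists_corner (x : X) (hx : x ∈ P.pos) : ∃ c, P.cornerLabel c = some x := by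
  obtain ⟨c, hc⟩ := ((P.tree (Sum.inl (Quotient.mk G.vertexSetoid x))).mem_labels x).mp
    ((P.mem_labels _ x).mpr ⟨hx, rfl⟩)
  exact ⟨⟨_, c⟩, hc⟩

theorem mem_of_cornerLabel {c : P.Corner} {x : X} (h : P.cornerLabel c = some x) :
    x ∈ P.pos ∧ Sum.inl (Quotient.mk G.vertexSetoid x) = c.1 :=
  (P.mem_labels c.1 x).mp (((P.tree c.1).mem_labels x).mpr ⟨c.2, h⟩)

theorem cornerLabel_injective {c d : P.Corner} {x : X} (hc : P.cornerLabel c = some x)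
    (hd : P.cornerLabel d = some x) : c = d := by
  obtain ⟨v, c⟩ := c
  obtain ⟨v', d⟩ := d
  have h : v = v' := ((P.mem_of_cornerLabel hc).2.symm.trans (P.mem_of_cornerLabel hd).2 : _)
  subst h
  rw [(P.tree v).cornerLabel_injective (P.nodup_labels v) c d x hc hd]

theorem next_eq (v : G.Vertex) (x : X) (l₁ l₂ : List X) (h : (P.tree v).labels = l₁ ++ x :: l₂) :
    l₂.headD ((P.tree v).labels.headD x) = G.σ₀ x :=
  headD_eq_of_cyclic G.σ₀ x l₁ l₂ _ h (P.next_label v)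

theorem labels_ne_nil (hb : G.bare = 0) (v : G.Vertex) : (P.tree v).labels ≠ [] := by
  rcases v with q | k
  · obtain ⟨x, rfl⟩ := Quotient.exists_rep q
    obtain ⟨y, hy, hq⟩ : ∃ y ∈ P.pos, Quotient.mk G.vertexSetoid y = Quotient.mk G.vertexSetoid x := by
      by_cases hx : x ∈ P.pos
      · exact ⟨x, hx, rfl⟩
      · refine ⟨G.θ x, (P.isOrientation.θ_mem x).mpr hx, Quotient.sound (Or.inr ?_)⟩
        rw [G.θ_θ]
    have := (P.mem_labels (Sum.inl (Quotient.mk G.vertexSetoid x)) y).mpr ⟨hy, by rw [hq]⟩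
    exact List.ne_nil_of_mem this
  · exact absurd k.2 (by omega)

theorem exists_walk (hb : G.bare = 0) : ∃ R : P.Corner ⊕ P.Inner → X × ℕ,
    (∀ h, (R h).1 ∈ P.pos) ∧
    (∀ c x, P.cornerLabel c = some x → R (Sum.inl c) = (x, 0) ∧
      (R (P.rot (Sum.inl c))).1 = G.σ₀ x) ∧
    (∀ c, P.cornerLabel c = none → (∀ m, P.stemOf m ≠ c) →
      R (Sum.inl c) = PlaneTree.farther (R (P.rot (Sum.inl c)))) ∧
    (∀ m, R (Sum.inr m) = PlaneTree.farther (R (P.rot (Sum.inl (P.stemOf m)))) ∧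
      R (Sum.inl (P.stemOf m)) = PlaneTree.farther (R (P.rot (Sum.inr m)))) := by
  choose R h1 h2 h3 h4 using fun v => (P.tree v).exists_walk (P.labels_ne_nil hb v)
  let R' : P.Corner ⊕ P.Inner → X × ℕ := fun h => R (P.sortHalf h).1 (P.sortHalf h).2
  have hR' : ∀ v k, R' (P.lift v k) = R v k := by
    intro v k
    show R (P.sortHalf (P.lift v k)).1 (P.sortHalf (P.lift v k)).2 = _
    rw [sortHalf_lift]
  refine ⟨R', ?_, ?_, ?_, ?_⟩
  · intro h
    obtain ⟨v, k, rfl⟩ := P.exists_lift h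
    rw [hR']
    exact ((P.mem_labels v _).mp (h1 v k)).1
  · rintro ⟨v, c⟩ x hx
    obtain ⟨h5, l₁, l₂, h6, h7⟩ := h2 v c x hx
    have e : (Sum.inl ⟨v, c⟩ : P.Corner ⊕ P.Inner) = P.lift v (Sum.inl c) := rfl
    rw [e, rot_lift, hR', hR', h7]
    exact ⟨h5, P.next_eq v x l₁ l₂ h6⟩
  · rintro ⟨v, c⟩ hc hs
    have e : (Sum.inl ⟨v, c⟩ : P.Corner ⊕ P.Inner) = P.lift v (Sum.inl c) := rfl
    rw [e, rot_lift, hR', hR']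
    refine h3 v c hc fun m hm => hs ⟨v, m⟩ ?_
    rw [← hm]; rfl
  · rintro ⟨v, m⟩
    have e1 : (Sum.inr ⟨v, m⟩ : P.Corner ⊕ P.Inner) = P.lift v (Sum.inr m) := rfl
    have e2 : (Sum.inl (P.stemOf ⟨v, m⟩) : P.Corner ⊕ P.Inner)
      = P.lift v (Sum.inl ((P.tree v).stemOf m)) := rfl
    rw [e1, e2, rot_lift, rot_lift, hR', hR', hR', hR']
    exact h4 v m

open Classical in
/-- The antisymmetric adjacency matrix of all the corners. -/
noncomputable def fullAdjacency : Matrix P.Corner P.Corner ℝ :=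
  Matrix.of fun i j => if P.Step i j then 1 else if P.Step j i then -1 else 0

open Classical in
/-- The coupling of the labelled corners, the flags being given the identity. -/
noncomputable def fullCoupling (Ω t : X → ℝ) : Matrix P.Corner P.Corner ℝ :=
  Matrix.of fun c d => (P.cornerLabel c).elim 0 fun x =>
    (P.cornerLabel d).elim 0 (G.coupling Ω t x)

open Classical in
/-- `0` at the external corners, `1` at the internal ones. -/
noncomputable def internalWeight (c : P.Corner) : ℝ := if P.IsExternal c then 0 else 1

open Classical in
-- Each sum has at most one nonzero term, since a side determines its half-corner, and no two
-- corners are joined in both directions.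
theorem fullAdjacency_eq [Fintype P.Corner] [Fintype P.Inner] (c d : P.Corner) :
    P.fullAdjacency c d
      = (∑ h, if P.cornerOf h = c ∧ P.cornerOf (P.rot h) = d then (1 : ℝ) else 0)
        - ∑ h, if P.cornerOf h = d ∧ P.cornerOf (P.rot h) = c then (1 : ℝ) else 0 := by
  have key : ∀ c d, (∑ h, if P.cornerOf h = c ∧ P.cornerOf (P.rot h) = d then (1 : ℝ) else 0)
      = if P.Step c d then 1 else 0 := by
    intro c d
    by_cases h : P.Step c d
    · obtain ⟨k, h1, h2⟩ := (P.step_iff c d).mp h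
      rw [if_pos h, Finset.sum_eq_single k, if_pos ⟨h1, h2⟩]
      · intro k' _ hk'
        rw [if_neg]
        rintro ⟨h3, h4⟩
        exact hk' (P.half_corner_injective k' k (h3.trans h1.symm) (h4.trans h2.symm))
      · simp
    · rw [if_neg h]
      refine Finset.sum_eq_zero fun k _ => if_neg fun hk => h ((P.step_iff c d).mpr ⟨k, hk⟩)
  rw [key, key, fullAdjacency, Matrix.of_apply]
  by_cases h : P.Step c d
  · rw [if_pos h, if_pos h, if_neg (P.step_asymm c d h), sub_zero]
  · rw [if_neg h, if_neg h, zero_sub]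
    split_ifs <;> simp

open Classical in
-- An external corner has weight 0 and coupling 1 with itself, so its row is a unit row and can be
-- expanded away. The minus sign comes from transposing: the adjacency matrix is antisymmetric and
-- the coupling symmetric.
theorem det_internal [Fintype P.Corner] [Fintype P.InternalCorner] [Fintype P.EdgeIndex]
    {Ω t : X → ℝ} (hΩ : G.IsEdgeFunction Ω) (ht : G.IsEdgeFunction t) :
    (P.adjacency + Matrix.of fun i j => ∑ e : P.EdgeIndex,
      (Ω e.1 / t e.1 * (P.incidence e i * P.incidence e j)
          + Ω e.1 * t e.1 * (|P.incidence e i| * |P.incidence e j|)) / 2).det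
      = (P.fullCoupling Ω t - Matrix.diagonal P.internalWeight * P.fullAdjacency).det := by
  have hext : ∀ c, P.IsExternal c → ∀ d, (P.fullCoupling Ω t -
      Matrix.diagonal P.internalWeight * P.fullAdjacency) c d = if c = d then 1 else 0 := by
    rintro c ⟨x, hx, hx₁⟩ d
    have hw : P.internalWeight c = 0 := if_pos ⟨x, hx, hx₁⟩
    rw [Matrix.sub_apply, Matrix.diagonal_mul, hw, zero_mul, sub_zero, fullCoupling,
      Matrix.of_apply, hx]
    by_cases hcd : c = d
    · rw [← hcd, hx]; simp [coupling, hx₁]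
    · rw [if_neg hcd]
      cases hy : P.cornerLabel d with
      | none => rfl
      | some y =>
        have : y ≠ x := fun h => hcd (P.cornerLabel_injective hx (h ▸ hy))
        simp [coupling, hx₁, this]
  rw [Matrix.twoBlockTriangular_det' _ P.IsExternal]
  swap
  · intro i hi j hj
    rw [hext i hi, if_neg]
    exact fun h => hj (h ▸ hi)
  have h1 : (P.fullCoupling Ω t - Matrix.diagonal P.internalWeight * P.fullAdjacency).toSquareBlockProp
      P.IsExternal = 1 := by
    ext i j
    rw [Matrix.toSquareBlockProp_def, Matrix.of_apply, hext _ i.2, Matrix.one_apply]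
    simp [Subtype.ext_iff]
  rw [h1, Matrix.det_one, one_mul, ← Matrix.det_transpose]
  have h2 : (P.adjacency + Matrix.of fun i j => ∑ e : P.EdgeIndex,
      (Ω e.1 / t e.1 * (P.incidence e i * P.incidence e j)
          + Ω e.1 * t e.1 * (|P.incidence e i| * |P.incidence e j|)) / 2).transpose
      = (P.fullCoupling Ω t - Matrix.diagonal P.internalWeight * P.fullAdjacency).toSquareBlockProp
        fun c => ¬ P.IsExternal c := by
    ext (i : P.InternalCorner) (j : P.InternalCorner)
    show P.adjacency j i + ∑ e : P.EdgeIndex, (Ω e.1 / t e.1 * (P.incidence e j * P.incidence e i)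
        + Ω e.1 * t e.1 * (|P.incidence e j| * |P.incidence e i|)) / 2
      = P.fullCoupling Ω t i.1 j.1 - (Matrix.diagonal P.internalWeight * P.fullAdjacency) i.1 j.1
    rw [Matrix.diagonal_mul]
    have hw : P.internalWeight i.1 = 1 := if_neg i.2
    have hadj : P.adjacency j i = - P.fullAdjacency i.1 j.1 := by
      rw [adjacency, fullAdjacency, Matrix.of_apply, Matrix.of_apply]
      by_cases h : P.Step j.1 i.1
      · rw [if_pos h, if_neg (P.step_asymm _ _ h), if_pos h, neg_neg]
      · rw [if_neg h, if_neg h]; split_ifs <;> simp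
    rw [hadj]
    have hsum : ∑ e : P.EdgeIndex, (Ω e.1 / t e.1 * (P.incidence e j * P.incidence e i)
        + Ω e.1 * t e.1 * (|P.incidence e j| * |P.incidence e i|)) / 2
        = P.fullCoupling Ω t i.1 j.1 := by
      rw [fullCoupling, Matrix.of_apply]
      cases hj : P.cornerLabel j.1 with
      | none =>
        have h0 : ∀ e, P.incidence e j = 0 := by
          intro e; simp [incidence, hj]
        simp only [h0]
        cases P.cornerLabel i.1 <;> simp
      | some y =>
        have hy₁ : G.σ₁ y ≠ y := fun h => j.2 ⟨y, hj, h⟩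
        rw [P.sum_incidence hΩ ht j i y hj (P.mem_of_cornerLabel hj).1 hy₁]
        cases hi : P.cornerLabel i.1 with
        | none => rfl
        | some x => exact G.coupling_symm hΩ ht y x
    rw [hsum, hw]
    ring
  rw [h2]
  have inst : ∀ (d₁ d₂ : DecidableEq P.InternalCorner) (f₁ f₂ : Fintype P.InternalCorner)
      (M : Matrix P.InternalCorner P.InternalCorner ℝ),
      @Matrix.det _ d₁ f₁ ℝ _ M = @Matrix.det _ d₂ f₂ ℝ _ M := by
    intros
    congr!
  exact inst _ _ _ _ _

open Classical in
-- The indicator of the corners of a tree without labels is in the kernel: the coupling does not see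
-- these corners, and as many triangle sides arrive at a corner as leave it.
theorem det_full_of_bare [Fintype P.Corner] (Ω t : X → ℝ) (hX : Finite X) (hb : G.bare ≠ 0) :
    (P.fullCoupling Ω t - Matrix.diagonal P.internalWeight * P.fullAdjacency).det = 0 := by
  letI : Fintype P.Inner := Fintype.ofFinite _
  let v : G.Vertex := Sum.inr ⟨0, Nat.pos_of_ne_zero hb⟩
  let q : P.Corner → ℝ := fun c => if c.1 = v then 1 else 0
  refine Matrix.exists_mulVec_eq_zero_iff.mp ⟨q, ?_, ?_⟩
  · intro h
    have := congrFun h ⟨v, none⟩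
    simp [q] at this
    exact one_ne_zero this
  · have hN : (P.fullCoupling Ω t).mulVec q = 0 := by
      ext c
      refine Finset.sum_eq_zero fun d _ => ?_
      by_cases hd : d.1 = v
      · have : P.cornerLabel d = none := by
          cases h : P.cornerLabel d with
          | none => rfl
          | some x =>
            have h1 := (P.mem_of_cornerLabel h).2
            rw [hd] at h1
            exact absurd h1 (by simp [v])
        have h0 : P.fullCoupling Ω t c d = 0 := by
          rw [fullCoupling, Matrix.of_apply, this]
          cases P.cornerLabel c <;> rfl
        simp only [h0, zero_mul]
      · simp [q, hd]
    have hrot : ∀ h, q (P.cornerOf (P.rot h)) = q (P.cornerOf h) := by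
      intro h
      obtain ⟨w, k, rfl⟩ := P.exists_lift h
      rw [rot_lift, cornerOf_lift, cornerOf_lift]
    have hα : P.fullAdjacency.mulVec q = 0 := by
      ext c
      have hsum : ∀ f g : P.Corner ⊕ P.Inner → P.Corner,
          ∑ d, (∑ h, if f h = c ∧ g h = d then (1 : ℝ) else 0) * q d
            = ∑ h, if f h = c then q (g h) else 0 := by
        intro f g
        simp only [Finset.sum_mul]
        rw [Finset.sum_comm]
        refine Finset.sum_congr rfl fun h _ => ?_
        by_cases hf : f h = c <;> simp [hf]
      show ∑ d, P.fullAdjacency c d * q d = 0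
      simp only [fullAdjacency_eq, sub_mul, Finset.sum_sub_distrib]
      rw [hsum P.cornerOf fun h => P.cornerOf (P.rot h)]
      have := hsum (fun h => P.cornerOf (P.rot h)) P.cornerOf
      simp only [and_comm] at this ⊢
      rw [this, sub_eq_zero, ← Equiv.sum_comp P.rot fun h => if P.cornerOf h = c then q (P.cornerOf (P.rot h)) else 0]
      simp only [hrot]
    rw [Matrix.sub_mulVec, ← Matrix.mulVec_mulVec, hN, hα, Matrix.mulVec_zero, sub_zero]

open Classical in
-- Elimination by `det_triangulation`, with the walks around the trees as data. The hypothesis on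
-- `bare` ensures that every tree carries a label, so that each walk ends.
theorem det_full [Fintype P.Corner] [Fintype P.pos] (Ω t : X → ℝ) [Finite X] (hb : G.bare = 0) :
    2 ^ Nat.card G.Vertex *
      (P.fullCoupling Ω t - Matrix.diagonal P.internalWeight * P.fullAdjacency).det
      = (G.formMatrix P.pos Ω t).det := by
  letI : Fintype P.Inner := Fintype.ofFinite _
  letI : Fintype G.Vertex := Fintype.ofFinite _
  letI : ∀ v, Fintype (P.tree v).Inner := fun v => Fintype.ofFinite _
  choose corner hcorner using fun x : P.pos => P.exists_corner x.1 x.2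
  obtain ⟨R, hR₁, hR₂, hR₃, hR₄⟩ := P.exists_walk hb
  have hlab : ∀ {c x}, P.cornerLabel c = some x → ∃ y, corner y = c := by
    intro c x h
    exact ⟨⟨x, (P.mem_of_cornerLabel h).1⟩, P.cornerLabel_injective (hcorner _) h⟩
  have hblank : ∀ c, (∀ x, corner x ≠ c) → P.cornerLabel c = none := by
    intro c hc
    cases h : P.cornerLabel c with
    | none => rfl
    | some x => obtain ⟨y, hy⟩ := hlab h; exact absurd hy (hc y)
  have hfar : ∀ h k, R h = PlaneTree.farther (R k) →
      (⟨(R k).1, hR₁ k⟩ : P.pos) = ⟨(R h).1, hR₁ h⟩ ∧ (R k).2 < (R h).2 := by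
    intro h k hk
    exact ⟨Subtype.ext (congrArg Prod.fst hk).symm, by rw [hk]; exact Nat.lt_succ_self _⟩
  have key := det_triangulation P.rot P.rot_mul_rot P.stemOf P.stemOf_injective P.fullAdjacency
    (fun c d => P.fullAdjacency_eq c d) corner
    (fun x m h => by
      have h1 := hcorner x
      rw [h, P.cornerLabel_stemOf] at h1
      exact absurd h1 (by simp))
    (fun h => (⟨(R h).1, hR₁ h⟩ : P.pos)) (fun h => (R h).2)
    (fun x => ⟨G.σ₀ x.1, (P.isOrientation.σ₀_mem x.1).mpr x.2⟩)
    (fun x => Subtype.ext (congrArg Prod.fst (hR₂ _ _ (hcorner x)).1))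
    (fun x => Subtype.ext (hR₂ _ _ (hcorner x)).2)
    (fun c hc hs => hfar _ _ (hR₃ c (hblank c hc) hs))
    (fun m => hfar _ _ (hR₄ m).1) (fun m => hfar _ _ (hR₄ m).2)
    (fun x y => G.coupling Ω t x y) (P.fullCoupling Ω t)
    (fun x y => by rw [fullCoupling, Matrix.of_apply, hcorner, hcorner]; rfl)
    (fun c d hc => by rw [fullCoupling, Matrix.of_apply, hblank c hc]; rfl)
    (fun c d hd => by
      rw [fullCoupling, Matrix.of_apply, hblank d hd]
      cases P.cornerLabel c <;> rfl)
    P.internalWeight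
    (fun c hc => if_neg fun ⟨x, hx, _⟩ => by rw [hblank c hc] at hx; exact absurd hx (by simp))
  rw [det_one_add_rotation P.rot P.half P.half_rot] at key
  -- Each tree has one triangle more than gluings, the one adjacent to its root.
  have hcard : Fintype.card (Σ v : G.Vertex, Option (P.tree v).Inner)
      = Fintype.card P.Inner + Nat.card G.Vertex := by
    have h1 : Fintype.card P.Inner = ∑ v, Fintype.card (P.tree v).Inner := by
      rw [← Fintype.card_sigma]; exact Fintype.card_congr (Equiv.refl _)
    rw [h1, Fintype.card_sigma, Nat.card_eq_fintype_card]
    simp [Fintype.card_option, Finset.sum_add_distrib]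
  rw [hcard, pow_add] at key
  have h2 : (2 : ℝ) ^ Fintype.card P.Inner ≠ 0 := by positivity
  apply mul_left_cancel₀ h2
  rw [← mul_assoc, mul_comm (2 ^ Fintype.card P.Inner * 2 ^ Nat.card G.Vertex), ← key]
  congr 2
  ext x z
  have hw : P.internalWeight (corner x) = if G.σ₁ x.1 = x.1 then 0 else 1 := by
    rw [internalWeight]
    congr 1
    rw [eq_iff_iff]
    constructor
    · rintro ⟨y, hy, hy₁⟩
      rw [hcorner] at hy
      cases hy; exact hy₁
    · exact fun h => ⟨x.1, hcorner x, h⟩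
  rw [Matrix.of_apply, hw, formMatrix, Matrix.of_apply, form]
  have e1 : ∀ a : P.pos, (if a = z then (1 : ℝ) else 0) = coord P.pos a.1 z := by
    intro a; simp [coord, Subtype.ext_iff]
  simp only [e1]
  have e2 : ∀ a : P.pos, coord P.pos a.1 z + coord P.pos (G.σ₀ a.1) z = G.sumForm P.pos a.1 z :=
    fun a => rfl
  have e3 : ∀ a : P.pos, coord P.pos a.1 z - coord P.pos (G.σ₀ a.1) z = G.diffForm P.pos a.1 z :=
    fun a => rfl
  simp only [e2, e3]
  have e4 : ∀ a (f : P.pos → ℝ) (ha : a ∈ P.pos), ∑ y : P.pos, (if y.1 = a then (1 : ℝ) else 0) * f y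
      = f ⟨a, ha⟩ := by
    intro a f ha
    rw [Finset.sum_eq_single ⟨a, ha⟩]
    · simp
    · intro b _ hb'
      rw [if_neg fun h => hb' (Subtype.ext h), zero_mul]
    · simp
  by_cases hx₁ : G.σ₁ x.1 = x.1
  · simp only [coupling, hx₁, if_true, zero_mul, add_zero]
    rw [e4 x.1 _ x.2]
  · have htw : G.twin x.1 ∈ P.pos := (P.isOrientation.twin_mem hx₁).mpr x.2
    simp only [coupling, hx₁, if_false, one_mul, add_mul, mul_assoc, Finset.sum_add_distrib,
      ← Finset.mul_sum]
    rw [e4 x.1 _ x.2, e4 _ _ htw]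
    simp [mul_assoc]

open Classical in
theorem value_eq_closedValue [Finite X] {Ω t : X → ℝ} (hΩ : G.IsEdgeFunction Ω)
    (ht : G.IsEdgeFunction t) : P.value Ω t = G.closedValue P.pos P.tail Ω t := by
  letI : Fintype X := Fintype.ofFinite X
  letI : Fintype P.Corner := Fintype.ofFinite _
  letI : Fintype P.EdgeIndex := Fintype.ofFinite _
  letI : Fintype P.InternalCorner := Fintype.ofFinite _
  have h1 := (det_diagPart_add_antisymmPart (fun e : P.EdgeIndex => Ω e.1) (fun e => t e.1)
    P.incidence P.adjacency).trans (P.det_internal hΩ ht)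
  have h2 : P.value Ω t = 2 ^ Nat.card G.Vertex * (∏ e : P.EdgeIndex, t e.1) *
      (P.fullCoupling Ω t - Matrix.diagonal P.internalWeight * P.fullAdjacency).det := by
    rw [← h1, value]
    congr!
  rw [h2, closedValue]
  split_ifs with hb
  · rw [mul_right_comm, P.det_full Ω t hb, mul_comm]
    congr!
  · rw [P.det_full_of_bare Ω t inferInstance hb, mul_zero]

end Presentation
end RibbonGraph

/-! ### Independence of the orientation -/

section Flip

variable {V : Type*} [Fintype V] [DecidableEq V]

theorem rotation_apply (C : Matrix V V ℝ) (e : V → ℝ) (s : Perm V) (x y : V) :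
    (C * (1 + s.permMatrix ℝ) + Matrix.diagonal e * (1 - s.permMatrix ℝ)) x y
      = C x y + C x (s⁻¹ y) + e x * ((if x = y then 1 else 0) - if s x = y then 1 else 0) := by
  rw [mul_add, mul_one, Matrix.add_apply, Matrix.add_apply, Matrix.diagonal_mul,
    Matrix.sub_apply, permMatrix_apply', Matrix.one_apply, Matrix.mul_apply]
  congr 2
  rw [Finset.sum_eq_single (s⁻¹ y)]
  · simp [permMatrix_apply']
  · intro z _ hz
    rw [permMatrix_apply', if_neg, mul_zero]
    rintro rfl
    exact hz (by simp)
  · simp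

/-- The rotation may be reversed on a set which is stable under it and under the coupling. -/
theorem det_rotation_reverse (C : Matrix V V ℝ) (e : V → ℝ) (hC : C.transpose = C)
    (hCe : Commute C (Matrix.diagonal e)) (s s' : Perm V) (U : V → Prop)
    (hs : ∀ x, U (s x) ↔ U x) (hCU : ∀ x y, ¬ U x → U y → C x y = 0)
    (h₁ : ∀ x, U x → s' x = s x) (h₂ : ∀ x, ¬ U x → s' x = s⁻¹ x) :
    (C * (1 + s'.permMatrix ℝ) + Matrix.diagonal e * (1 - s'.permMatrix ℝ)).det
      = (C * (1 + s.permMatrix ℝ) + Matrix.diagonal e * (1 - s.permMatrix ℝ)).det := by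
  classical
  have hsi : ∀ x, U (s⁻¹ x) ↔ U x := fun x => by rw [← hs]; simp
  have hs' : ∀ x, U (s' x) ↔ U x := by
    intro x
    by_cases hx : U x
    · rw [h₁ x hx, hs]
    · rw [h₂ x hx, hsi]
  have hs'i : ∀ x, U (s'⁻¹ x) ↔ U x := fun x => by rw [← hs']; simp
  have h₁' : ∀ x, U x → s'⁻¹ x = s⁻¹ x := by
    intro x hx
    rw [Perm.inv_eq_iff_eq, h₁ _ ((hsi x).mpr hx)]; simp
  have h₂' : ∀ x, ¬ U x → s'⁻¹ x = s x := by
    intro x hx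
    rw [Perm.inv_eq_iff_eq, h₂ _ (fun h => hx ((hs x).mp h))]; simp
  have hblock : ∀ r : Perm V, (∀ x, U (r x) ↔ U x) →
      ∀ i, ¬ U i → ∀ j, U j →
      (C * (1 + r.permMatrix ℝ) + Matrix.diagonal e * (1 - r.permMatrix ℝ)) i j = 0 := by
    intro r hr i hi j hj
    have hj' : U (r⁻¹ j) := by rw [← hr]; simpa using hj
    rw [rotation_apply, hCU i j hi hj, hCU i _ hi hj', if_neg (by rintro rfl; exact hi hj),
      if_neg (by rintro rfl; exact hi ((hr i).mp hj))]
    simp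
  -- The blocks on `U` coincide, and those on the complement differ by the inversion of the
  -- rotation, to which `det_rotation_inv` applies.
  rw [Matrix.twoBlockTriangular_det _ U (hblock s' hs'),
    Matrix.twoBlockTriangular_det _ U (hblock s hs)]
  congr 1
  · congr 1
    ext i j
    rw [Matrix.toSquareBlockProp_def, Matrix.toSquareBlockProp_def, Matrix.of_apply,
      Matrix.of_apply, rotation_apply, rotation_apply, h₁ _ i.2, h₁' _ j.2]
  · set C' : Matrix {x // ¬ U x} {x // ¬ U x} ℝ := C.toSquareBlockProp fun x => ¬ U x with hC'
    set e' : {x // ¬ U x} → ℝ := fun x => e x with he'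
    set r : Perm {x // ¬ U x} := s.subtypePerm fun x => not_congr (hs x) with hr
    have key := det_rotation_inv C' (r.permMatrix ℝ) (r⁻¹.permMatrix ℝ) e' (by
        ext i j; exact congrFun (congrFun hC i.1) j.1) (by
        ext i j
        have := congrFun (congrFun hCe.eq i.1) j.1
        rw [Matrix.mul_diagonal, Matrix.diagonal_mul] at this ⊢
        exact this) (Matrix.transpose_permMatrix _) (permMatrix_mul_inv r)
    convert key using 2
    · ext i j
      rw [Matrix.toSquareBlockProp_def, Matrix.of_apply, rotation_apply, rotation_apply,
        h₂ _ i.2, h₂' _ j.2, inv_inv]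
      simp [hC', he', hr, Matrix.toSquareBlockProp_def, Subtype.ext_iff]
    · ext i j
      rw [Matrix.toSquareBlockProp_def, Matrix.of_apply, rotation_apply, rotation_apply]
      simp [hC', he', hr, Matrix.toSquareBlockProp_def, Subtype.ext_iff]

end Flip

namespace RibbonGraph

variable {X : Type*} {G : RibbonGraph X}

theorem σ₁_θ_ne_iff (G : RibbonGraph X) (x : X) : G.σ₁ (G.θ x) = G.θ x ↔ G.σ₁ x = x := by
  rw [← G.θ_σ₁]; exact G.θ.injective.eq_iff

theorem σ₁_twin_eq_iff (G : RibbonGraph X) (x : X) : G.σ₁ (G.twin x) = G.twin x ↔ G.σ₁ x = x :=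
  ⟨fun h => by_contra fun h' => G.σ₁_twin_ne h' h, fun h => by_contra fun h' =>
    G.σ₁_twin_ne h' (by rwa [twin_twin])⟩

theorem twin_θ (G : RibbonGraph X) (x : X) : G.twin (G.θ x) = G.θ (G.twin x) := by
  rw [twin, twin, G.θ_σ₁, G.θ_σ₁, G.θ_σ₁]

/-- The half-edges of an orientation from which the edges leave. -/
structure IsTail (G : RibbonGraph X) (pos tail : Set X) : Prop where
  mem : ∀ x ∈ tail, x ∈ pos ∧ G.σ₁ x ≠ x
  iff : ∀ x ∈ pos, G.σ₁ x ≠ x → (x ∈ tail ↔ G.twin x ∉ tail)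

theorem Presentation.isTail (P : G.Presentation) : G.IsTail P.pos P.tail :=
  ⟨P.tail_mem, P.tail_iff⟩

theorem IsEdgeFunction.eq_of_mem_edge {w : X → ℝ} (hw : G.IsEdgeFunction w) {x y : X}
    (h : y ∈ G.edge x) : w y = w x := by
  simp only [edge, Set.mem_insert_iff, Set.mem_singleton_iff] at h
  rcases h with rfl | rfl | rfl | rfl <;> simp [hw.1, hw.2]

theorem mem_edge_comm {x y : X} (h : y ∈ G.edge x) : x ∈ G.edge y := by
  simp only [edge, Set.mem_insert_iff, Set.mem_singleton_iff] at h ⊢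
  rcases h with rfl | rfl | rfl | rfl <;> simp [G.θ_σ₁, G.θ_θ, G.σ₁_σ₁]

theorem mem_edge_trans {x y z : X} (h : y ∈ G.edge x) (h' : z ∈ G.edge y) : z ∈ G.edge x := by
  simp only [edge, Set.mem_insert_iff, Set.mem_singleton_iff] at h'
  rcases h' with rfl | rfl | rfl | rfl
  · exact h
  · exact (G.θ_mem_edge _ _).mpr h
  · exact (G.σ₁_mem_edge _ _).mpr h
  · exact (G.θ_mem_edge _ _).mpr ((G.σ₁_mem_edge _ _).mpr h)

/-- The half-edges of an edge that belong to an orientation. -/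
theorem IsOrientation.mem_edge_iff {pos : Set X} (ho : G.IsOrientation pos) {x y : X} (hx : x ∈ pos)
    (hx₁ : G.σ₁ x ≠ x) (hy : y ∈ pos) : y ∈ G.edge x ↔ y = x ∨ y = G.twin x := by
  simp only [edge, Set.mem_insert_iff, Set.mem_singleton_iff]
  constructor
  · rintro (rfl | rfl | rfl | rfl)
    · exact Or.inl rfl
    · exact absurd hx ((ho.θ_mem _).mp hy)
    · exact absurd hx ((ho.σ₁_mem _ hx₁).mp hy)
    · exact Or.inr rfl
  · rintro (rfl | rfl)
    · exact Or.inl rfl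
    · exact Or.inr (Or.inr (Or.inr rfl))

theorem IsTail.exists_mem_edge {pos tail : Set X} (ho : G.IsOrientation pos)
    (h : G.IsTail pos tail) (x : X) (hx₁ : G.σ₁ x ≠ x) : ∃ e ∈ tail, e ∈ G.edge x := by
  have key : ∀ x ∈ pos, G.σ₁ x ≠ x → ∃ e ∈ tail, e ∈ G.edge x := by
    intro x hx hx₁
    by_cases hxt : x ∈ tail
    · exact ⟨x, hxt, G.mem_edge_self x⟩
    · exact ⟨G.twin x, by_contra fun h' => hxt ((h.iff x hx hx₁).mpr h'), by simp [edge, twin]⟩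
  by_cases hx : x ∈ pos
  · exact key x hx hx₁
  · obtain ⟨e, he, he'⟩ := key (G.θ x) ((ho.θ_mem x).mpr hx)
      (fun h => hx₁ ((G.σ₁_θ_ne_iff x).mp h))
    exact ⟨e, he, mem_edge_trans (by simp [edge]) he'⟩

theorem IsTail.eq_of_mem_edge {pos tail : Set X} (ho : G.IsOrientation pos)
    (h : G.IsTail pos tail) {e e' : X} (he : e ∈ tail) (he' : e' ∈ tail) (h' : e' ∈ G.edge e) :
    e' = e := by
  obtain ⟨h1, h2⟩ := h.mem e he
  rcases (ho.mem_edge_iff h1 h2 (h.mem e' he').1).mp h' with h3 | h3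
  · exact h3
  · exact absurd (h3 ▸ he') ((h.iff e h1 h2).mp he)

open Classical in
theorem prod_tail_eq [Fintype X] {pos tail pos' tail' : Set X} (ho : G.IsOrientation pos)
    (h : G.IsTail pos tail) (ho' : G.IsOrientation pos') (h' : G.IsTail pos' tail')
    {t : X → ℝ} (ht : G.IsEdgeFunction t) : ∏ e : tail, t e = ∏ e : tail', t e := by
  choose r hr₁ hr₂ using fun e : tail => h'.exists_mem_edge ho' e.1 (h.mem e e.2).2
  choose r' hr'₁ hr'₂ using fun e : tail' => h.exists_mem_edge ho e.1 (h'.mem e e.2).2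
  refine Finset.prod_bij' (fun e _ => ⟨r e, hr₁ e⟩) (fun e _ => ⟨r' e, hr'₁ e⟩) (by simp) (by simp)
    ?_ ?_ ?_
  · intro e _
    exact Subtype.ext (h.eq_of_mem_edge ho e.2 (hr'₁ _) (mem_edge_trans (hr₂ e) (hr'₂ ⟨_, hr₁ e⟩)))
  · intro e _
    exact Subtype.ext (h'.eq_of_mem_edge ho' e.2 (hr₁ _) (mem_edge_trans (hr'₂ e) (hr₂ ⟨_, hr'₁ e⟩)))
  · intro e _
    exact (ht.eq_of_mem_edge (hr₂ e)).symm

/-- The rotation of an orientation. -/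
noncomputable def IsOrientation.rot {pos : Set X} (ho : G.IsOrientation pos) : Perm pos :=
  G.σ₀.subtypePerm ho.σ₀_mem

theorem IsOrientation.rot_val {pos : Set X} (ho : G.IsOrientation pos) (x : pos) :
    (ho.rot x : X) = G.σ₀ x := rfl

theorem IsOrientation.rot_inv_val {pos : Set X} (ho : G.IsOrientation pos) (x : pos) :
    ((ho.rot)⁻¹ x : pos) = G.σ₀⁻¹ x := by
  rw [Perm.eq_inv_iff_eq, ← ho.rot_val]; simp

/-- `0` at the flags, `1` at the half-edges. -/
noncomputable def edgeWeight (G : RibbonGraph X) (x : X) : ℝ :=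
  open Classical in if G.σ₁ x = x then 0 else 1

open Classical in
-- The shape `C (1 + S) + E (1 - S)` isolates the rotation, the only ingredient affected by a change
-- of orientation.
theorem formMatrix_eq {pos : Set X} [Fintype pos] (ho : G.IsOrientation pos) (Ω t : X → ℝ) :
    G.formMatrix pos Ω t = Matrix.of (fun x y : pos => G.coupling Ω t x y)
        * (1 + ho.rot.permMatrix ℝ)
      + Matrix.diagonal (fun x : pos => G.edgeWeight x) * (1 - ho.rot.permMatrix ℝ) := by
  ext x z
  rw [rotation_apply, formMatrix, Matrix.of_apply, Matrix.of_apply, Matrix.of_apply]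
  have hc : ∀ a b : X, (if b = a then (1 : ℝ) else 0) = if a = b then 1 else 0 := by
    intro a b; simp only [eq_comm (a := a)]
  have hz : ∀ a : X, (if (ho.rot⁻¹ z : X) = a then (1 : ℝ) else 0) = coord pos (G.σ₀ a) z := by
    intro a
    rw [ho.rot_inv_val, coord]
    refine if_congr ?_ rfl rfl
    rw [Perm.inv_eq_iff_eq, eq_comm]
  have hz' : ∀ a : X, (if (z : X) = a then (1 : ℝ) else 0) = coord pos a z := by
    intro a
    rw [coord, hc]
  have h3 : (if x = z then (1 : ℝ) else 0) = coord pos x z := by simp [coord, Subtype.ext_iff]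
  have h4 : (if ho.rot x = z then (1 : ℝ) else 0) = coord pos (G.σ₀ x) z := by
    simp [coord, Subtype.ext_iff, ho.rot_val]
  rw [h3, h4]
  generalize ho.rot⁻¹ z = z' at hz ⊢
  by_cases hx₁ : G.σ₁ x.1 = x.1
  · simp [form, coupling, hx₁, edgeWeight, sumForm, hz, hz']
  · simp [form, coupling, hx₁, edgeWeight, sumForm, diffForm, hz, hz']
    ring

theorem coupling_eq_zero {pos : Set X} (ho : G.IsOrientation pos) (Ω t : X → ℝ) {x y : X}
    (h : ¬ (x ∈ pos ↔ y ∈ pos)) : G.coupling Ω t x y = 0 := by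
  have h1 : y ≠ x := by rintro rfl; exact h Iff.rfl
  by_cases hx₁ : G.σ₁ x = x
  · simp [coupling, hx₁, h1]
  · have h2 : y ≠ G.twin x := by rintro rfl; exact h (ho.twin_mem hx₁).symm
    simp [coupling, hx₁, h1, h2]

open Classical in
theorem coupling_θ {Ω t : X → ℝ} (hΩ : G.IsEdgeFunction Ω) (ht : G.IsEdgeFunction t) (x y : X) :
    G.coupling Ω t (G.θ x) (G.θ y) = G.coupling Ω t x y := by
  simp only [coupling, σ₁_θ_ne_iff, G.θ.injective.eq_iff, twin_θ, hΩ.1, ht.1]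

open Classical in
theorem edgeWeight_θ (x : X) : G.edgeWeight (G.θ x) = G.edgeWeight x := by
  rw [edgeWeight, edgeWeight, if_congr (G.σ₁_θ_ne_iff x) rfl rfl]

open Classical in
-- The coupling never joins a flag to a half-edge, so it commutes with the diagonal matrix of the
-- weights.
theorem coupling_mul_edgeWeight (Ω t : X → ℝ) (x y : X) :
    G.coupling Ω t x y * G.edgeWeight y = G.edgeWeight x * G.coupling Ω t x y := by
  by_cases h : y = x
  · rw [h, mul_comm]
  by_cases h' : y = G.twin x
  · have : G.edgeWeight y = G.edgeWeight x := by
      rw [edgeWeight, edgeWeight, h', if_congr (G.σ₁_twin_eq_iff x) rfl rfl]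
    rw [this, mul_comm]
  · simp [coupling, h, h']

open Classical in
/-- The half-ribbons of two orientations correspond. -/
noncomputable def IsOrientation.turn {pos pos' : Set X} (ho : G.IsOrientation pos)
    (ho' : G.IsOrientation pos') : pos ≃ pos' where
  toFun x := if h : x.1 ∈ pos' then ⟨x.1, h⟩ else ⟨G.θ x.1, (ho'.θ_mem _).mpr h⟩
  invFun x := if h : x.1 ∈ pos then ⟨x.1, h⟩ else ⟨G.θ x.1, (ho.θ_mem _).mpr h⟩
  left_inv x := by
    by_cases h : x.1 ∈ pos'
    · simp [h]
    · simp [h, G.θ_θ, ho.θ_mem]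
  right_inv x := by
    by_cases h : x.1 ∈ pos
    · simp [h]
    · simp [h, G.θ_θ, ho'.θ_mem]

open Classical in
-- The half-ribbons on which the two orientations agree form a set stable under `σ₀` and under the
-- coupling. Elsewhere `x` corresponds to `θ x`, and `θ` conjugates `σ₀` to its inverse, so the
-- rotation is reversed there.
theorem det_formMatrix_eq {pos pos' : Set X} [Fintype pos] [Fintype pos']
    (ho : G.IsOrientation pos) (ho' : G.IsOrientation pos') {Ω t : X → ℝ}
    (hΩ : G.IsEdgeFunction Ω) (ht : G.IsEdgeFunction t) :
    (G.formMatrix pos' Ω t).det = (G.formMatrix pos Ω t).det := by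
  set φ := ho.turn ho' with hφ
  have φ₁ : ∀ x : pos, x.1 ∈ pos' → (φ x : X) = x := by
    intro x h; simp [hφ, IsOrientation.turn, h]
  have φ₂ : ∀ x : pos, x.1 ∉ pos' → (φ x : X) = G.θ x := by
    intro x h; simp [hφ, IsOrientation.turn, h]
  have hcomp : (∀ x : pos, x.1 ∈ pos' → (((φ.trans ho'.rot).trans φ.symm) x) = ho.rot x) ∧
      ∀ x : pos, x.1 ∉ pos' → (((φ.trans ho'.rot).trans φ.symm) x) = ho.rot⁻¹ x := by
    constructor
    · intro x h
      rw [Equiv.trans_apply, Equiv.symm_apply_eq]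
      apply Subtype.ext
      rw [φ₁ (ho.rot x) ((ho'.σ₀_mem _).mpr h), Equiv.trans_apply, ho'.rot_val, φ₁ x h, ho.rot_val]
    · intro x h
      rw [Equiv.trans_apply, Equiv.symm_apply_eq]
      apply Subtype.ext
      rw [φ₂ (ho.rot⁻¹ x) (by
          rw [ho.rot_inv_val, ← ho'.σ₀_mem]; simpa using h),
        Equiv.trans_apply, ho'.rot_val, φ₂ x h, ho.rot_inv_val, G.σ₀_θ]
  rw [← Matrix.det_submatrix_equiv_self φ (G.formMatrix pos' Ω t), formMatrix_eq ho,
    ← det_rotation_reverse _ _ ?_ ?_ ho.rot ((φ.trans ho'.rot).trans φ.symm) (fun x => x.1 ∈ pos')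
      (fun x => ho'.σ₀_mem x.1) ?_ hcomp.1 hcomp.2]
  · congr 1
    ext x y
    rw [Matrix.submatrix_apply, formMatrix_eq ho', rotation_apply, rotation_apply,
      Matrix.of_apply, Matrix.of_apply, Matrix.of_apply, Matrix.of_apply]
    have hcoup : ∀ x y : pos, G.coupling Ω t (φ x) (φ y) = G.coupling Ω t x y := by
      intro x y
      by_cases hx : x.1 ∈ pos' <;> by_cases hy : y.1 ∈ pos'
      · rw [φ₁ x hx, φ₁ y hy]
      · rw [coupling_eq_zero ho' Ω t (x := x.1) (y := y.1) (by simp [hx, hy]),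
          coupling_eq_zero ho Ω t]
        rw [φ₁ x hx, φ₂ y hy, ho.θ_mem]; simp
      · rw [coupling_eq_zero ho' Ω t (x := x.1) (y := y.1) (by simp [hx, hy]),
          coupling_eq_zero ho Ω t]
        rw [φ₂ x hx, φ₁ y hy, ho.θ_mem]; simp
      · rw [φ₂ x hx, φ₂ y hy, coupling_θ hΩ ht]
    have hw : G.edgeWeight (φ x) = G.edgeWeight x := by
      by_cases hx : x.1 ∈ pos'
      · rw [φ₁ x hx]
      · rw [φ₂ x hx, edgeWeight_θ]
    have hinv : ho'.rot⁻¹ (φ y) = φ (((φ.trans ho'.rot).trans φ.symm : Perm pos)⁻¹ y) := by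
      show ho'.rot.symm (φ y) = φ (φ.symm (ho'.rot.symm (φ y)))
      simp
    rw [hinv, hcoup, hcoup, hw]
    simp [Equiv.symm_apply_eq]
  · ext x y
    exact G.coupling_symm hΩ ht y x
  · ext x y
    rw [Matrix.mul_diagonal, Matrix.diagonal_mul]
    exact coupling_mul_edgeWeight Ω t x.1 y.1
  · intro x y hx hy
    exact coupling_eq_zero ho' Ω t (by simp [hx, hy])

theorem closedValue_eq [Finite X] {pos tail pos' tail' : Set X} (ho : G.IsOrientation pos)
    (h : G.IsTail pos tail) (ho' : G.IsOrientation pos') (h' : G.IsTail pos' tail') {Ω t : X → ℝ}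
    (hΩ : G.IsEdgeFunction Ω) (ht : G.IsEdgeFunction t) :
    G.closedValue pos tail Ω t = G.closedValue pos' tail' Ω t := by
  classical
  letI := Fintype.ofFinite X
  rw [closedValue, closedValue]
  split_ifs with hb
  · congr 1
    · have := prod_tail_eq ho h ho' h' ht
      convert this
    · have := det_formMatrix_eq ho' ho hΩ ht
      convert this
  · rfl

end RibbonGraph

/-- The right comb with given labels. -/
def PlaneTree.comb {X : Type*} : List X → PlaneTree X
  | [] => leaf none
  | x :: l => node (leaf (some x)) (comb l)

theorem PlaneTree.labels_comb {X : Type*} (l : List X) : (PlaneTree.comb l).labels = l := by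
  induction l with
  | nil => rfl
  | cons x l ih => simp [comb, labels, ih]

/-- A tree with given labels. -/
def TriangleTree.comb {X : Type*} (l : List X) : TriangleTree X :=
  ⟨none, PlaneTree.comb l, PlaneTree.leaf none⟩

theorem TriangleTree.labels_comb {X : Type*} (l : List X) : (TriangleTree.comb l).labels = l := by
  simp [labels, comb, PlaneTree.labels_comb, PlaneTree.labels]

/-! ### Existence of presentations and independence of the choices -/

namespace RibbonGraph

variable {X : Type*} {G : RibbonGraph X}

theorem IsOrientation.zpow_mem {pos : Set X} (ho : G.IsOrientation pos) (k : ℤ) (x : X) :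
    (G.σ₀ ^ k) x ∈ pos ↔ x ∈ pos := by
  have hn : ∀ (k : ℕ) x, (G.σ₀ ^ k) x ∈ pos ↔ x ∈ pos := by
    intro k
    induction k with
    | zero => simp
    | succ k ih => intro x; rw [pow_succ, Perm.mul_apply, ih, ho.σ₀_mem]
  obtain ⟨k, rfl | rfl⟩ := k.eq_nat_or_neg
  · rw [zpow_natCast, hn]
  · rw [← hn k]
    simp

theorem IsOrientation.mk_eq_mk_iff {pos : Set X} (ho : G.IsOrientation pos) {x y : X}
    (hx : x ∈ pos) (hy : y ∈ pos) :
    Quotient.mk G.vertexSetoid y = Quotient.mk G.vertexSetoid x ↔ G.σ₀.SameCycle y x := by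
  rw [Quotient.eq]
  refine ⟨?_, Or.inl⟩
  rintro (h | ⟨k, hk⟩)
  · exact h
  · have h1 : G.θ y ∈ pos := (ho.zpow_mem k _).mp (hk ▸ hx)
    exact absurd hy ((ho.θ_mem y).mp h1)

theorem IsOrientation.exists_rep {pos : Set X} (ho : G.IsOrientation pos)
    (q : Quotient G.vertexSetoid) : ∃ x ∈ pos, Quotient.mk G.vertexSetoid x = q := by
  obtain ⟨x, rfl⟩ := Quotient.exists_rep q
  by_cases hx : x ∈ pos
  · exact ⟨x, hx, rfl⟩
  · exact ⟨G.θ x, (ho.θ_mem x).mpr hx, Quotient.sound (Or.inr (by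
      show G.σ₀.SameCycle (G.θ (G.θ x)) x
      rw [G.θ_θ]))⟩

theorem IsOrientation.exists_isTail [Finite X] {pos : Set X} (ho : G.IsOrientation pos) :
    ∃ tail, G.IsTail pos tail := by
  obtain ⟨n, ⟨f⟩⟩ := Finite.exists_equiv_fin X
  -- An arbitrary numbering of the crosses decides from which of its two ends an edge leaves.
  refine ⟨{x | x ∈ pos ∧ G.σ₁ x ≠ x ∧ f x < f (G.twin x)}, fun x hx => ⟨hx.1, hx.2.1⟩, ?_⟩
  intro x hx hx₁
  have h1 : f (G.twin x) ≠ f x := fun h => G.twin_ne x (f.injective h)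
  have h2 := (ho.twin_mem hx₁).mpr hx
  have h3 := G.σ₁_twin_ne hx₁
  simp only [Set.mem_ofPred_eq, hx, hx₁, h2, h3, twin_twin, ne_eq, not_false_eq_true, true_and,
    not_lt]
  exact ⟨le_of_lt, fun h => lt_of_le_of_ne h h1.symm⟩

/-- A cycle as a list. -/
noncomputable def cycleList (σ : Perm X) (x : X) : List X :=
  (List.range (Function.minimalPeriod σ x)).map fun k => (σ^[k]) x

theorem nodup_cycleList (σ : Perm X) (x : X) : (cycleList σ x).Nodup := by
  refine List.Nodup.map_on ?_ List.nodup_range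
  intro k hk l hl h
  exact Function.iterate_injOn_Iio_minimalPeriod (List.mem_range.mp hk) (List.mem_range.mp hl) h

theorem mem_cycleList [Finite X] (σ : Perm X) (x y : X) : y ∈ cycleList σ x ↔ σ.SameCycle y x := by
  simp only [cycleList, List.mem_map, List.mem_range]
  constructor
  · rintro ⟨k, _, rfl⟩
    exact Perm.SameCycle.symm ⟨k, by simp [Perm.iterate_eq_pow]⟩
  · intro h
    obtain ⟨k, rfl⟩ := h.symm.exists_nat_pow_eq
    have hp : 0 < Function.minimalPeriod σ x := by
      refine Function.minimalPeriod_pos_of_mem_periodicPts ?_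
      exact σ.injective.mem_periodicPts x
    refine ⟨k % Function.minimalPeriod σ x, Nat.mod_lt _ hp, ?_⟩
    rw [Function.iterate_mod_minimalPeriod_eq, Perm.iterate_eq_pow]

theorem cycleList_next (σ : Perm X) (x : X) (k : ℕ) (hk : k < (cycleList σ x).length) :
    σ ((cycleList σ x)[k])
      = (cycleList σ x)[(k + 1) % (cycleList σ x).length]'(Nat.mod_lt _ (by omega)) := by
  simp only [cycleList, List.getElem_map, List.getElem_range, List.length_map, List.length_range]
  rw [Function.iterate_mod_minimalPeriod_eq, Function.iterate_succ_apply']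

/-- Every orientation comes from a presentation. -/
theorem IsOrientation.exists_presentation [Finite X] {pos tail : Set X} (ho : G.IsOrientation pos)
    (h : G.IsTail pos tail) : Nonempty G.Presentation := by
  choose rep hrep₁ hrep₂ using ho.exists_rep
  -- A vertex without half-ribbons still gets one triangle, with three unlabelled leaves.
  let l : G.Vertex → List X := Sum.elim (fun q => cycleList G.σ₀ (rep q)) fun _ => []
  have hl : ∀ v, (TriangleTree.comb (l v)).labels = l v := fun v => TriangleTree.labels_comb _
  exact ⟨{
    pos := pos
    isOrientation := ho
    tail := tail
    tail_mem := h.mem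
    tail_iff := h.iff
    tree := fun v => TriangleTree.comb (l v)
    nodup_labels := by
      intro v
      rw [hl]
      rcases v with q | k
      · exact nodup_cycleList _ _
      · exact List.nodup_nil
    mem_labels := by
      intro v x
      rw [hl]
      rcases v with q | k
      · show x ∈ cycleList G.σ₀ (rep q) ↔ _
        rw [mem_cycleList, Sum.inl.injEq]
        constructor
        · intro h1
          have hx : x ∈ pos := by
            obtain ⟨k, hk⟩ := h1
            exact (ho.zpow_mem k x).mp (hk ▸ hrep₁ q)
          exact ⟨hx, by rw [← hrep₂ q]; exact (ho.mk_eq_mk_iff (hrep₁ q) hx).mpr h1⟩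
        · rintro ⟨hx, h1⟩
          rw [← hrep₂ q] at h1
          exact (ho.mk_eq_mk_iff (hrep₁ _) hx).mp h1
      · simp [l]
    next_label := by
      intro v k hk
      have key : ∀ l' l'' : List X, l' = l'' → (∀ (k : ℕ) (hk : k < l''.length),
          G.σ₀ (l''[k]) = l''[(k + 1) % l''.length]'(Nat.mod_lt _ (by omega))) →
          ∀ (k : ℕ) (hk : k < l'.length),
          G.σ₀ (l'[k]) = l'[(k + 1) % l'.length]'(Nat.mod_lt _ (by omega)) := by
        rintro l' _ rfl h; exact h
      refine key _ _ (hl v) ?_ k hk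
      rcases v with q | j
      · exact cycleList_next _ _
      · intro k hk
        simp [l] at hk }⟩

theorem Orientable.nonempty_presentation [Finite X] (h : G.Orientable) : Nonempty G.Presentation := by
  obtain ⟨pos, ho⟩ := h
  obtain ⟨tail, ht⟩ := ho.exists_isTail
  exact ho.exists_presentation ht

theorem HU_eq [Finite X] {pos tail : Set X} (ho : G.IsOrientation pos) (h : G.IsTail pos tail)
    {Ω t : X → ℝ} (hΩ : G.IsEdgeFunction Ω) (ht : G.IsEdgeFunction t) :
    G.HU Ω t = G.closedValue pos tail Ω t := by
  have hne := ho.exists_presentation h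
  rw [HU, dif_pos hne, Presentation.value_eq_closedValue _ hΩ ht]
  exact closedValue_eq (Presentation.isOrientation _) (Presentation.isTail _) ho h hΩ ht

theorem Presentation.value_eq_HU [Finite X] (P : G.Presentation) {Ω t : X → ℝ}
    (hΩ : G.IsEdgeFunction Ω) (ht : G.IsEdgeFunction t) : P.value Ω t = G.HU Ω t := by
  rw [P.value_eq_closedValue hΩ ht, HU_eq P.isOrientation P.isTail hΩ ht]

/-! ### Polynomiality -/

section Polynomial

open MvPolynomial in
open Classical in
/-- The determinant is a polynomial: the denominators `t e` cancel in the rows of the `u e`. -/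
theorem exists_polynomial {E C : Type*} [Fintype E] [Fintype C] (i : E → X) (M : Matrix
    (GaussIndex E C) (GaussIndex E C) ℝ) :
    ∃ p : MvPolynomial (X ⊕ X) ℝ, ∀ Ω t : X → ℝ, (∀ e, t (i e) ≠ 0) →
      (∏ e, t (i e)) * (diagPart (fun e => Ω (i e)) (fun e => t (i e)) + M).det
        = eval (Sum.elim Ω t) p := by
  -- `w` is the factor by which each row is multiplied, `t e` at `u e` and 1 elsewhere, and `d` is
  -- the diagonal part after this multiplication.
  let w : GaussIndex E C → MvPolynomial (X ⊕ X) ℝ :=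
    Sum.elim (Sum.elim (Sum.elim (fun e => MvPolynomial.X (Sum.inr (i e))) fun _ => 1) fun _ => 1)
      fun _ => 1
  let d : GaussIndex E C → MvPolynomial (X ⊕ X) ℝ :=
    Sum.elim (Sum.elim (Sum.elim (fun e => MvPolynomial.X (Sum.inl (i e)))
      fun e => MvPolynomial.X (Sum.inl (i e)) * MvPolynomial.X (Sum.inr (i e))) fun _ => 0)
      fun _ => 0
  refine ⟨(Matrix.of fun a b => (if a = b then d a else 0) + w a * MvPolynomial.C (M a b)).det, ?_⟩
  intro Ω t ht
  rw [RingHom.map_det]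
  have hw : ∏ a, eval (Sum.elim Ω t) (w a) = ∏ e, t (i e) := by
    simp [w, Fintype.prod_sum_type]
  rw [← hw, ← Matrix.det_mul_column]
  congr 1
  ext a b
  simp only [Matrix.of_apply, Matrix.add_apply, diagPart, Matrix.diagonal_apply,
    RingHom.mapMatrix_apply, Matrix.map_apply, map_add, map_mul, eval_C]
  rw [mul_add]
  congr 1
  by_cases hab : a = b
  · rw [if_pos hab, if_pos hab]
    rcases a with ((e | e) | e) | e <;> simp [w, d]
    field_simp [ht e]
  · simp [hab]

end Polynomial

theorem Presentation.exists_polynomial [Finite X] (P : G.Presentation) :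
    ∃ p : MvPolynomial (X ⊕ X) ℝ, ∀ Ω t : X → ℝ, (∀ x, G.σ₁ x ≠ x → t x ≠ 0) →
      P.value Ω t = MvPolynomial.eval (Sum.elim Ω t) p := by
  classical
  letI : Fintype P.EdgeIndex := Fintype.ofFinite _
  letI : Fintype P.InternalCorner := Fintype.ofFinite _
  obtain ⟨p, hp⟩ := RibbonGraph.exists_polynomial (fun e : P.EdgeIndex => e.1)
    (antisymmPart P.incidence P.adjacency)
  refine ⟨2 ^ Nat.card G.Vertex * p, fun Ω t ht => ?_⟩
  rw [map_mul, ← hp Ω t fun e => ht _ (P.tail_mem _ e.2).2, value, mul_assoc]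
  simp only [map_pow, map_ofNat]
  congr!

end RibbonGraph

/-! ### Determinant of the identity plus a cycle -/

section Cycle

variable {V : Type*} [Fintype V] [DecidableEq V]

/-- A permutation with a single cycle. -/
theorem det_one_add_permMatrix (s : Perm V) [Nonempty V] (h : ∀ x y, s.SameCycle x y) :
    (1 + s.permMatrix ℝ).det = if Odd (Fintype.card V) then 2 else 0 := by
  -- A fixed point leaves a single index, where the entries of the identity and of `s` add up to 2.
  -- Otherwise they occupy different places.
  by_cases hfix : ∃ x, s x = x
  · obtain ⟨x, hx⟩ := hfix
    have hall : ∀ y, y = x := fun y => ((h x y).eq_of_left hx).symm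
    haveI : Unique V := ⟨⟨x⟩, hall⟩
    rw [Matrix.det_unique, Fintype.card_unique, if_pos odd_one]
    have : s default = default := Subsingleton.elim _ _
    simp [permMatrix_apply', this]
    norm_num
  · push Not at hfix
    have hcyc : s.IsCycle := by
      obtain ⟨x⟩ := ‹Nonempty V›
      exact ⟨x, hfix x, fun y _ => h x y⟩
    have hsign : ((Perm.sign s : ℤ) : ℝ) = -(-1) ^ Fintype.card V := by
      have : s.support = Finset.univ := by
        ext x; simp [hfix x]
      rw [hcyc.sign, this, Finset.card_univ]
      simp
    have hne : (1 : Perm V) ≠ s := by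
      rintro rfl
      obtain ⟨x⟩ := ‹Nonempty V›
      exact hfix x rfl
    have hentry : ∀ i j, (1 + s.permMatrix ℝ) i j
        = (if i = j then 1 else 0) + if s i = j then 1 else 0 := by
      intro i j
      rw [Matrix.add_apply, Matrix.one_apply, permMatrix_apply']
    -- Only the identity and `s` contribute to the Leibniz expansion.
    rw [← Matrix.det_transpose, Matrix.det_apply', Finset.sum_eq_add 1 s hne]
    · have h1 : ∀ i, (1 + s.permMatrix ℝ).transpose ((1 : Perm V) i) i = 1 := by
        intro i
        rw [Matrix.transpose_apply, hentry]; simp [hfix i]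
      have h2 : ∀ i, (1 + s.permMatrix ℝ).transpose (s i) i = 1 := by
        intro i
        rw [Matrix.transpose_apply, hentry]; simp [(hfix i).symm]
      simp only [h1, h2, Finset.prod_const_one, hsign]
      rcases Nat.even_or_odd (Fintype.card V) with he | ho
      · rw [if_neg (Nat.not_odd_iff_even.mpr he), he.neg_one_pow]; simp
      · rw [if_pos ho, ho.neg_one_pow]; norm_num
    · rintro τ - ⟨hτ₁, hτ₂⟩
      rw [mul_eq_zero]; right
      by_contra hp
      have hall : ∀ i, τ i = i ∨ τ i = s i := by
        intro i
        have := (Finset.prod_ne_zero_iff.mp hp) i (Finset.mem_univ i)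
        rw [Matrix.transpose_apply, hentry] at this
        by_contra hi
        push Not at hi
        rw [if_neg hi.1.symm, if_neg hi.2.symm, add_zero] at this
        exact this rfl
      obtain ⟨i₀, hi₀⟩ : ∃ i, τ i ≠ i := by
        by_contra hi
        push Not at hi
        exact hτ₁ (Equiv.ext hi)
      -- If `τ` moves a point it sends it to the next one, which then cannot be fixed by
      -- injectivity. Once `τ` moves a point it follows the whole cycle.
      have hk : ∀ k : ℕ, τ ((s ^ k) i₀) ≠ (s ^ k) i₀ := by
        intro k
        induction k with
        | zero => exact hi₀
        | succ k ih =>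
          rw [pow_succ', Perm.mul_apply]
          intro hc
          have h1 := (hall _).resolve_left ih
          exact hfix _ (τ.injective (h1.trans hc.symm)).symm
      apply hτ₂
      ext i
      obtain ⟨k, rfl⟩ := (h i₀ i).exists_nat_pow_eq
      exact (hall _).resolve_left (hk k)
    · simp
    · simp

end Cycle

/-! ### Disjoint unions and isolated vertices -/

namespace RibbonGraph

variable {X Y : Type*} {G : RibbonGraph X} {H : RibbonGraph Y}

theorem closedValue_eq_ite [Finite X] (G : RibbonGraph X) (pos tail : Set X) [Fintype pos]
    [DecidableEq pos] [Fintype tail] (Ω t : X → ℝ) : G.closedValue pos tail Ω t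
      = if G.bare = 0 then (∏ e : tail, t e) * (G.formMatrix pos Ω t).det else 0 := by
  rw [closedValue]
  congr!

theorem IsOrientation.disjointUnion {pos : Set X} {pos' : Set Y} (ho : G.IsOrientation pos)
    (ho' : H.IsOrientation pos') :
    (G.disjointUnion H).IsOrientation {z | Sum.elim (· ∈ pos) (· ∈ pos') z} where
  σ₀_mem := by rintro (x | x); exacts [ho.σ₀_mem x, ho'.σ₀_mem x]
  θ_mem := by rintro (x | x); exacts [ho.θ_mem x, ho'.θ_mem x]
  σ₁_mem := by
    rintro (x | x) hx
    exacts [ho.σ₁_mem x fun h => hx (congrArg Sum.inl h),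
      ho'.σ₁_mem x fun h => hx (congrArg Sum.inr h)]

theorem IsTail.disjointUnion {pos tail : Set X} {pos' tail' : Set Y} (h : G.IsTail pos tail)
    (h' : H.IsTail pos' tail') : (G.disjointUnion H).IsTail {z | Sum.elim (· ∈ pos) (· ∈ pos') z}
      {z | Sum.elim (· ∈ tail) (· ∈ tail') z} where
  mem := by
    rintro (x | x) hx
    · exact ⟨(h.mem x hx).1, fun h1 => (h.mem x hx).2 (Sum.inl_injective h1)⟩
    · exact ⟨(h'.mem x hx).1, fun h1 => (h'.mem x hx).2 (Sum.inr_injective h1)⟩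
  iff := by
    rintro (x | x) hx hx₁
    · exact h.iff x hx fun h => hx₁ (congrArg Sum.inl h)
    · exact h'.iff x hx fun h => hx₁ (congrArg Sum.inr h)

theorem IsEdgeFunction.sumElim {w : X → ℝ} {w' : Y → ℝ} (h : G.IsEdgeFunction w)
    (h' : H.IsEdgeFunction w') : (G.disjointUnion H).IsEdgeFunction (Sum.elim w w') := by
  constructor <;> rintro (x | x)
  exacts [h.1 x, h'.1 x, h.2 x, h'.2 x]

/-- Neither rotation nor coupling leaves a summand, so the matrix is block diagonal. Vertices
without half-ribbons add up, so the union is killed exactly when one factor is. -/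
theorem closedValue_disjointUnion [Finite X] [Finite Y] (G : RibbonGraph X) (H : RibbonGraph Y)
    (pos tail : Set X) (pos' tail' : Set Y) (Ω t : X → ℝ) (Ω' t' : Y → ℝ) :
    (G.disjointUnion H).closedValue {z | Sum.elim (· ∈ pos) (· ∈ pos') z}
      {z | Sum.elim (· ∈ tail) (· ∈ tail') z} (Sum.elim Ω Ω') (Sum.elim t t')
      = G.closedValue pos tail Ω t * H.closedValue pos' tail' Ω' t' := by
  classical
  letI := Fintype.ofFinite X
  letI := Fintype.ofFinite Y
  rw [closedValue_eq_ite, closedValue_eq_ite, closedValue_eq_ite]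
  have hb : (G.disjointUnion H).bare = G.bare + H.bare := rfl
  by_cases h1 : G.bare = 0
  swap
  · rw [if_neg (by omega), if_neg h1, zero_mul]
  by_cases h2 : H.bare = 0
  swap
  · rw [if_neg (by omega), if_neg h2, mul_zero]
  rw [if_pos (by omega), if_pos h1, if_pos h2]
  let e : {z | Sum.elim (· ∈ pos) (· ∈ pos') z} ≃ pos ⊕ pos' := Equiv.subtypeSum
  let e' : {z | Sum.elim (· ∈ tail) (· ∈ tail') z} ≃ tail ⊕ tail' := Equiv.subtypeSum
  rw [← Equiv.prod_comp e'.symm, Fintype.prod_sum_type, ← Matrix.det_submatrix_equiv_self e.symm]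
  have hd : ((G.disjointUnion H).formMatrix {z | Sum.elim (· ∈ pos) (· ∈ pos') z} (Sum.elim Ω Ω')
      (Sum.elim t t')).submatrix e.symm e.symm
      = Matrix.fromBlocks (G.formMatrix pos Ω t) 0 0 (H.formMatrix pos' Ω' t') := by
    have c1 : ∀ (a : X) (y : pos), coord {z | Sum.elim (· ∈ pos) (· ∈ pos') z} (Sum.inl a)
        (e.symm (Sum.inl y)) = coord pos a y := by
      intro a y
      have : ((e.symm (Sum.inl y)).1 : X ⊕ Y) = Sum.inl y.1 := rfl
      simp [coord, this]
    have c2 : ∀ (a : X) (y : pos'), coord {z | Sum.elim (· ∈ pos) (· ∈ pos') z} (Sum.inl a)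
        (e.symm (Sum.inr y)) = 0 := by
      intro a y
      have : ((e.symm (Sum.inr y)).1 : X ⊕ Y) = Sum.inr y.1 := rfl
      simp [coord, this]
    have c3 : ∀ (a : Y) (y : pos), coord {z | Sum.elim (· ∈ pos) (· ∈ pos') z} (Sum.inr a)
        (e.symm (Sum.inl y)) = 0 := by
      intro a y
      have : ((e.symm (Sum.inl y)).1 : X ⊕ Y) = Sum.inl y.1 := rfl
      simp [coord, this]
    have c4 : ∀ (a : Y) (y : pos'), coord {z | Sum.elim (· ∈ pos) (· ∈ pos') z} (Sum.inr a)
        (e.symm (Sum.inr y)) = coord pos' a y := by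
      intro a y
      have : ((e.symm (Sum.inr y)).1 : X ⊕ Y) = Sum.inr y.1 := rfl
      simp [coord, this]
    have s0 : ∀ x, (G.disjointUnion H).σ₀ (Sum.inl x) = Sum.inl (G.σ₀ x) := fun _ => rfl
    have s1 : ∀ x, (G.disjointUnion H).σ₁ (Sum.inl x) = Sum.inl (G.σ₁ x) := fun _ => rfl
    have s2 : ∀ x, (G.disjointUnion H).twin (Sum.inl x) = Sum.inl (G.twin x) := fun _ => rfl
    have s0' : ∀ x, (G.disjointUnion H).σ₀ (Sum.inr x) = Sum.inr (H.σ₀ x) := fun _ => rfl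
    have s1' : ∀ x, (G.disjointUnion H).σ₁ (Sum.inr x) = Sum.inr (H.σ₁ x) := fun _ => rfl
    have s2' : ∀ x, (G.disjointUnion H).twin (Sum.inr x) = Sum.inr (H.twin x) := fun _ => rfl
    have v1 : ∀ x, ((e.symm (Sum.inl x)).1 : X ⊕ Y) = Sum.inl x.1 := fun _ => rfl
    have v2 : ∀ x, ((e.symm (Sum.inr x)).1 : X ⊕ Y) = Sum.inr x.1 := fun _ => rfl
    ext (x | x) (y | y)
    · rw [Matrix.submatrix_apply, formMatrix, Matrix.of_apply, form, v1, s1, s2]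
      by_cases hx : G.σ₁ x.1 = x.1 <;>
        simp [formMatrix, form, sumForm, diffForm, hx, s0, s0', c1, c2, c3, c4]
    · rw [Matrix.submatrix_apply, formMatrix, Matrix.of_apply, form, v1, s1, s2]
      by_cases hx : G.σ₁ x.1 = x.1 <;>
        simp [formMatrix, form, sumForm, diffForm, hx, s0, s0', c1, c2, c3, c4]
    · rw [Matrix.submatrix_apply, formMatrix, Matrix.of_apply, form, v2, s1', s2']
      by_cases hx : H.σ₁ x.1 = x.1 <;>
        simp [formMatrix, form, sumForm, diffForm, hx, s0, s0', c1, c2, c3, c4]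
    · rw [Matrix.submatrix_apply, formMatrix, Matrix.of_apply, form, v2, s1', s2']
      by_cases hx : H.σ₁ x.1 = x.1 <;>
        simp [formMatrix, form, sumForm, diffForm, hx, s0, s0', c1, c2, c3, c4]
  rw [hd, Matrix.det_fromBlocks_zero₂₁]
  have p1 : ∀ x, Sum.elim t t' ((e'.symm (Sum.inl x)).1) = t x := fun _ => rfl
  have p2 : ∀ x, Sum.elim t t' ((e'.symm (Sum.inr x)).1) = t' x := fun _ => rfl
  simp only [p1, p2]
  ring

theorem HU_disjointUnion [Finite X] [Finite Y] (hG : G.Orientable) (hH : H.Orientable)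
    {Ω t : X → ℝ} {Ω' t' : Y → ℝ} (hΩ : G.IsEdgeFunction Ω) (ht : G.IsEdgeFunction t)
    (hΩ' : H.IsEdgeFunction Ω') (ht' : H.IsEdgeFunction t') :
    (G.disjointUnion H).HU (Sum.elim Ω Ω') (Sum.elim t t') = G.HU Ω t * H.HU Ω' t' := by
  obtain ⟨pos, ho⟩ := hG
  obtain ⟨pos', ho'⟩ := hH
  obtain ⟨tail, h⟩ := ho.exists_isTail
  obtain ⟨tail', h'⟩ := ho'.exists_isTail
  rw [HU_eq ho h hΩ ht, HU_eq ho' h' hΩ' ht',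
    HU_eq (ho.disjointUnion ho') (h.disjointUnion h') (hΩ.sumElim hΩ') (ht.sumElim ht'),
    closedValue_disjointUnion]

theorem IsOrientation.card [Finite X] {pos : Set X} (ho : G.IsOrientation pos) :
    Nat.card X = 2 * Nat.card pos := by
  have e : pos ≃ (posᶜ : Set X) :=
    { toFun := fun x => ⟨G.θ x, fun h => (ho.θ_mem _).mp h x.2⟩
      invFun := fun x => ⟨G.θ x, (ho.θ_mem _).mpr x.2⟩
      left_inv := fun x => Subtype.ext (G.θ_θ _)
      right_inv := fun x => Subtype.ext (G.θ_θ _) }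
  have h := Set.ncard_add_ncard_compl pos
  rw [← h, two_mul, ← Nat.card_coe_set_eq, ← Nat.card_coe_set_eq, Nat.card_congr e]

/-- Arbitrary `Ω` and `t` need not be edge functions, as the closed form requires. Without edges
they play no role and may be replaced by constants. -/
theorem HU_eq_of_flags [Finite X] (hflag : ∀ x, G.σ₁ x = x) (Ω t Ω' t' : X → ℝ) :
    G.HU Ω t = G.HU Ω' t' := by
  rw [HU, HU]
  split_ifs with h
  · haveI : IsEmpty h.some.EdgeIndex := ⟨fun e => (h.some.tail_mem _ e.2).2 (hflag _)⟩
    rw [Presentation.value, Presentation.value]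
    rw [Subsingleton.elim (fun e : h.some.EdgeIndex => Ω e.1) fun e => Ω' e.1,
      Subsingleton.elim (fun e : h.some.EdgeIndex => t e.1) fun e => t' e.1]
  · rfl

theorem HU_isolatedVertex [Finite X] {n : ℕ} (hG : G.IsIsolatedVertex n) (Ω t : X → ℝ) :
    G.HU Ω t = if Odd n then 2 else 0 := by
  classical
  letI := Fintype.ofFinite X
  obtain ⟨hv, hflag, hcard⟩ := hG
  have hcst : G.IsEdgeFunction fun _ => 1 := ⟨fun _ => rfl, fun _ => rfl⟩
  rw [HU_eq_of_flags hflag Ω t (fun _ => 1) fun _ => 1]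
  have hv' : Nat.card (Quotient G.vertexSetoid) + G.bare = 1 := by
    rw [← hv]
    exact (Nat.card_sum.trans (by rw [Nat.card_fin])).symm
  rcases isEmpty_or_nonempty X with hX | hX
  -- Without crosses the single vertex is bare, and the value 0 agrees with `n = 0` being even.
  · have ho : G.IsOrientation ∅ := ⟨isEmptyElim, isEmptyElim, isEmptyElim⟩
    obtain ⟨tail, h⟩ := ho.exists_isTail
    have hn : n = 0 := by rw [Nat.card_of_isEmpty] at hcard; omega
    have hb : G.bare ≠ 0 := by rw [Nat.card_of_isEmpty] at hv'; omega
    rw [HU_eq ho h hcst hcst, closedValue_eq_ite, if_neg hb, hn]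
    simp
  · obtain ⟨x₀⟩ := hX
    have hpos : 0 < Nat.card (Quotient G.vertexSetoid) :=
      Nat.card_pos_iff.mpr ⟨⟨Quotient.mk _ x₀⟩, inferInstance⟩
    have hb : G.bare = 0 := by omega
    haveI : Subsingleton (Quotient G.vertexSetoid) := by
      rw [← Finite.card_le_one_iff_subsingleton]; omega
    have hone : ∀ y, G.σ₀.SameCycle x₀ y ∨ G.σ₀.SameCycle (G.θ x₀) y := fun y =>
      Quotient.exact (Subsingleton.elim (Quotient.mk G.vertexSetoid x₀) (Quotient.mk _ y))
    -- There is a single pair of conjugate cycles, and one of them is an orientation.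
    set pos : Set X := {y | G.σ₀.SameCycle x₀ y} with hpos
    have ho : G.IsOrientation pos := by
      refine ⟨fun y => Perm.sameCycle_apply_right, fun y => ?_, fun y hy => absurd (hflag y) hy⟩
      constructor
      · intro h1 h2
        exact G.orbit_ne y (Perm.SameCycle.trans (Perm.SameCycle.symm h2) h1)
      · intro h1
        rcases hone y with h2 | h2
        · exact absurd h2 h1
        · have := G.sameCycle_θ h2
          rwa [G.θ_θ] at this
    have htail : G.IsTail pos ∅ := ⟨by simp, fun x _ hx => absurd (hflag x) hx⟩
    rw [HU_eq ho htail hcst hcst, closedValue_eq_ite, if_pos hb]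
    have hM : G.formMatrix pos (fun _ => 1) (fun _ => 1) = 1 + ho.rot.permMatrix ℝ := by
      ext x y
      rw [formMatrix, Matrix.of_apply, form, if_pos (hflag x), Matrix.add_apply, Matrix.one_apply,
        permMatrix_apply']
      simp [sumForm, coord, Subtype.ext_iff, ho.rot_val]
    haveI : Nonempty pos := ⟨⟨x₀, Perm.SameCycle.refl _ _⟩⟩
    have hn : Fintype.card pos = n := by
      have := ho.card
      rw [← Nat.card_eq_fintype_card]
      omega
    rw [hM, det_one_add_permMatrix _ fun x y => ?_, hn]
    · simp
    · exact (Perm.sameCycle_subtypePerm (h := ho.σ₀_mem)).mpr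
        (Perm.SameCycle.trans (Perm.SameCycle.symm x.2) y.2)

end RibbonGraph

/-! ### Expansion of the determinant in the two rows of an edge -/

section Bilinear

/-- Expansion of an alternating bilinear form at the two linear forms of an edge. -/
theorem alternating_expansion {W : Type*} [AddCommGroup W] [Module ℝ W] (F : W → W → ℝ)
    (h₁ : ∀ u v w, F (u + v) w = F u w + F v w) (h₂ : ∀ (c : ℝ) u w, F (c • u) w = c * F u w)
    (h₃ : ∀ u v w, F u (v + w) = F u v + F u w) (h₄ : ∀ (c : ℝ) u w, F u (c • w) = c * F u w)
    (h₅ : ∀ u, F u u = 0) (Ω t : ℝ) (ht : t ≠ 0) (p p' q q' : W) :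
    t * F (((Ω / t + Ω * t) / 2) • (p + q) + ((Ω * t - Ω / t) / 2) • (p' + q') + (p - q))
        (((Ω / t + Ω * t) / 2) • (p' + q') + ((Ω * t - Ω / t) / 2) • (p + q) + (p' - q'))
      = t * F (p - q) (p' - q') + t * Ω ^ 2 * F (p + q) (p' + q')
        + Ω * F (p - q') (p' - q) + Ω * t ^ 2 * F (p + q') (p' + q) := by
  have h₆ : ∀ u v, F u v = - F v u := by
    intro u v
    have := h₅ (u + v)
    rw [h₁, h₃, h₃, h₅, h₅] at this
    linarith
  have hs : ∀ u v : W, u - v = u + (-1 : ℝ) • v := fun u v => by module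
  -- By bilinearity and antisymmetry everything reduces to the six pairings of `p`, `p'`, `q`, `q'`,
  -- whose coefficients are compared.
  simp only [hs, h₁, h₂, h₃, h₄, smul_add, h₅]
  rw [h₆ p' p, h₆ q p, h₆ q' p, h₆ q p', h₆ q' p', h₆ q' q]
  field_simp
  ring

variable {V : Type*} [Fintype V] [DecidableEq V]

/-- The determinant of a matrix two rows of which are replaced, expanded at an edge. -/
theorem det_updateRow_expansion (N : Matrix V V ℝ) {i j : V} (hij : i ≠ j) (Ω t : ℝ) (ht : t ≠ 0)
    (p p' q q' : V → ℝ) :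
    t * ((N.updateRow i
          (((Ω / t + Ω * t) / 2) • (p + q) + ((Ω * t - Ω / t) / 2) • (p' + q') + (p - q))).updateRow j
        (((Ω / t + Ω * t) / 2) • (p' + q') + ((Ω * t - Ω / t) / 2) • (p + q) + (p' - q'))).det
      = t * ((N.updateRow i (p - q)).updateRow j (p' - q')).det
        + t * Ω ^ 2 * ((N.updateRow i (p + q)).updateRow j (p' + q')).det
        + Ω * ((N.updateRow i (p - q')).updateRow j (p' - q)).det
        + Ω * t ^ 2 * ((N.updateRow i (p + q')).updateRow j (p' + q)).det := by
  refine alternating_expansion (fun r r' => ((N.updateRow i r).updateRow j r').det) ?_ ?_ ?_ ?_ ?_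
    Ω t ht p p' q q'
  · intro u v w
    simp only [Matrix.updateRow_comm _ hij]
    rw [Matrix.det_updateRow_add]
  · intro c u w
    simp only [Matrix.updateRow_comm _ hij]
    rw [Matrix.det_updateRow_smul]
  · intro u v w
    exact Matrix.det_updateRow_add _ _ _ _
  · intro c u w
    exact Matrix.det_updateRow_smul _ _ _ _
  · intro u
    exact Matrix.det_zero_of_row_eq hij (by simp [Matrix.updateRow_ne hij])

end Bilinear

namespace RibbonGraph

variable {X : Type*} {G : RibbonGraph X}

theorem IsOrientation.compl {pos : Set X} (ho : G.IsOrientation pos) : G.IsOrientation posᶜ where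
  σ₀_mem x := not_congr (ho.σ₀_mem x)
  θ_mem x := not_congr (ho.θ_mem x)
  σ₁_mem x hx := not_congr (ho.σ₁_mem x hx)

theorem twin_mem_edge (G : RibbonGraph X) (x y : X) : G.twin y ∈ G.edge x ↔ y ∈ G.edge x := by
  rw [twin, θ_mem_edge, σ₁_mem_edge]

open Classical in
theorem prod_tail_eq_mul [Fintype X] {pos tail : Set X} (ho : G.IsOrientation pos)
    (h : G.IsTail pos tail) {t : X → ℝ} (ht : G.IsEdgeFunction t) {x : X} (hx₁ : G.σ₁ x ≠ x) :
    ∏ e : tail, t e = t x * ∏ e : (tail \ G.edge x : Set X), t e := by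
  obtain ⟨e, he, hex⟩ := h.exists_mem_edge ho x hx₁
  rw [Finset.prod_set_coe, Finset.prod_set_coe]
  have : tail.toFinset = insert e (tail \ G.edge x).toFinset := by
    ext y
    simp only [Set.mem_toFinset, Finset.mem_insert, Set.mem_sdiff]
    constructor
    · intro hy
      by_cases hyx : y ∈ G.edge x
      · exact Or.inl (h.eq_of_mem_edge ho he hy (mem_edge_trans (mem_edge_comm hex) hyx))
      · exact Or.inr ⟨hy, hyx⟩
    · rintro (rfl | hy)
      exacts [he, hy.1]
  rw [this, Finset.prod_insert (by simp [hex]), ht.eq_of_mem_edge hex]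

/-! ### Cutting an edge -/

section Cut

theorem cut_σ₁_of_mem (G : RibbonGraph X) {x y : X} (h : y ∈ G.edge x) : (G.cut x).σ₁ y = y :=
  permOn_of_notMem _ _ _ (Set.notMem_compl_iff.mpr h)

theorem cut_σ₁_of_notMem (G : RibbonGraph X) {x y : X} (h : y ∉ G.edge x) :
    (G.cut x).σ₁ y = G.σ₁ y :=
  permOn_of_mem _ _ _ h

theorem cut_twin_of_notMem (G : RibbonGraph X) {x y : X} (h : y ∉ G.edge x) :
    (G.cut x).twin y = G.twin y :=
  congrArg G.θ (G.cut_σ₁_of_notMem h)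

theorem IsOrientation.cut {pos : Set X} (ho : G.IsOrientation pos) (x : X) :
    (G.cut x).IsOrientation pos where
  σ₀_mem := ho.σ₀_mem
  θ_mem := ho.θ_mem
  σ₁_mem y hy := by
    by_cases h : y ∈ G.edge x
    · exact absurd (G.cut_σ₁_of_mem h) hy
    · rw [G.cut_σ₁_of_notMem h] at hy ⊢
      exact ho.σ₁_mem y hy

theorem IsTail.cut {pos tail : Set X} (h : G.IsTail pos tail) (x : X) :
    (G.cut x).IsTail pos (tail \ G.edge x) where
  mem y hy := ⟨(h.mem y hy.1).1, by rw [G.cut_σ₁_of_notMem hy.2]; exact (h.mem y hy.1).2⟩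
  iff y hy hy₁ := by
    by_cases hyx : y ∈ G.edge x
    · exact absurd (G.cut_σ₁_of_mem hyx) hy₁
    · rw [G.cut_σ₁_of_notMem hyx] at hy₁
      rw [G.cut_twin_of_notMem hyx, Set.mem_sdiff, Set.mem_sdiff, G.twin_mem_edge, h.iff y hy hy₁]
      simp [hyx]

theorem IsEdgeFunction.cut {w : X → ℝ} (h : G.IsEdgeFunction w) (x : X) :
    (G.cut x).IsEdgeFunction w := by
  refine ⟨h.1, fun y => ?_⟩
  by_cases hy : y ∈ G.edge x
  · rw [G.cut_σ₁_of_mem hy]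
  · rw [G.cut_σ₁_of_notMem hy, h.2]

open Classical in
theorem formMatrix_cut {pos : Set X} (ho : G.IsOrientation pos) (Ω t : X → ℝ) {x : X}
    (hx : x ∈ pos) (hx₁ : G.σ₁ x ≠ x) : (G.cut x).formMatrix pos Ω t
      = ((G.formMatrix pos Ω t).updateRow ⟨x, hx⟩ (G.sumForm pos x)).updateRow
        ⟨G.twin x, (ho.twin_mem hx₁).mpr hx⟩ (G.sumForm pos (G.twin x)) := by
  ext ⟨y, hy⟩ z
  rw [Matrix.updateRow_apply, Matrix.updateRow_apply]
  simp only [Subtype.mk.injEq]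
  show (G.cut x).form pos Ω t y z = _
  by_cases hyx : y ∈ G.edge x
  · rw [form, if_pos (G.cut_σ₁_of_mem hyx)]
    rcases (ho.mem_edge_iff hx hx₁ hy).mp hyx with rfl | rfl
    · rw [if_neg (G.twin_ne y).symm, if_pos rfl]; rfl
    · rw [if_pos rfl]; rfl
  · have h1 : y ≠ x := fun h => hyx (h ▸ G.mem_edge_self x)
    have h2 : y ≠ G.twin x := fun h => hyx (by rw [h, twin_mem_edge]; exact G.mem_edge_self x)
    rw [if_neg h2, if_neg h1, form, G.cut_σ₁_of_notMem hyx, G.cut_twin_of_notMem hyx]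
    rfl

end Cut

/-! ### Partial duality -/

section Dual

variable {x : X} (hx₁ : G.σ₁ x ≠ x)

theorem edge_partialDual : (G.partialDual x hx₁).edge x = G.edge x := by
  have h1 : (G.partialDual x hx₁).θ x = G.σ₁ x := dualθ_of_mem G (G.mem_edge_self x)
  have h2 : (G.partialDual x hx₁).σ₁ x = G.θ x := dualσ₁_of_mem G (G.mem_edge_self x)
  have h3 : (G.partialDual x hx₁).θ (G.θ x) = G.θ (G.σ₁ x) :=
    (dualθ_of_mem G ((G.θ_mem_edge x x).mpr (G.mem_edge_self x))).trans (G.θ_σ₁ x).symm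
  rw [edge, edge, h1, h2, h3, Set.insert_comm (G.σ₁ x)]

theorem partialDual_σ₁_ne_iff (y : X) :
    (G.partialDual x hx₁).σ₁ y = y ↔ G.σ₁ y = y := by
  by_cases hy : y ∈ G.edge x
  · rw [show (G.partialDual x hx₁).σ₁ y = G.θ y from dualσ₁_of_mem G hy]
    exact iff_of_false (G.θ_ne y) (G.σ₁_ne_of_mem_edge hx₁ hy)
  · rw [show (G.partialDual x hx₁).σ₁ y = G.σ₁ y from dualσ₁_of_notMem G hy]

/-- On the edge, `θ` and `σ₁` are exchanged and their product is unchanged. This is why the same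
`pos` and `tail` serve for the partial dual, with the same coupling. -/
theorem twin_partialDual (y : X) : (G.partialDual x hx₁).twin y = G.twin y := by
  by_cases hy : y ∈ G.edge x
  · exact (congrArg (G.dualθ x) (dualσ₁_of_mem G hy)).trans
      ((dualθ_of_mem G ((G.θ_mem_edge x y).mpr hy)).trans (G.θ_σ₁ y).symm)
  · exact (congrArg (G.dualθ x) (dualσ₁_of_notMem G hy)).trans
      (dualθ_of_notMem G fun h => hy ((G.σ₁_mem_edge x y).mp h))

theorem IsOrientation.partialDual {pos : Set X} (ho : G.IsOrientation pos) :
    (G.partialDual x hx₁).IsOrientation pos where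
  σ₀_mem y := by
    by_cases hy : y ∈ G.edge x
    · rw [show (G.partialDual x hx₁).σ₀ y = G.σ₀ (G.twin y) from dualσ₀_of_mem G hy, ho.σ₀_mem,
        ho.twin_mem (G.σ₁_ne_of_mem_edge hx₁ hy)]
    · rw [show (G.partialDual x hx₁).σ₀ y = G.σ₀ y from dualσ₀_of_notMem G hy, ho.σ₀_mem]
  θ_mem y := by
    by_cases hy : y ∈ G.edge x
    · rw [show (G.partialDual x hx₁).θ y = G.σ₁ y from dualθ_of_mem G hy,
        ho.σ₁_mem y (G.σ₁_ne_of_mem_edge hx₁ hy)]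
    · rw [show (G.partialDual x hx₁).θ y = G.θ y from dualθ_of_notMem G hy, ho.θ_mem]
  σ₁_mem y hy₁ := by
    rw [ne_eq, partialDual_σ₁_ne_iff] at hy₁
    by_cases hy : y ∈ G.edge x
    · rw [show (G.partialDual x hx₁).σ₁ y = G.θ y from dualσ₁_of_mem G hy, ho.θ_mem]
    · rw [show (G.partialDual x hx₁).σ₁ y = G.σ₁ y from dualσ₁_of_notMem G hy, ho.σ₁_mem y hy₁]

theorem IsTail.partialDual {pos tail : Set X} (h : G.IsTail pos tail) :
    (G.partialDual x hx₁).IsTail pos tail where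
  mem y hy := ⟨(h.mem y hy).1, fun h' => (h.mem y hy).2 ((partialDual_σ₁_ne_iff hx₁ y).mp h')⟩
  iff y hy hy₁ := by
    rw [twin_partialDual]
    exact h.iff y hy fun h' => hy₁ ((partialDual_σ₁_ne_iff hx₁ y).mpr h')

theorem IsEdgeFunction.partialDual {w : X → ℝ} (h : G.IsEdgeFunction w) :
    (G.partialDual x hx₁).IsEdgeFunction w := by
  constructor <;> intro y <;> by_cases hy : y ∈ G.edge x
  · rw [show (G.partialDual x hx₁).θ y = G.σ₁ y from dualθ_of_mem G hy, h.2]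
  · rw [show (G.partialDual x hx₁).θ y = G.θ y from dualθ_of_notMem G hy, h.1]
  · rw [show (G.partialDual x hx₁).σ₁ y = G.θ y from dualσ₁_of_mem G hy, h.1]
  · rw [show (G.partialDual x hx₁).σ₁ y = G.σ₁ y from dualσ₁_of_notMem G hy, h.2]

open Classical in
/-- Partial duality only changes the linear forms of the edge. -/
theorem updateRow_formMatrix_partialDual {pos : Set X} (ho : G.IsOrientation pos) (Ω t : X → ℝ)
    (hx : x ∈ pos) (r r' : pos → ℝ) :
    (((G.partialDual x hx₁).formMatrix pos Ω t).updateRow ⟨x, hx⟩ r).updateRow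
        ⟨G.twin x, (ho.twin_mem hx₁).mpr hx⟩ r'
      = ((G.formMatrix pos Ω t).updateRow ⟨x, hx⟩ r).updateRow
        ⟨G.twin x, (ho.twin_mem hx₁).mpr hx⟩ r' := by
  ext ⟨y, hy⟩ z
  rw [Matrix.updateRow_apply, Matrix.updateRow_apply, Matrix.updateRow_apply, Matrix.updateRow_apply]
  simp only [Subtype.mk.injEq]
  by_cases h2 : y = G.twin x
  · rw [if_pos h2, if_pos h2]
  by_cases h1 : y = x
  · rw [if_neg h2, if_neg h2, if_pos h1, if_pos h1]
  rw [if_neg h2, if_neg h2, if_neg h1, if_neg h1]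
  show (G.partialDual x hx₁).form pos Ω t y z = G.form pos Ω t y z
  have hyx : y ∉ G.edge x := by
    rw [ho.mem_edge_iff hx hx₁ hy]; tauto
  have h3 : G.twin y ∉ G.edge x := by rwa [twin_mem_edge]
  have e1 : (G.partialDual x hx₁).σ₀ y = G.σ₀ y := dualσ₀_of_notMem G hyx
  have e2 : (G.partialDual x hx₁).σ₀ (G.twin y) = G.σ₀ (G.twin y) := dualσ₀_of_notMem G h3
  have e3 : (G.partialDual x hx₁).σ₁ y = G.σ₁ y := dualσ₁_of_notMem G hyx
  rw [form, form, e3, twin_partialDual,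
    sumForm, sumForm, sumForm, sumForm, diffForm, diffForm, e1, e2]

end Dual

end RibbonGraph
namespace RibbonGraph

variable {X : Type*} {G : RibbonGraph X}

/-! ### Deleting an edge -/

section Delete

open Classical in
/-- The matrix obtained by erasing the coupling of an edge. -/
noncomputable def IsOrientation.uncoupledMatrix {pos : Set X} (ho : G.IsOrientation pos) (Ω t : X → ℝ) {x : X}
    (hx : x ∈ pos) (hx₁ : G.σ₁ x ≠ x) : Matrix pos pos ℝ :=
  ((G.formMatrix pos Ω t).updateRow ⟨x, hx⟩ (G.diffForm pos x)).updateRow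
    ⟨G.twin x, (ho.twin_mem hx₁).mpr hx⟩ (G.diffForm pos (G.twin x))

open Classical in
theorem uncoupledMatrix_of_mem {pos : Set X} (ho : G.IsOrientation pos) (Ω t : X → ℝ) {x : X}
    (hx : x ∈ pos) (hx₁ : G.σ₁ x ≠ x) (y : pos) (hy : y.1 ∈ G.edge x) :
    ho.uncoupledMatrix Ω t hx hx₁ y = G.diffForm pos y := by
  obtain ⟨y, hyp⟩ := y
  funext z
  rw [IsOrientation.uncoupledMatrix, Matrix.updateRow_apply, Matrix.updateRow_apply]
  simp only [Subtype.mk.injEq]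
  rcases (ho.mem_edge_iff hx hx₁ hyp).mp hy with rfl | rfl
  · rw [if_neg (G.twin_ne y).symm, if_pos rfl]
  · rw [if_pos rfl]

open Classical in
theorem uncoupledMatrix_of_notMem {pos : Set X} (ho : G.IsOrientation pos) (Ω t : X → ℝ) {x : X}
    (hx : x ∈ pos) (hx₁ : G.σ₁ x ≠ x) (y : pos) (hy : y.1 ∉ G.edge x) :
    ho.uncoupledMatrix Ω t hx hx₁ y = G.form pos Ω t y := by
  obtain ⟨y, hyp⟩ := y
  have h1 : y ≠ x := fun h => hy (h ▸ G.mem_edge_self x)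
  have h2 : y ≠ G.twin x := fun h => hy (show y ∈ G.edge x by
    rw [h, twin_mem_edge]; exact G.mem_edge_self x)
  funext z
  rw [IsOrientation.uncoupledMatrix, Matrix.updateRow_apply, Matrix.updateRow_apply]
  simp only [Subtype.mk.injEq]
  rw [if_neg h2, if_neg h1]
  rfl

/-- Application of a linear form. -/
theorem sum_coord_mul {pos : Set X} [Fintype pos] (a : X) (ha : a ∈ pos) (f : pos → ℝ) :
    ∑ h, coord pos a h * f h = f ⟨a, ha⟩ := by
  rw [Finset.sum_eq_single ⟨a, ha⟩]
  · simp [coord]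
  · intro b _ hb
    have : a ≠ b := fun h => hb (Subtype.ext h.symm)
    simp [coord, this]
  · simp

open Classical in
/-- A vertex disappears: the matrix is singular. -/
theorem det_uncoupledMatrix_eq_zero {pos : Set X} [Fintype pos] (ho : G.IsOrientation pos)
    (Ω t : X → ℝ) {x : X} (hx : x ∈ pos) (hx₁ : G.σ₁ x ≠ x) (v : Quotient G.vertexSetoid)
    (hv : ∀ y, Quotient.mk G.vertexSetoid y = v → y ∈ G.edge x) :
    (ho.uncoupledMatrix Ω t hx hx₁).det = 0 := by
  obtain ⟨z, hz, hzv⟩ := ho.exists_rep v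
  -- The indicator of the vertex is in the kernel: it is constant along `σ₀`, which kills the
  -- differences, and the sums attached to half-ribbons outside the edge do not meet this vertex.
  let q : pos → ℝ := fun y => if Quotient.mk G.vertexSetoid y.1 = v then 1 else 0
  have hσ : ∀ y : X, Quotient.mk G.vertexSetoid (G.σ₀ y) = Quotient.mk G.vertexSetoid y := fun y =>
    Quotient.sound (Or.inl (Perm.SameCycle.symm (Perm.sameCycle_apply_right.mpr
      (Perm.SameCycle.refl _ y))))
  refine Matrix.exists_mulVec_eq_zero_iff.mp ⟨q, ?_, ?_⟩
  · intro h
    have := congrFun h ⟨z, hz⟩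
    simp [q, hzv] at this
  · have hc : ∀ a (ha : a ∈ pos), ∑ h, coord pos a h * q h
        = if Quotient.mk G.vertexSetoid a = v then 1 else 0 := fun a ha => sum_coord_mul a ha q
    have hs : ∀ a ∈ pos, a ∉ G.edge x → ∑ h, G.sumForm pos a h * q h = 0 := by
      intro a ha hax
      simp only [sumForm, Pi.add_apply, add_mul, Finset.sum_add_distrib]
      rw [hc a ha, hc _ ((ho.σ₀_mem a).mpr ha), hσ, if_neg fun h => hax (hv a h), add_zero]
    have hd : ∀ a ∈ pos, ∑ h, G.diffForm pos a h * q h = 0 := by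
      intro a ha
      simp only [diffForm, Pi.sub_apply, sub_mul, Finset.sum_sub_distrib]
      rw [hc a ha, hc _ ((ho.σ₀_mem a).mpr ha), hσ, sub_self]
    funext y
    show ∑ h, ho.uncoupledMatrix Ω t hx hx₁ y h * q h = 0
    by_cases hy : y.1 ∈ G.edge x
    · rw [uncoupledMatrix_of_mem ho Ω t hx hx₁ y hy]
      exact hd y y.2
    · rw [uncoupledMatrix_of_notMem ho Ω t hx hx₁ y hy, form]
      split_ifs with hy₁
      · exact hs y y.2 hy
      · simp only [Pi.add_apply, Pi.smul_apply, smul_eq_mul, add_mul, Finset.sum_add_distrib,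
          mul_assoc, ← Finset.mul_sum]
        rw [hs y y.2 hy, hd y y.2, hs _ ((ho.twin_mem hy₁).mpr y.2) (by rwa [twin_mem_edge])]
        simp

variable [Finite X]

theorem delete_σ₁_eq_iff (x : X) (y : ((G.edge x)ᶜ : Set X)) :
    (G.delete x).σ₁ y = y ↔ G.σ₁ y = y := Subtype.ext_iff

theorem delete_σ₀_val (x : X) (y : ((G.edge x)ᶜ : Set X)) :
    ((G.delete x).σ₀ y : X) = (G.σ₀ ^ returnTime G.σ₀ (G.edge x)ᶜ y) (y : X) := rfl

theorem IsOrientation.delete {pos : Set X} (ho : G.IsOrientation pos) (x : X) :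
    (G.delete x).IsOrientation {y | y.1 ∈ pos} where
  σ₀_mem y := by
    show ((G.delete x).σ₀ y : X) ∈ pos ↔ _
    rw [delete_σ₀_val, ← zpow_natCast, ho.zpow_mem]
    rfl
  θ_mem y := ho.θ_mem y
  σ₁_mem y hy := ho.σ₁_mem y fun h => hy ((delete_σ₁_eq_iff x y).mpr h)

theorem IsTail.delete {pos tail : Set X} (h : G.IsTail pos tail) (x : X) :
    (G.delete x).IsTail {y | y.1 ∈ pos} {y | y.1 ∈ tail} where
  mem y hy := ⟨(h.mem y hy).1, fun h' => (h.mem y hy).2 ((delete_σ₁_eq_iff x y).mp h')⟩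
  iff y hy hy₁ := h.iff y hy fun h => hy₁ ((delete_σ₁_eq_iff x y).mpr h)

theorem IsEdgeFunction.delete {w : X → ℝ} (h : G.IsEdgeFunction w) (x : X) :
    (G.delete x).IsEdgeFunction fun y => w y :=
  ⟨fun y => h.1 y, fun y => h.2 y⟩

open Classical in
/-- The first half-ribbon outside the edge which is met when turning around the vertex. -/
theorem IsOrientation.exists_hit {pos : Set X} (ho : G.IsOrientation pos) (x : X)
    (hv : ∀ v : Quotient G.vertexSetoid, ∃ y, Quotient.mk G.vertexSetoid y = v ∧ y ∉ G.edge x) :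
    ∃ (hit : pos → ℕ) (r : pos → ({y | y.1 ∈ pos} : Set ((G.edge x)ᶜ : Set X))),
      (∀ y, r ⟨y.1.1, y.2⟩ = y) ∧ (∀ h : pos, h.1 ∈ G.edge x → hit (ho.rot h) < hit h) ∧
      (∀ h : pos, h.1 ∈ G.edge x → r (ho.rot h) = r h) ∧
      ∀ y : ({y | y.1 ∈ pos} : Set ((G.edge x)ᶜ : Set X)),
        (r (ho.rot ⟨y.1.1, y.2⟩)).1 = (G.delete x).σ₀ y.1 := by
  set pos' : Set ((G.edge x)ᶜ : Set X) := {y | y.1 ∈ pos} with hpos'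
  have hhit : ∀ y : pos, ∃ k : ℕ, (G.σ₀ ^ k) y.1 ∉ G.edge x := by
    intro y
    obtain ⟨z, hz, hzx⟩ := hv (Quotient.mk _ y.1)
    have key : ∀ z, z ∈ pos → Quotient.mk G.vertexSetoid z = Quotient.mk _ y.1 → z ∉ G.edge x →
        ∃ k : ℕ, (G.σ₀ ^ k) y.1 ∉ G.edge x := by
      intro z hzp hz hzx
      obtain ⟨k, hk⟩ := ((ho.mk_eq_mk_iff y.2 hzp).mp hz).symm.exists_nat_pow_eq
      exact ⟨k, by rwa [hk]⟩
    by_cases hzp : z ∈ pos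
    · exact key z hzp hz hzx
    · refine key (G.θ z) ((ho.θ_mem z).mpr hzp) ?_ (by rwa [θ_mem_edge])
      rw [← hz]
      exact Quotient.sound (Or.inr (by
        show G.σ₀.SameCycle (G.θ (G.θ z)) z
        rw [G.θ_θ]))
  let hit : pos → ℕ := fun y => Nat.find (hhit y)
  have hpow : ∀ (k : ℕ) {y : X}, y ∈ pos → (G.σ₀ ^ k) y ∈ pos := by
    intro k y hy
    rw [← zpow_natCast]; exact (ho.zpow_mem _ y).mpr hy
  let r : pos → pos' := fun y =>
    ⟨⟨(G.σ₀ ^ hit y) y.1, Nat.find_spec (hhit y)⟩, hpow _ y.2⟩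
  let inc : pos' → pos := fun y => ⟨y.1.1, y.2⟩
  have hr : ∀ y, r (inc y) = y := by
    intro y
    have : hit (inc y) = 0 := (Nat.find_eq_zero _).mpr y.1.2
    apply Subtype.ext
    apply Subtype.ext
    show (G.σ₀ ^ hit (inc y)) y.1.1 = y.1.1
    rw [this]; rfl
  -- From a half-ribbon of the edge, turning once brings the first hit exactly one step nearer; this
  -- is the rank for the contraction.
  have hsucc : ∀ h : pos, h.1 ∈ G.edge x → hit h = hit (ho.rot h) + 1 := by
    intro h hh
    have hne : hit h ≠ 0 := by
      intro h0
      exact (Nat.find_eq_zero (hhit h)).mp h0 hh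
    apply le_antisymm
    · refine Nat.find_min' (hhit h) ?_
      rw [pow_succ, Perm.mul_apply]
      exact Nat.find_spec (hhit (ho.rot h))
    · have : hit (ho.rot h) ≤ hit h - 1 := by
        refine Nat.find_min' (hhit (ho.rot h)) ?_
        have h1 : (G.σ₀ ^ hit h) h.1 ∉ G.edge x := Nat.find_spec (hhit h)
        rw [show hit h = (hit h - 1) + 1 by omega, pow_succ, Perm.mul_apply] at h1
        exact h1
      omega
  have hrot : ∀ h : pos, h.1 ∈ G.edge x → r (ho.rot h) = r h := by
    intro h hh
    apply Subtype.ext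
    apply Subtype.ext
    show (G.σ₀ ^ hit (ho.rot h)) (G.σ₀ h.1) = (G.σ₀ ^ hit h) h.1
    rw [hsucc h hh, pow_succ, Perm.mul_apply]
  have hret : ∀ y : pos', (r (ho.rot (inc y))).1 = (G.delete x).σ₀ y.1 := by
    intro y
    apply Subtype.ext
    show (G.σ₀ ^ hit (ho.rot (inc y))) (G.σ₀ y.1.1) = _
    rw [delete_σ₀_val]
    -- A return time is positive whereas `hit` may be zero: the first return from `y` is one turn
    -- followed by the first hit.
    have : returnTime G.σ₀ (G.edge x)ᶜ y.1 = hit (ho.rot (inc y)) + 1 := by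
      apply le_antisymm
      · refine returnTime_le _ _ _ (Nat.succ_pos _) ?_
        rw [pow_succ, Perm.mul_apply]
        exact Nat.find_spec (hhit (ho.rot (inc y)))
      · have h1 := returnTime_pos G.σ₀ (G.edge x)ᶜ y.1
        have h2 := returnTime_mem G.σ₀ (G.edge x)ᶜ y.1
        have : hit (ho.rot (inc y)) ≤ returnTime G.σ₀ (G.edge x)ᶜ y.1 - 1 := by
          refine Nat.find_min' (hhit (ho.rot (inc y))) ?_
          rw [show returnTime G.σ₀ (G.edge x)ᶜ y.1
            = (returnTime G.σ₀ (G.edge x)ᶜ y.1 - 1) + 1 by omega, pow_succ, Perm.mul_apply] at h2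
          exact h2
        omega
    rw [this, pow_succ, Perm.mul_apply]
  exact ⟨hit, r, hr, fun h hh => by rw [hsucc h hh]; omega, hrot, hret⟩

open Classical in
/-- Erasing the coupling of an edge amounts to deleting it. -/
theorem det_uncoupledMatrix {pos : Set X} [Fintype pos] (ho : G.IsOrientation pos)
    (Ω t : X → ℝ) {x : X} (hx : x ∈ pos) (hx₁ : G.σ₁ x ≠ x)
    [Fintype ({y | y.1 ∈ pos} : Set ((G.edge x)ᶜ : Set X))]
    (hv : ∀ v : Quotient G.vertexSetoid, ∃ y, Quotient.mk G.vertexSetoid y = v ∧ y ∉ G.edge x) :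
    (ho.uncoupledMatrix Ω t hx hx₁).det
      = ((G.delete x).formMatrix {y | y.1 ∈ pos} (fun y => Ω y) fun y => t y).det := by
  obtain ⟨hit, r, hr, hlt, hrot, hret⟩ := ho.exists_hit x hv
  let inc : ({y | y.1 ∈ pos} : Set ((G.edge x)ᶜ : Set X)) → pos := fun y => ⟨y.1.1, y.2⟩
  have hrange : ∀ h : pos, h ∉ Set.range inc → h.1 ∈ G.edge x := by
    intro h hh
    by_contra hc
    exact hh ⟨⟨⟨h.1, hc⟩, h.2⟩, rfl⟩
  -- The rows of the edge identify each of its half-ribbons with the next one, so each unknown is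
  -- carried to the first half-ribbon outside the edge, which is how deletion acts on `σ₀`.
  rw [det_contract (ho.uncoupledMatrix Ω t hx hx₁) inc r (fun _ => 1) (fun _ => 1) ho.rot hit hr
    (fun _ => rfl)]
  · refine congrArg Matrix.det ?_
    ext y y'
    rw [Matrix.of_apply, uncoupledMatrix_of_notMem ho Ω t hx hx₁ (inc y) y.1.2]
    have hc : ∀ (a : pos), ∑ h, coord pos a.1 h * (if r h = y' then (1 : ℝ) else 0)
        = coord {y | y.1 ∈ pos} (r a).1 y' := by
      intro a
      rw [sum_coord_mul a.1 a.2, coord]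
      simp only [Subtype.ext_iff]
    have hs : ∀ y : ({y | y.1 ∈ pos} : Set ((G.edge x)ᶜ : Set X)), ∑ h, G.sumForm pos y.1.1 h * (if r h = y' then (1 : ℝ) else 0)
        = (G.delete x).sumForm {y | y.1 ∈ pos} y.1 y' := by
      intro y
      simp only [sumForm, Pi.add_apply, add_mul, Finset.sum_add_distrib]
      rw [← hret y, ← hc (ho.rot ⟨y.1.1, y.2⟩)]
      have := hc (inc y)
      rw [show r (inc y) = y from hr y] at this
      rw [← this]
      rfl
    have hd : ∀ y : ({y | y.1 ∈ pos} : Set ((G.edge x)ᶜ : Set X)), ∑ h, G.diffForm pos y.1.1 h * (if r h = y' then (1 : ℝ) else 0)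
        = (G.delete x).diffForm {y | y.1 ∈ pos} y.1 y' := by
      intro y
      simp only [diffForm, Pi.sub_apply, sub_mul, Finset.sum_sub_distrib]
      rw [← hret y, ← hc (ho.rot ⟨y.1.1, y.2⟩)]
      have := hc (inc y)
      rw [show r (inc y) = y from hr y] at this
      rw [← this]
      rfl
    show ∑ h, G.form pos Ω t y.1.1 h * (if r h = y' then (1 : ℝ) else 0)
      = (G.delete x).form {y | y.1 ∈ pos} (fun y => Ω y) (fun y => t y) y.1 y'
    by_cases hy₁ : G.σ₁ y.1.1 = y.1.1
    · rw [form, form, if_pos hy₁, if_pos ((delete_σ₁_eq_iff x y.1).mpr hy₁)]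
      exact hs y
    · rw [form, form, if_neg hy₁, if_neg fun h => hy₁ ((delete_σ₁_eq_iff x y.1).mp h)]
      simp only [Pi.add_apply, Pi.smul_apply, smul_eq_mul, add_mul, Finset.sum_add_distrib,
        mul_assoc, ← Finset.mul_sum]
      rw [hs y, hd y]
      rw [show G.twin y.1.1 = ((G.delete x).twin y.1 : X) from rfl]
      rw [hs ⟨(G.delete x).twin y.1, (ho.twin_mem hy₁).mpr y.2⟩]
  · intro h hh
    rw [uncoupledMatrix_of_mem ho Ω t hx hx₁ h (hrange h hh), one_smul]
    funext z
    simp [diffForm, coord, Pi.single_apply, Subtype.ext_iff, ho.rot_val, eq_comm]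
  · exact fun h hh => hrot h (hrange h hh)
  · simp
  · intro h hh
    exact hlt h (hrange h hh)

open Classical in
-- If deletion leaves a vertex without half-ribbons, the left side is 0 by the count of bare
-- vertices and the right side by singularity of the matrix. Otherwise the contraction applies.
theorem closedValue_delete {pos tail : Set X} [Fintype X] (ho : G.IsOrientation pos) (Ω t : X → ℝ)
    {x : X} (hx : x ∈ pos) (hx₁ : G.σ₁ x ≠ x) :
    (G.delete x).closedValue {y | y.1 ∈ pos} {y | y.1 ∈ tail} (fun y => Ω y) (fun y => t y)
      = if G.bare = 0 then (∏ e : (tail \ G.edge x : Set X), t e)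
        * (ho.uncoupledMatrix Ω t hx hx₁).det else 0 := by
  have hbare : (G.delete x).bare = G.bare + Nat.card {v : Quotient G.vertexSetoid //
    ∀ y, Quotient.mk G.vertexSetoid y = v → y ∈ G.edge x} := rfl
  rw [closedValue_eq_ite]
  by_cases hb : G.bare = 0
  swap
  · rw [if_neg (by omega), if_neg hb]
  rw [if_pos hb]
  by_cases hv : ∃ v : Quotient G.vertexSetoid, ∀ y, Quotient.mk G.vertexSetoid y = v → y ∈ G.edge x
  · obtain ⟨v, hv⟩ := hv
    rw [det_uncoupledMatrix_eq_zero ho Ω t hx hx₁ v hv, mul_zero, if_neg]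
    have : 0 < Nat.card {v : Quotient G.vertexSetoid //
      ∀ y, Quotient.mk G.vertexSetoid y = v → y ∈ G.edge x} :=
      Nat.card_pos_iff.mpr ⟨⟨v, hv⟩, inferInstance⟩
    omega
  · push Not at hv
    haveI : IsEmpty {v : Quotient G.vertexSetoid //
      ∀ y, Quotient.mk G.vertexSetoid y = v → y ∈ G.edge x} := ⟨fun v => by
        obtain ⟨y, h1, h2⟩ := hv v.1
        exact h2 (v.2 y h1)⟩
    rw [if_pos (by rw [hbare, hb, Nat.card_of_isEmpty]), det_uncoupledMatrix ho Ω t hx hx₁ hv]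
    congr 1
    refine Fintype.prod_equiv
      { toFun := fun e => ⟨e.1.1, e.2, e.1.2⟩
        invFun := fun e => ⟨⟨e.1, e.2.2⟩, e.2.1⟩
        left_inv := fun _ => rfl
        right_inv := fun _ => rfl } _ _ fun _ => rfl

end Delete

/-! ### The reduction relation -/

section Reduction

/-- One orientation and one tail serve for all five graphs, so every term is the matrix of `G` with
only the two rows of the edge replaced; the relation is then the alternating expansion, times the
product of `t` over the other edges. -/
theorem HU_reduction [Finite X] {Ω t : X → ℝ} (hG : G.Orientable) (hΩ : G.IsEdgeFunction Ω)
    (ht : G.IsEdgeFunction t) (x : X) (hx₁ : G.σ₁ x ≠ x) (htx : t x ≠ 0) :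
    G.HU Ω t = t x * (G.delete x).HU (fun y => Ω y) (fun y => t y)
        + t x * Ω x ^ 2 * (G.cut x).HU Ω t
        + Ω x * ((G.partialDual x hx₁).delete x).HU (fun y => Ω y) (fun y => t y)
        + Ω x * t x ^ 2 * ((G.partialDual x hx₁).cut x).HU Ω t := by
  classical
  letI := Fintype.ofFinite X
  -- The complement of an orientation is an orientation, so `x` may be assumed to be one of its
  -- crosses.
  obtain ⟨pos, ho, hx⟩ : ∃ pos, G.IsOrientation pos ∧ x ∈ pos := by
    obtain ⟨pos, ho⟩ := hG
    by_cases hx : x ∈ pos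
    exacts [⟨pos, ho, hx⟩, ⟨posᶜ, ho.compl, hx⟩]
  obtain ⟨tail, h⟩ := ho.exists_isTail
  have ho' := ho.partialDual hx₁
  have h' := h.partialDual hx₁
  have hx₁' : (G.partialDual x hx₁).σ₁ x ≠ x := fun h => hx₁ ((partialDual_σ₁_ne_iff hx₁ x).mp h)
  rw [HU_eq ho h hΩ ht, HU_eq (ho.delete x) (h.delete x) (hΩ.delete x) (ht.delete x),
    HU_eq (ho.cut x) (h.cut x) (hΩ.cut x) (ht.cut x),
    HU_eq (ho'.delete x) (h'.delete x) ((hΩ.partialDual hx₁).delete x)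
      ((ht.partialDual hx₁).delete x),
    HU_eq (ho'.cut x) (h'.cut x) ((hΩ.partialDual hx₁).cut x) ((ht.partialDual hx₁).cut x),
    closedValue_delete ho Ω t hx hx₁, closedValue_delete ho' Ω t hx hx₁',
    closedValue_eq_ite, closedValue_eq_ite, closedValue_eq_ite]
  have b1 : (G.cut x).bare = G.bare := rfl
  have b2 : (G.partialDual x hx₁).bare = G.bare := rfl
  have b3 : ((G.partialDual x hx₁).cut x).bare = G.bare := rfl
  rw [b1, b2, b3, edge_partialDual]
  by_cases hb : G.bare = 0
  swap
  · simp [hb]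
  simp only [if_pos hb]
  rw [prod_tail_eq_mul ho h ht hx₁, formMatrix_cut ho Ω t hx hx₁, formMatrix_cut ho' Ω t hx hx₁',
    IsOrientation.uncoupledMatrix, IsOrientation.uncoupledMatrix]
  simp only [twin_partialDual]
  rw [updateRow_formMatrix_partialDual hx₁ ho Ω t hx, updateRow_formMatrix_partialDual hx₁ ho Ω t hx]
  -- Partial duality exchanges the successors of the two ends of the edge, that is `q` and `q'` in
  -- the expansion.
  have s1 : (G.partialDual x hx₁).σ₀ x = G.σ₀ (G.twin x) := dualσ₀_of_mem G (G.mem_edge_self x)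
  have s2 : (G.partialDual x hx₁).σ₀ (G.twin x) = G.σ₀ x := by
    rw [show (G.partialDual x hx₁).σ₀ (G.twin x) = G.σ₀ (G.twin (G.twin x)) from
      dualσ₀_of_mem G ((G.twin_mem_edge x x).mpr (G.mem_edge_self x)), twin_twin]
  simp only [sumForm, diffForm, s1, s2]
  have hij : (⟨x, hx⟩ : pos) ≠ ⟨G.twin x, (ho.twin_mem hx₁).mpr hx⟩ := by
    simpa using (G.twin_ne x).symm
  have key := det_updateRow_expansion (G.formMatrix pos Ω t) hij (Ω x) (t x) htx (coord pos x)
    (coord pos (G.twin x)) (coord pos (G.σ₀ x)) (coord pos (G.σ₀ (G.twin x)))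
  have hself : ((G.formMatrix pos Ω t).updateRow ⟨x, hx⟩ (G.form pos Ω t x)).updateRow
      ⟨G.twin x, (ho.twin_mem hx₁).mpr hx⟩ (G.form pos Ω t (G.twin x)) = G.formMatrix pos Ω t := by
    rw [show G.form pos Ω t x = (G.formMatrix pos Ω t) ⟨x, hx⟩ from rfl, Matrix.updateRow_eq_self]
    rw [show G.form pos Ω t (G.twin x)
      = (G.formMatrix pos Ω t) ⟨G.twin x, (ho.twin_mem hx₁).mpr hx⟩ from rfl,
      Matrix.updateRow_eq_self]
  rw [form, form, if_neg hx₁, if_neg (G.σ₁_twin_ne hx₁), twin_twin, hΩ.twin, ht.twin] at hself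
  simp only [sumForm, diffForm] at hself
  rw [hself] at key
  linear_combination (∏ e : (tail \ G.edge x : Set X), t e) * key

end Reduction

end RibbonGraph
end HyperbolicPolynomial

theorem theorem5p1 :
    -- The determinant can be written for every orientable ribbon graph with flags, it does not
    -- depend on the choices made to write it, and it is a polynomial in the edge variables.
    (∀ (X : Type*) [Finite X] (G : HyperbolicPolynomial.RibbonGraph X), G.Orientable →
      Nonempty G.Presentation ∧
      ∃ p : MvPolynomial (X ⊕ X) ℝ, ∀ Ω t : X → ℝ,
        G.IsEdgeFunction Ω → G.IsEdgeFunction t → (∀ x, G.σ₁ x ≠ x → t x ≠ 0) →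
        (∀ P : G.Presentation, P.value Ω t = G.HU Ω t) ∧
        G.HU Ω t = MvPolynomial.eval (Sum.elim Ω t) p) ∧
    -- Multiplicativity over disjoint unions.
    (∀ (X Y : Type*) [Finite X] [Finite Y] (G : HyperbolicPolynomial.RibbonGraph X)
      (H : HyperbolicPolynomial.RibbonGraph Y) (Ω t : X → ℝ) (Ω' t' : Y → ℝ),
      G.Orientable → H.Orientable →
      G.IsEdgeFunction Ω → G.IsEdgeFunction t → (∀ x, G.σ₁ x ≠ x → t x ≠ 0) →
      H.IsEdgeFunction Ω' → H.IsEdgeFunction t' → (∀ y, H.σ₁ y ≠ y → t' y ≠ 0) →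
      (G.disjointUnion H).HU (Sum.elim Ω Ω') (Sum.elim t t') = G.HU Ω t * H.HU Ω' t') ∧
    -- The reduction relation for the edge through the cross `x`.
    (∀ (X : Type*) [Finite X] (G : HyperbolicPolynomial.RibbonGraph X) (Ω t : X → ℝ),
      G.Orientable → G.IsEdgeFunction Ω → G.IsEdgeFunction t → (∀ x, G.σ₁ x ≠ x → t x ≠ 0) →
      ∀ (x : X) (hx : G.σ₁ x ≠ x),
      G.HU Ω t =
        t x * (G.delete x).HU (fun y => Ω y) (fun y => t y)
        + t x * Ω x ^ 2 * (G.cut x).HU Ω t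
        + Ω x * ((G.partialDual x hx).delete x).HU (fun y => Ω y) (fun y => t y)
        + Ω x * t x ^ 2 * ((G.partialDual x hx).cut x).HU Ω t) ∧
    -- Isolated vertices.
    (∀ (X : Type*) [Finite X] (G : HyperbolicPolynomial.RibbonGraph X) (Ω t : X → ℝ) (n : ℕ),
      G.IsIsolatedVertex n → G.HU Ω t = if Odd n then 2 else 0) := by
  refine ⟨fun X _ G hG => ⟨hG.nonempty_presentation, ?_⟩,
    fun X Y _ _ G H Ω t Ω' t' hG hH hΩ ht _ hΩ' ht' _ =>
      HyperbolicPolynomial.RibbonGraph.HU_disjointUnion hG hH hΩ ht hΩ' ht',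
    fun X _ G Ω t hG hΩ ht htx x hx =>
      HyperbolicPolynomial.RibbonGraph.HU_reduction hG hΩ ht x hx (htx x hx),
    fun X _ G Ω t n hG => HyperbolicPolynomial.RibbonGraph.HU_isolatedVertex hG Ω t⟩
  obtain ⟨P⟩ := hG.nonempty_presentation
  obtain ⟨p, hp⟩ := P.exists_polynomial
  exact ⟨p, fun Ω t hΩ ht htx => ⟨fun P' => P'.value_eq_HU hΩ ht,
    (P.value_eq_HU hΩ ht).symm.trans (hp Ω t htx)⟩⟩
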